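/- Units are $8\pi G=c=1$. Let $\Lambda<0$ and $0<\gamma<1$. **Interior.** Let $(M^-,g^-)$ be a spherically symmetric, spatially flat FLRW spacetime, $g^-=-dt^2+a(t)^2\big(dR^2+R^2(dx^2+\sin^2x\,dy^2)\big)$, inextendible in time, whose density $\rho=3\dot a^2/a^2-\Lambda$ and pressure $p=-2\ddot a/a-\dot a^2/a^2+\Lambda$ satisfy $p=\gamma\rho$. **Exterior.** The candidates for $(M^+,g^+)$ are the generalised Vaidya metrics $g^+=-\chi\,du^2+2\varepsilon\,du\,dr+r^2(d\theta^2+\sin^2\theta\,d\phi^2)$, $\chi=1-\frac{2m(u)}{r}-\frac{\Lambda}{3}r^2$, with $\varepsilon=\pm1$ and $u$ growing towards the future. **Matching.** The two are matched across a timelike surface of symmetry $\sigma=\{t=\tau,\ R=R(\tau)\}=\{u=u(\tau),\ r=r(\tau)\}$, with $\tau$ in an open interval and the angles identified, if the first and the second fundamental forms of $\sigma$ from both sides agree; $\overline\epsilon\epsilon=\pm1$ is the relative orientation of the unit normals $n^-=\epsilon\,(a\dot R\,\partial_t+a^{-1}\partial_R)/\sqrt{1-a^2\dot R^2}$ and $n^+=\overline\epsilon\,(\varepsilon\dot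 u\,\partial_u+(\chi\dot u-\varepsilon\dot r)\,\partial_r)/\sqrt{\chi\dot u^2-2\varepsilon\dot u\dot r}$. **(1)** For every interior as above and all signs $\varepsilon$, $\overline\epsilon\epsilon$ there is a one-parameter family of timelike surfaces of symmetry $R=R_c(\tau)$, the parameter $c$ running over a nonempty open interval and being the additive constant of $R_c$, each given on a nonempty open time interval $I_c$ that depends on $\varepsilon$, $\overline\epsilon\epsilon$ (and $c$), across which the interior matches an exterior. The matched spacetime satisfies the dominant energy conditions: $\rho\ge0$, $\rho+p\ge0$, $\rho\ge p$ in the interior and $\varepsilon\,dm/du\ge0$ in the exterior. Every matching surface with these signs belongs to the family, on a subinterval of the corresponding $I_c$. **(2)** Given the interior and $c$ (for these signs), the exterior is uniquely determined along $\sigma$: $\varepsilon$, $\overline\epsilon\epsilon$, $r(\tau)$, and, up to a common translation of the null coordinate $u$, the functions $u(\tau)$ and $m(u)$ on the range of $u(\tau)$. **(3)** Let $\varepsilon=\overline\epsilon\epsilon=1$. There are nonempty open sets of initial data $(a,\dot a,R)$ at $\tau=t_0$, one for which $\dot r(t_0)<0$ (collapse) and one for which $\dot r(t_0)>0$ (expansion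 followed by recollapse), such that all their data $(a,\dot a)$ occur in interiors as above, every such interior has at some time data in each of them, and for every interior with such data at $t_0$ there is a matched spacetime as in (1), with $R(t_0)$ as prescribed, for which: the matching lasts from $t_0$ until the end $T$ of the interior; all symmetry spheres on the initial surface ($t=t_0$ in the interior, $u=u(t_0)$ in the exterior) are untrapped; the area radius of $\sigma$ increases up to some time in $[t_0,T)$ (which is $t_0$ if $\dot r(t_0)<0$), then decreases and tends to $0$ as $\tau\to T$, where $\rho\to\infty$; there is $\tau_H\in(t_0,T)$ such that all symmetry spheres with $t=\tau$, or with $u=u(\tau)$, are untrapped for $t_0\le\tau<\tau_H$, while for $\tau\ge\tau_H$ there is an apparent horizon on both sides of $\sigma$ (meeting $\sigma$ at $\tau_H$), i.e. one future marginally trapped sphere $R=R_H(\tau)$ on $t=\tau$ and one $r=r_H(\tau)$ on $u=u(\tau)$, the spheres between it and $\sigma$ being future trapped and the spheres on its other side untrapped; and the exterior has $m>0$, is asymptotically anti-de Sitter as $r\to\infty$, and contains a spherical black hole: from events with $u=u(\tau)$ and $r$ sufficiently large, future-directed causal curves reach $r=\infty$, but for $\tau>\tau_H$ no future-directed causal curve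 of the matched spacetime does so from an interior event with $t=\tau$, or from an exterior event with $u=u(\tau)$ behind the apparent horizon. -/

import Mathlib

open Set Filter Topology

noncomputable section

namespace CollapseModel

/-! ## Coordinate differential geometry -/

/-- Points (and tangent vectors) in a four-dimensional coordinate chart. -/
abbrev Coord := Fin 4 → ℝ

/-- A metric tensor in a four-dimensional coordinate chart. -/
abbrev MetricField := Coord → Matrix (Fin 4) (Fin 4) ℝ

/-- The partial derivative `∂F/∂xⁱ`. -/
def pderiv {n : ℕ} (i : Fin n) (F : (Fin n → ℝ) → ℝ) (x : Fin n → ℝ) : ℝ :=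
  deriv (fun s => F (Function.update x i s)) (x i)

/-- The scalar product `g(v, w)` at the point `x`. -/
def metricProd (g : MetricField) (x v w : Coord) : ℝ :=
  ∑ α, ∑ β, g x α β * v α * w β

/-- The covector `v_μ = g_{μν} v^ν` at the point `x`. -/
def lower (g : MetricField) (x v : Coord) (μ : Fin 4) : ℝ := ∑ ν, g x μ ν * v ν

/-- The Christoffel symbols `Γ^μ_{αβ}` of the Levi-Civita connection. -/
def christoffel (g : MetricField) (μ α β : Fin 4) (x : Coord) : ℝ :=
  (1 / 2) * ∑ ν, (g x)⁻¹ μ ν *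
    (pderiv α (fun y => g y ν β) x + pderiv β (fun y => g y ν α) x
      - pderiv ν (fun y => g y α β) x)

/-- The tangent vector `e_i = ∂Φ/∂ξⁱ` of a parametrized hypersurface. -/
def tangent (Φ : (Fin 3 → ℝ) → Coord) (i : Fin 3) (ξ : Fin 3 → ℝ) : Coord :=
  fun μ => pderiv i (fun ζ => Φ ζ μ) ξ

/-- The first fundamental form of a parametrized hypersurface. -/
def firstForm (g : MetricField) (Φ : (Fin 3 → ℝ) → Coord) (ξ : Fin 3 → ℝ) (i j : Fin 3) : ℝ :=
  metricProd g (Φ ξ) (tangent Φ i ξ) (tangent Φ j ξ)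

/-- The second fundamental form
`K_{ij} = -n_μ (∂²Φ^μ/∂ξⁱ∂ξʲ + Γ^μ_{αβ} e_i^α e_j^β)` with respect to the normal `n`. -/
def secondForm (g : MetricField) (Φ : (Fin 3 → ℝ) → Coord) (n : Coord) (ξ : Fin 3 → ℝ)
    (i j : Fin 3) : ℝ :=
  -∑ μ, lower g (Φ ξ) n μ *
    (pderiv i (fun ζ => tangent Φ j ζ μ) ξ
      + ∑ α, ∑ β, christoffel g μ α β (Φ ξ) * tangent Φ i ξ α * tangent Φ j ξ β)

/-- `n` is a (spacelike) unit normal of the parametrized hypersurface at parameter `ξ`. -/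
def IsUnitNormal (g : MetricField) (Φ : (Fin 3 → ℝ) → Coord) (n : Coord) (ξ : Fin 3 → ℝ) : Prop :=
  (∀ i, metricProd g (Φ ξ) n (tangent Φ i ξ) = 0) ∧ metricProd g (Φ ξ) n n = 1

/-! ## Trapped surfaces

The surfaces are those on which the first two coordinates are constant. `T` is a timelike vector
field that fixes the time orientation. -/

/-- The coordinates on the surfaces: the third and the fourth one. -/
def surfIdx : Fin 2 → Fin 4 := ![2, 3]

/-- `k`, `l` are future-directed null normals, with `k·l = -1`, of the surface through `x`. -/
structure IsFutureNullPair (g : MetricField) (T : Coord → Coord) (x k l : Coord) : Prop where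
  null_left : metricProd g x k k = 0
  null_right : metricProd g x l l = 0
  cross : metricProd g x k l = -1
  normal_left : ∀ A, lower g x k (surfIdx A) = 0
  normal_right : ∀ A, lower g x l (surfIdx A) = 0
  future_left : metricProd g x k (T x) < 0
  future_right : metricProd g x l (T x) < 0

/-- The null expansion `θ = -η^{AB} k_μ e_A^ν ∇_ν e_B^μ = -η^{AB} k_μ Γ^μ_{AB}`, where `η` is the
induced metric of the surface. -/
def expansion (g : MetricField) (x k : Coord) : ℝ :=
  -∑ A, ∑ B, ((g x).submatrix surfIdx surfIdx)⁻¹ A B *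
    ∑ μ, lower g x k μ * christoffel g μ (surfIdx A) (surfIdx B) x

/-- The null normals are unique up to exchange and `(k, l) ↦ (c k, c⁻¹ l)` with `c > 0`, so the
three notions below do not depend on the choice of the pair. -/
def IsUntrapped (g : MetricField) (T : Coord → Coord) (x : Coord) : Prop :=
  ∃ k l, IsFutureNullPair g T x k l ∧ expansion g x k * expansion g x l < 0

/-- Future trapped: both future null expansions are negative. -/
def IsFutureTrapped (g : MetricField) (T : Coord → Coord) (x : Coord) : Prop :=
  ∃ k l, IsFutureNullPair g T x k l ∧ expansion g x k < 0 ∧ expansion g x l < 0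

/-- Future marginally trapped: one of the future null expansions vanishes, the other one is
negative. An apparent horizon is foliated by such surfaces. -/
def IsFutureMarginallyTrapped (g : MetricField) (T : Coord → Coord) (x : Coord) : Prop :=
  ∃ k l, IsFutureNullPair g T x k l ∧ expansion g x k = 0 ∧ expansion g x l < 0

/-! ## The interior: spatially flat FLRW in spherical symmetry -/

/-- A nonempty open interval. -/
def IsOpenInterval (I : Set ℝ) : Prop := I.Nonempty ∧ IsOpen I ∧ I.OrdConnected

/-- `ds² = -dt² + a(t)² (dR² + R² (dx² + sin² x dy²))` in the coordinates `(t, R, x, y)`. -/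
def interiorMetric (a : ℝ → ℝ) : MetricField := fun X =>
  Matrix.diagonal ![-1, a (X 0) ^ 2, a (X 0) ^ 2 * X 1 ^ 2,
    a (X 0) ^ 2 * X 1 ^ 2 * Real.sin (X 2) ^ 2]

/-- The future-directed field `∂_t`. -/
def interiorTime : Coord → Coord := fun _ => ![1, 0, 0, 0]

/-- The energy density, from the Friedmann equations with `k = 0` and `8πG = c = 1`. -/
def density (Λ : ℝ) (a : ℝ → ℝ) (t : ℝ) : ℝ := 3 * deriv a t ^ 2 / a t ^ 2 - Λ

/-- The pressure, from the Friedmann equations with `k = 0` and `8πG = c = 1`. -/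
def pressure (Λ : ℝ) (a : ℝ → ℝ) (t : ℝ) : ℝ :=
  -2 * deriv (deriv a) t / a t - deriv a t ^ 2 / a t ^ 2 + Λ

/-- `a` is the scale factor, on the time interval `J`, of a flat FLRW spacetime whose fluid has
the equation of state `p = γ ρ`. -/
structure IsFlatFLRW (Λ γ : ℝ) (J : Set ℝ) (a : ℝ → ℝ) : Prop where
  interval : IsOpenInterval J
  smooth : ContDiffOn ℝ 2 a J
  pos : ∀ t ∈ J, 0 < a t
  eos : ∀ t ∈ J, pressure Λ a t = γ * density Λ a t

/-- A flat FLRW spacetime with `p = γ ρ` that is inextendible in time. -/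
structure IsFLRWInterior (Λ γ : ℝ) (J : Set ℝ) (a : ℝ → ℝ) : Prop extends
    IsFlatFLRW Λ γ J a where
  maximal : ∀ J' a', IsFlatFLRW Λ γ J' a' → J ⊆ J' → EqOn a' a J → J' = J

/-- The dominant energy condition for the fluid in the interior. -/
def InteriorDEC (Λ : ℝ) (J : Set ℝ) (a : ℝ → ℝ) : Prop :=
  ∀ t ∈ J, 0 ≤ density Λ a t ∧ 0 ≤ density Λ a t + pressure Λ a t ∧
    pressure Λ a t ≤ density Λ a t

/-! ## The exterior: generalised Vaidya with spherical symmetry (`b = 1`) -/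

/-- `χ = 1 - 2 m(u)/r - (Λ/3) r²`. -/
def chi (Λ : ℝ) (m : ℝ → ℝ) (u r : ℝ) : ℝ := 1 - 2 * m u / r - Λ / 3 * r ^ 2

/-- `ds² = -χ du² + 2 ε du dr + r² (dθ² + sin² θ dφ²)` in the coordinates `(u, r, θ, φ)`. -/
def exteriorMetric (Λ ε : ℝ) (m : ℝ → ℝ) : MetricField := fun X =>
  !![-chi Λ m (X 0) (X 1), ε, 0, 0;
     ε, 0, 0, 0;
     0, 0, X 1 ^ 2, 0;
     0, 0, 0, X 1 ^ 2 * Real.sin (X 2) ^ 2]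

/-- A timelike field fixing the time orientation in which `u` grows towards the future: the sum of
the null fields `-ε ∂_r` and `∂_u + (ε χ / 2) ∂_r`. -/
def exteriorTime (Λ ε : ℝ) (m : ℝ → ℝ) : Coord → Coord := fun X =>
  ![1, ε * (chi Λ m (X 0) (X 1) / 2 - 1), 0, 0]

/-- The dominant energy condition for the null radiation in the exterior, for `u ∈ S`. -/
def ExteriorDEC (ε : ℝ) (S : Set ℝ) (m : ℝ → ℝ) : Prop := ∀ u ∈ S, 0 ≤ ε * deriv m u

/-! ## Matching -/

/-- `ε = ±1`. -/
def IsSign (ε : ℝ) : Prop := ε = 1 ∨ ε = -1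

/-- The symmetry surface `σ⁻ = {t = τ, R = R(τ), x = ϑ, y = φ}`. -/
def interiorSurface (R : ℝ → ℝ) : (Fin 3 → ℝ) → Coord := fun ξ => ![ξ 0, R (ξ 0), ξ 1, ξ 2]

/-- The symmetry surface `σ⁺ = {u = u(τ), r = r(τ), θ = ϑ, φ = φ}`. -/
def exteriorSurface (u r : ℝ → ℝ) : (Fin 3 → ℝ) → Coord :=
  fun ξ => ![u (ξ 0), r (ξ 0), ξ 1, ξ 2]

/-- The normal of `σ⁻` that points to growing `R`. -/
def interiorNormal (a R : ℝ → ℝ) (τ : ℝ) : Coord :=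
  (Real.sqrt (1 - a τ ^ 2 * deriv R τ ^ 2))⁻¹ • ![a τ * deriv R τ, 1 / a τ, 0, 0]

/-- The normal of `σ⁺`; the sign `s` is its orientation relative to `interiorNormal`. -/
def exteriorNormal (Λ ε s : ℝ) (u r m : ℝ → ℝ) (τ : ℝ) : Coord :=
  (s / Real.sqrt (chi Λ m (u τ) (r τ) * deriv u τ ^ 2 - 2 * ε * deriv u τ * deriv r τ)) •
    ![ε * deriv u τ, chi Λ m (u τ) (r τ) * deriv u τ - ε * deriv r τ, 0, 0]

/-- The flat FLRW spacetime with scale factor `a` and the exterior with mass function `m` and sign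
`ε` match, for `τ ∈ I`, across the timelike symmetry surface `σ` given by `R` in the interior and
by `(u, r)` in the exterior, with relative orientation `s` of the normals: both fundamental forms
agree. The coordinate `u` grows towards the future along `σ`. -/
structure Matches (a : ℝ → ℝ) (Λ ε s : ℝ) (I : Set ℝ) (R u r m : ℝ → ℝ) : Prop where
  smooth_R : ContDiffOn ℝ 2 R I
  smooth_u : ContDiffOn ℝ 2 u I
  smooth_r : ContDiffOn ℝ 2 r I
  smooth_m : ContDiffOn ℝ 2 m (u '' I)
  pos_R : ∀ τ ∈ I, 0 < R τ
  pos_r : ∀ τ ∈ I, 0 < r τ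
  future_u : ∀ τ ∈ I, 0 < deriv u τ
  timelike_int : ∀ τ ∈ I, ∀ ϑ ∈ Ioo 0 Real.pi, ∀ φ : ℝ,
    firstForm (interiorMetric a) (interiorSurface R) ![τ, ϑ, φ] 0 0 < 0
  timelike_ext : ∀ τ ∈ I, ∀ ϑ ∈ Ioo 0 Real.pi, ∀ φ : ℝ,
    firstForm (exteriorMetric Λ ε m) (exteriorSurface u r) ![τ, ϑ, φ] 0 0 < 0
  normal_int : ∀ τ ∈ I, ∀ ϑ ∈ Ioo 0 Real.pi, ∀ φ : ℝ,
    IsUnitNormal (interiorMetric a) (interiorSurface R) (interiorNormal a R τ) ![τ, ϑ, φ]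
  normal_ext : ∀ τ ∈ I, ∀ ϑ ∈ Ioo 0 Real.pi, ∀ φ : ℝ,
    IsUnitNormal (exteriorMetric Λ ε m) (exteriorSurface u r) (exteriorNormal Λ ε s u r m τ)
      ![τ, ϑ, φ]
  first_eq : ∀ τ ∈ I, ∀ ϑ ∈ Ioo 0 Real.pi, ∀ φ : ℝ, ∀ i j,
    firstForm (exteriorMetric Λ ε m) (exteriorSurface u r) ![τ, ϑ, φ] i j =
      firstForm (interiorMetric a) (interiorSurface R) ![τ, ϑ, φ] i j
  second_eq : ∀ τ ∈ I, ∀ ϑ ∈ Ioo 0 Real.pi, ∀ φ : ℝ, ∀ i j,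
    secondForm (exteriorMetric Λ ε m) (exteriorSurface u r) (exteriorNormal Λ ε s u r m τ)
        ![τ, ϑ, φ] i j =
      secondForm (interiorMetric a) (interiorSurface R) (interiorNormal a R τ) ![τ, ϑ, φ] i j

/-! ## The matched spacetime for `ε = s = 1`: causality, infinity, black hole -/

/-- The interior region, bounded by `σ⁻`. -/
def interiorRegion (I : Set ℝ) (R : ℝ → ℝ) : Set Coord :=
  {X | X 0 ∈ I ∧ 0 ≤ X 1 ∧ X 1 ≤ R (X 0)}

/-- The exterior region, bounded by `σ⁺` and extending to `r = ∞`; it is the side of `σ⁺` to which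
the normal points when its relative orientation is `s = 1`. -/
def exteriorRegion (I : Set ℝ) (u r : ℝ → ℝ) : Set Coord :=
  {X | ∃ τ ∈ I, X 0 = u τ ∧ r τ ≤ X 1}

/-- A future-directed causal `C¹` curve in the region `D`, with parameter interval `S`. -/
def IsCausalCurve (g : MetricField) (T : Coord → Coord) (D : Set Coord) (S : Set ℝ)
    (x : ℝ → Coord) : Prop :=
  ContDiffOn ℝ 1 x S ∧ ∀ l ∈ S, x l ∈ D ∧
    metricProd g (x l) (derivWithin x S l) (derivWithin x S l) ≤ 0 ∧
    metricProd g (x l) (derivWithin x S l) (T (x l)) < 0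

/-- Events of the matched spacetime: interior (`inl`) and exterior (`inr`) ones; the events of
`σ⁻` and `σ⁺` are identified by the steps `out` and `into` below. -/
abbrev Event := Coord ⊕ Coord

/-- A causal curve in one of the two regions, or a passage through `σ`. -/
inductive CausalStep (a : ℝ → ℝ) (Λ : ℝ) (I : Set ℝ) (R u r m : ℝ → ℝ) : Event → Event → Prop
  | interior (x : ℝ → Coord)
      (hx : IsCausalCurve (interiorMetric a) interiorTime (interiorRegion I R) (Icc 0 1) x) :
      CausalStep a Λ I R u r m (Sum.inl (x 0)) (Sum.inl (x 1))
  | exterior (x : ℝ → Coord)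
      (hx : IsCausalCurve (exteriorMetric Λ 1 m) (exteriorTime Λ 1 m) (exteriorRegion I u r)
        (Icc 0 1) x) :
      CausalStep a Λ I R u r m (Sum.inr (x 0)) (Sum.inr (x 1))
  | out (τ : ℝ) (hτ : τ ∈ I) (ϑ φ : ℝ) :
      CausalStep a Λ I R u r m (Sum.inl ![τ, R τ, ϑ, φ]) (Sum.inr ![u τ, r τ, ϑ, φ])
  | into (τ : ℝ) (hτ : τ ∈ I) (ϑ φ : ℝ) :
      CausalStep a Λ I R u r m (Sum.inr ![u τ, r τ, ϑ, φ]) (Sum.inl ![τ, R τ, ϑ, φ])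

/-- The event `e` lies in the causal past of infinity: a future-directed, piecewise `C¹` causal
curve of the matched spacetime leads from `e` to `r = ∞`, at a value of `u` of the exterior. -/
def IsVisible (a : ℝ → ℝ) (Λ : ℝ) (I : Set ℝ) (R u r m : ℝ → ℝ) (e : Event) : Prop :=
  ∃ x : ℝ → Coord, Relation.ReflTransGen (CausalStep a Λ I R u r m) e (Sum.inr (x 0)) ∧
    IsCausalCurve (exteriorMetric Λ 1 m) (exteriorTime Λ 1 m) (exteriorRegion I u r)
      (Ico 0 1) x ∧
    Tendsto (fun l => x l 1) (𝓝[<] 1) atTop ∧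
    ∃ τ ∈ I, Tendsto (fun l => x l 0) (𝓝[<] 1) (𝓝 (u τ))

/-- The orders of the fall-off towards the anti-de Sitter metric: `O(1/r)` for the components
along `u, θ, φ`, faster by three powers of `r` for the mixed ones and by four for `dr²`. -/
def fallOff (μ ν : Fin 4) : ℕ := if μ = 1 ∧ ν = 1 then 5 else if μ = 1 ∨ ν = 1 then 4 else 1

/-- The metric `g` approaches, as `r → ∞` at the given `u`, the anti-de Sitter metric (the exterior
metric with `m = 0`, `Λ < 0`). -/
def IsAsymptoticallyAdS (Λ ε : ℝ) (g : MetricField) (u : ℝ) : Prop :=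
  ∀ θ φ : ℝ, ∀ μ ν : Fin 4,
    (fun r : ℝ => g ![u, r, θ, φ] μ ν - exteriorMetric Λ ε (fun _ => 0) ![u, r, θ, φ] μ ν)
      =O[atTop] fun r : ℝ => (r ^ fallOff μ ν)⁻¹

/-- The matched spacetime (with `ε = s = 1`) starts untrapped at `τ = t₀`, (re)collapses to a
singularity at `τ = T`, and forms at `τ = τH` an apparent horizon (at `R = RH(τ)` in the interior
and at `r = rH(τ)`, `u = u(τ)` in the exterior) and an asymptotically AdS black hole. -/
structure FormsBlackHole (Λ : ℝ) (J : Set ℝ) (a : ℝ → ℝ) (t₀ : ℝ) (I : Set ℝ)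
    (R u r m : ℝ → ℝ) (τm τH T : ℝ) (RH rH : ℝ → ℝ) : Prop where
  /-- The whole initial surface `t = t₀`, `u = u(t₀)` is untrapped in the interior. -/
  initial_int : ∀ X ∈ Ioc 0 (R t₀), ∀ ϑ ∈ Ioo 0 Real.pi, ∀ φ : ℝ,
    IsUntrapped (interiorMetric a) interiorTime ![t₀, X, ϑ, φ]
  /-- It is also untrapped in the exterior. -/
  initial_ext : ∀ X ∈ Ici (r t₀), ∀ ϑ ∈ Ioo 0 Real.pi, ∀ φ : ℝ,
    IsUntrapped (exteriorMetric Λ 1 m) (exteriorTime Λ 1 m) ![u t₀, X, ϑ, φ]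
  /-- The matching holds until the end `T` of the interior spacetime. -/
  isLUB_end : IsLUB J T
  until_end : ∀ τ ∈ J, t₀ ≤ τ → τ ∈ I
  /-- The area radius of `σ` grows until `τm` (which may be `t₀`) and then decreases to `0`. -/
  max_mem : τm ∈ Ico t₀ T
  expands : StrictMonoOn r (Icc t₀ τm)
  collapses : StrictAntiOn r (Ico τm T)
  to_zero : Tendsto r (𝓝[<] T) (𝓝 0)
  singular : Tendsto (density Λ a) (𝓝[<] T) atTop
  /-- There are no trapped surfaces before `τH`. -/
  horizon_mem : τH ∈ Ioo t₀ T
  before_int : ∀ τ ∈ Ico t₀ τH, ∀ X ∈ Ioc 0 (R τ), ∀ ϑ ∈ Ioo 0 Real.pi, ∀ φ : ℝ,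
    IsUntrapped (interiorMetric a) interiorTime ![τ, X, ϑ, φ]
  before_ext : ∀ τ ∈ Ico t₀ τH, ∀ X ∈ Ici (r τ), ∀ ϑ ∈ Ioo 0 Real.pi, ∀ φ : ℝ,
    IsUntrapped (exteriorMetric Λ 1 m) (exteriorTime Λ 1 m) ![u τ, X, ϑ, φ]
  /-- At `τH` the surface `σ` crosses the apparent horizon. -/
  cross_int : RH τH = R τH
  cross_ext : rH τH = r τH
  /-- The apparent horizon in the interior. -/
  RH_mem : ∀ τ ∈ Ico τH T, RH τ ∈ Ioc 0 (R τ)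
  RH_inside : ∀ τ ∈ Ico τH T, ∀ X ∈ Ioo 0 (RH τ), ∀ ϑ ∈ Ioo 0 Real.pi, ∀ φ : ℝ,
    IsUntrapped (interiorMetric a) interiorTime ![τ, X, ϑ, φ]
  RH_on : ∀ τ ∈ Ico τH T, ∀ ϑ ∈ Ioo 0 Real.pi, ∀ φ : ℝ,
    IsFutureMarginallyTrapped (interiorMetric a) interiorTime ![τ, RH τ, ϑ, φ]
  RH_outside : ∀ τ ∈ Ico τH T, ∀ X ∈ Ioc (RH τ) (R τ), ∀ ϑ ∈ Ioo 0 Real.pi, ∀ φ : ℝ,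
    IsFutureTrapped (interiorMetric a) interiorTime ![τ, X, ϑ, φ]
  /-- The apparent horizon in the exterior; once it has formed, `σ` lies behind it. -/
  rH_mem : ∀ τ ∈ Ioo τH T, r τ < rH τ
  rH_inside : ∀ τ ∈ Ico τH T, ∀ X ∈ Ico (r τ) (rH τ), ∀ ϑ ∈ Ioo 0 Real.pi, ∀ φ : ℝ,
    IsFutureTrapped (exteriorMetric Λ 1 m) (exteriorTime Λ 1 m) ![u τ, X, ϑ, φ]
  rH_on : ∀ τ ∈ Ico τH T, ∀ ϑ ∈ Ioo 0 Real.pi, ∀ φ : ℝ,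
    IsFutureMarginallyTrapped (exteriorMetric Λ 1 m) (exteriorTime Λ 1 m) ![u τ, rH τ, ϑ, φ]
  rH_outside : ∀ τ ∈ Ico τH T, ∀ X ∈ Ioi (rH τ), ∀ ϑ ∈ Ioo 0 Real.pi, ∀ φ : ℝ,
    IsUntrapped (exteriorMetric Λ 1 m) (exteriorTime Λ 1 m) ![u τ, X, ϑ, φ]
  /-- The exterior has positive mass and is asymptotically AdS. -/
  mass_pos : ∀ τ ∈ I, 0 < m (u τ)
  asymptoticallyAdS : ∀ τ ∈ I, IsAsymptoticallyAdS Λ 1 (exteriorMetric Λ 1 m) (u τ)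
  /-- Events near infinity are visible from infinity. -/
  visible : ∀ τ ∈ I, ∃ X₀, ∀ X ≥ X₀, ∀ ϑ φ : ℝ,
    IsVisible a Λ I R u r m (Sum.inr ![u τ, X, ϑ, φ])
  /-- There is a black hole: after `τH`, no event in the interior, and no event of the exterior
  behind the apparent horizon, is visible from infinity. -/
  blackHole_int : ∀ τ ∈ Ioo τH T, ∀ X ∈ Icc 0 (R τ), ∀ ϑ φ : ℝ,
    ¬ IsVisible a Λ I R u r m (Sum.inl ![τ, X, ϑ, φ])
  blackHole_ext : ∀ τ ∈ Ioo τH T, ∀ X ∈ Ico (r τ) (rH τ), ∀ ϑ φ : ℝ,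
    ¬ IsVisible a Λ I R u r m (Sum.inr ![u τ, X, ϑ, φ])

end CollapseModel

end

noncomputable section

namespace CollapseModel

/-! Write v = aR', w = a'R and δ = sε. Both fundamental forms are diagonal on a symmetry surface, so
the matching reduces to four scalar equations at each τ (`IsJunction`). The first form and the
angular part of the second form can be solved algebraically: r = aR, χ = 1 - w², hence m = ρr³/6,
and s u'(1 - δw) = 1 + δv (`IsJunction.chi_eq`, `IsJunction.mass_eq`, `IsJunction.null_eq`). Once
the equation of state has eliminated a'', the remaining radial equation fails exactly by a nonzero
multiple of δv - γ (`radial_defect`); the factor is nonzero because Λ < 0 forces ρ > 0. So matching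
means aR' = δγ: the surface is a primitive of δγ/a, free up to its additive constant, and only R > 0
and s(1 - δw) > 0, which is u' > 0, remain as conditions (`Matches.isSolution`, `exists_matches`).
The same positive quantity is a factor of ε m' u', which gives the energy condition of the exterior.
The speed determines δ and the side condition then determines s, whence uniqueness
(`exterior_unique`).

That the admissible times form an interval rests on a'' < 0 and on the monotonicity of δR - 1/a'
(`IsFlatFLRW.crossing_lt`). The interiors are explicit: the Hubble rate solves a Riccati equation
whose arctangent is linear in t, so a is a power of a cosine and every maximal solution recollapses
(`IsFLRWInterior.exists_eq`).

For ε = s = 1 the whole collapse is read off from w, which stays below 1, decreases once it is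
nonpositive, and eventually falls below -1. On σ one has r' = w + γ and χ = 1 - w², so w = -γ marks
the maximal radius and w = -1 the horizon; the data sets are given by -γ < w < 1 and -1 < w < -γ
(`exists_formsBlackHole`). Nothing escapes afterwards, because causal curves satisfy dr ≤ (χ/2) du:
where χ < 0 the radius cannot grow, the mass does not decrease, and so χ stays negative
(`IsCausalCurve.chi_neg`, `not_isVisible`). Far out, χ grows like r², so radial curves reach
infinity within a finite range of u (`isVisible_of_large`). -/

/-! ### Contracting Christoffel symbols without inverting the metric -/

/-- The Christoffel symbols of the first kind. -/
def christoffelFirst (g : MetricField) (ν α β : Fin 4) (x : Coord) : ℝ :=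
  (1 / 2) * (pderiv α (fun y => g y ν β) x + pderiv β (fun y => g y ν α) x
      - pderiv ν (fun y => g y α β) x)

/-- Lowering the index of n with g cancels the inverse metric in the Christoffel symbols. Second
forms and expansions can thus be computed from first derivatives of g alone; symmetry and
invertibility are only needed at the point. -/
theorem sum_lower_mul_christoffel {g : MetricField} {x : Coord} (hs : (g x).transpose = g x)
    (hd : (g x).det ≠ 0) (n : Coord) (α β : Fin 4) :
    ∑ μ, lower g x n μ * christoffel g μ α β x = ∑ ν, n ν * christoffelFirst g ν α β x := by
  have h1 : ∀ ν, ∑ μ, lower g x n μ * (g x)⁻¹ μ ν = n ν := by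
    intro ν
    have h2 : lower g x n = Matrix.vecMul n (g x) := by
      rw [← Matrix.mulVec_transpose, hs]; rfl
    have h3 : ∑ μ, lower g x n μ * (g x)⁻¹ μ ν = Matrix.vecMul (lower g x n) (g x)⁻¹ ν := rfl
    rw [h3, h2, Matrix.vecMul_vecMul, Matrix.mul_nonsing_inv _ (isUnit_iff_ne_zero.2 hd),
      Matrix.vecMul_one]
  calc ∑ μ, lower g x n μ * christoffel g μ α β x
      = ∑ μ, ∑ ν, lower g x n μ * (g x)⁻¹ μ ν * christoffelFirst g ν α β x := by
        refine Finset.sum_congr rfl fun μ _ => ?_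
        simp only [christoffel, christoffelFirst, Finset.mul_sum]
        exact Finset.sum_congr rfl fun ν _ => by ring
    _ = ∑ ν, n ν * christoffelFirst g ν α β x := by
        rw [Finset.sum_comm]
        refine Finset.sum_congr rfl fun ν _ => ?_
        rw [← Finset.sum_mul, h1]

theorem secondForm_eq {g : MetricField} {Φ : (Fin 3 → ℝ) → Coord} {ξ : Fin 3 → ℝ}
    (hs : (g (Φ ξ)).transpose = g (Φ ξ)) (hd : (g (Φ ξ)).det ≠ 0) (n : Coord) (i j : Fin 3) :
    secondForm g Φ n ξ i j =
      -(∑ μ, lower g (Φ ξ) n μ * pderiv i (fun ζ => tangent Φ j ζ μ) ξ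
        + ∑ α, ∑ β, (∑ ν, n ν * christoffelFirst g ν α β (Φ ξ)) *
          (tangent Φ i ξ α * tangent Φ j ξ β)) := by
  simp only [← sum_lower_mul_christoffel hs hd, secondForm, mul_add, Finset.sum_add_distrib]
  congr 2
  simp only [Finset.mul_sum, Finset.sum_mul]
  rw [Finset.sum_comm]
  refine Finset.sum_congr rfl fun α _ => ?_
  rw [Finset.sum_comm]
  exact Finset.sum_congr rfl fun β _ => Finset.sum_congr rfl fun μ _ => by ring

theorem expansion_eq {g : MetricField} {x : Coord}
    (hs : (g x).transpose = g x) (hd : (g x).det ≠ 0) (k : Coord) :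
    expansion g x k = -∑ A, ∑ B, ((g x).submatrix surfIdx surfIdx)⁻¹ A B *
      ∑ ν, k ν * christoffelFirst g ν (surfIdx A) (surfIdx B) x := by
  simp only [← sum_lower_mul_christoffel hs hd, expansion]

/-! ### Symmetry surfaces -/

/-- The symmetry surface with first two coordinates `p(τ)`, `q(τ)`. -/
def symmetrySurface (p q : ℝ → ℝ) : (Fin 3 → ℝ) → Coord := fun ξ => ![p (ξ 0), q (ξ 0), ξ 1, ξ 2]

theorem interiorSurface_eq (R : ℝ → ℝ) : interiorSurface R = symmetrySurface id R := rfl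

theorem exteriorSurface_eq (u r : ℝ → ℝ) : exteriorSurface u r = symmetrySurface u r := rfl

theorem tangent_symmetrySurface (p q : ℝ → ℝ) (i : Fin 3) (ξ : Fin 3 → ℝ) :
    tangent (symmetrySurface p q) i ξ =
      match i with
      | 0 => ![deriv p (ξ 0), deriv q (ξ 0), 0, 0]
      | 1 => ![0, 0, 1, 0]
      | 2 => ![0, 0, 0, 1] := by
  funext μ
  fin_cases i <;> fin_cases μ <;> simp [tangent, pderiv, symmetrySurface]

theorem pderiv_tangent_symmetrySurface (p q : ℝ → ℝ) (i j : Fin 3) (μ : Fin 4) (ξ : Fin 3 → ℝ) :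
    pderiv i (fun ζ => tangent (symmetrySurface p q) j ζ μ) ξ =
      if i = 0 ∧ j = 0 then ![deriv (deriv p) (ξ 0), deriv (deriv q) (ξ 0), 0, 0] μ else 0 := by
  simp only [tangent_symmetrySurface]
  fin_cases i <;> fin_cases j <;> fin_cases μ <;> simp [pderiv]

/-! ### The interior metric -/

theorem interiorMetric_transpose (a : ℝ → ℝ) (x : Coord) :
    (interiorMetric a x).transpose = interiorMetric a x := by
  simp [interiorMetric]

theorem interiorMetric_det {a : ℝ → ℝ} {x : Coord} (ha : a (x 0) ≠ 0) (h1 : x 1 ≠ 0)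
    (h2 : Real.sin (x 2) ≠ 0) : (interiorMetric a x).det ≠ 0 := by
  simp [interiorMetric, Matrix.det_diagonal, Fin.prod_univ_four, ha, h1, h2]

/-- The partial derivatives of the interior metric. -/
def interiorMetricDeriv (a : ℝ → ℝ) (x : Coord) : Fin 4 → Matrix (Fin 4) (Fin 4) ℝ :=
  fun k => match k with
  | 0 => Matrix.diagonal ![0, 2 * a (x 0) * deriv a (x 0), 2 * a (x 0) * deriv a (x 0) * x 1 ^ 2,
      2 * a (x 0) * deriv a (x 0) * x 1 ^ 2 * Real.sin (x 2) ^ 2]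
  | 1 => Matrix.diagonal ![0, 0, 2 * a (x 0) ^ 2 * x 1,
      2 * a (x 0) ^ 2 * x 1 * Real.sin (x 2) ^ 2]
  | 2 => Matrix.diagonal ![0, 0, 0, 2 * a (x 0) ^ 2 * x 1 ^ 2 * Real.sin (x 2) * Real.cos (x 2)]
  | 3 => 0

theorem pderiv_interiorMetric {a : ℝ → ℝ} {x : Coord} (ha : DifferentiableAt ℝ a (x 0))
    (k i j : Fin 4) :
    pderiv k (fun y => interiorMetric a y i j) x = interiorMetricDeriv a x k i j := by
  by_cases hij : i = j
  swap
  · have : interiorMetricDeriv a x k i j = 0 := by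
      fin_cases k <;> simp [interiorMetricDeriv, Matrix.diagonal_apply_ne _ hij]
    rw [this]
    simp [pderiv, interiorMetric, Matrix.diagonal_apply_ne _ hij]
  subst hij
  have h1 : HasDerivAt (fun s => a s ^ 2) (2 * a (x 0) * deriv a (x 0)) (x 0) := by
    simpa using ha.hasDerivAt.fun_pow 2
  have h2 : ∀ y : ℝ, HasDerivAt (fun s : ℝ => s ^ 2) (2 * y) y := fun y => by
    simpa using hasDerivAt_pow 2 y
  have h3 : HasDerivAt (fun s : ℝ => Real.sin s ^ 2) (2 * Real.sin (x 2) * Real.cos (x 2)) (x 2) := by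
    simpa using (Real.hasDerivAt_sin (x 2)).fun_pow 2
  fin_cases k <;> fin_cases i <;>
    simp [pderiv, interiorMetric, interiorMetricDeriv, h1.deriv, h3.deriv, (h2 _).deriv,
      -deriv_fun_pow, -differentiableAt_fun_id, mul_assoc] <;> ring

/-! ### The exterior metric -/

theorem exteriorMetric_transpose (Λ ε : ℝ) (m : ℝ → ℝ) (x : Coord) :
    (exteriorMetric Λ ε m x).transpose = exteriorMetric Λ ε m x := by
  ext i j
  fin_cases i <;> fin_cases j <;> simp [exteriorMetric]

theorem exteriorMetric_det {Λ ε : ℝ} {m : ℝ → ℝ} {x : Coord} (hε : ε ≠ 0) (h1 : x 1 ≠ 0)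
    (h2 : Real.sin (x 2) ≠ 0) : (exteriorMetric Λ ε m x).det ≠ 0 := by
  simp [exteriorMetric, Matrix.det_succ_row_zero, Fin.sum_univ_succ, Fin.succAbove, hε, h1, h2]

/-- The partial derivatives of the exterior metric. -/
def exteriorMetricDeriv (Λ : ℝ) (m : ℝ → ℝ) (x : Coord) : Fin 4 → Matrix (Fin 4) (Fin 4) ℝ :=
  fun k => match k with
  | 0 => Matrix.diagonal ![2 * deriv m (x 0) / x 1, 0, 0, 0]
  | 1 => Matrix.diagonal ![-(2 * m (x 0) / x 1 ^ 2 - 2 * Λ / 3 * x 1), 0, 2 * x 1,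
      2 * x 1 * Real.sin (x 2) ^ 2]
  | 2 => Matrix.diagonal ![0, 0, 0, 2 * x 1 ^ 2 * Real.sin (x 2) * Real.cos (x 2)]
  | 3 => 0

theorem hasDerivAt_chi_radius (Λ : ℝ) (m : ℝ → ℝ) (u : ℝ) {r : ℝ} (hr : r ≠ 0) :
    HasDerivAt (fun s => chi Λ m u s) (2 * m u / r ^ 2 - 2 * Λ / 3 * r) r := by
  have h := ((hasDerivAt_const r (1 : ℝ)).sub ((hasDerivAt_inv hr).const_mul (2 * m u))).sub
    ((hasDerivAt_pow 2 r).const_mul (Λ / 3))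
  refine (h.congr_deriv ?_)
  field_simp
  ring

theorem hasDerivAt_chi_null (Λ : ℝ) {m : ℝ → ℝ} {u : ℝ} (r : ℝ) (hm : DifferentiableAt ℝ m u) :
    HasDerivAt (fun s => chi Λ m s r) (-(2 * deriv m u / r)) u := by
  have h := ((hasDerivAt_const u (1 : ℝ)).sub ((hm.hasDerivAt.const_mul 2).div_const r)).sub
    (hasDerivAt_const u (Λ / 3 * r ^ 2))
  refine (h.congr_deriv ?_)
  ring

theorem pderiv_exteriorMetric {Λ : ℝ} (ε : ℝ) {m : ℝ → ℝ} {x : Coord}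
    (hm : DifferentiableAt ℝ m (x 0)) (hx : x 1 ≠ 0) (k i j : Fin 4) :
    pderiv k (fun y => exteriorMetric Λ ε m y i j) x = exteriorMetricDeriv Λ m x k i j := by
  have h1 := hasDerivAt_chi_radius Λ m (x 0) hx
  have h1' := hasDerivAt_chi_null Λ (x 1) hm
  have h2 : ∀ y : ℝ, HasDerivAt (fun s : ℝ => s ^ 2) (2 * y) y := fun y => by
    simpa using hasDerivAt_pow 2 y
  have h3 : HasDerivAt (fun s : ℝ => Real.sin s ^ 2) (2 * Real.sin (x 2) * Real.cos (x 2)) (x 2) := by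
    simpa using (Real.hasDerivAt_sin (x 2)).fun_pow 2
  fin_cases k <;> fin_cases i <;> fin_cases j <;>
    simp [pderiv, exteriorMetric, exteriorMetricDeriv, h1.deriv, h1'.deriv, h3.deriv, (h2 _).deriv,
      -deriv_fun_pow, mul_assoc] <;> ring

/-! ### Fundamental forms of symmetry surfaces -/

theorem firstForm_interior (a R : ℝ → ℝ) (τ ϑ φ : ℝ) (i j : Fin 3) :
    firstForm (interiorMetric a) (interiorSurface R) ![τ, ϑ, φ] i j =
      Matrix.diagonal ![-1 + a τ ^ 2 * deriv R τ ^ 2, a τ ^ 2 * R τ ^ 2,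
        a τ ^ 2 * R τ ^ 2 * Real.sin ϑ ^ 2] i j := by
  rw [interiorSurface_eq]
  unfold firstForm
  simp only [tangent_symmetrySurface]
  fin_cases i <;> fin_cases j <;>
    simp [metricProd, interiorMetric, symmetrySurface, Fin.sum_univ_four, Matrix.diagonal] <;> ring

theorem firstForm_exterior (Λ ε : ℝ) (m u r : ℝ → ℝ) (τ ϑ φ : ℝ) (i j : Fin 3) :
    firstForm (exteriorMetric Λ ε m) (exteriorSurface u r) ![τ, ϑ, φ] i j =
      Matrix.diagonal ![-chi Λ m (u τ) (r τ) * deriv u τ ^ 2 + 2 * ε * deriv u τ * deriv r τ,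
        r τ ^ 2, r τ ^ 2 * Real.sin ϑ ^ 2] i j := by
  rw [exteriorSurface_eq]
  unfold firstForm
  simp only [tangent_symmetrySurface]
  fin_cases i <;> fin_cases j <;>
    simp [metricProd, exteriorMetric, symmetrySurface, Fin.sum_univ_four, Matrix.diagonal] <;> ring

theorem secondForm_interior {a : ℝ → ℝ} (R : ℝ → ℝ) {τ ϑ : ℝ} (φ n₀ n₁ : ℝ)
    (ha : DifferentiableAt ℝ a τ) (ha0 : a τ ≠ 0) (hR : R τ ≠ 0) (hϑ : Real.sin ϑ ≠ 0)
    (i j : Fin 3) :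
    secondForm (interiorMetric a) (interiorSurface R) ![n₀, n₁, 0, 0] ![τ, ϑ, φ] i j =
      Matrix.diagonal ![-(a τ ^ 2 * n₁ * deriv (deriv R) τ - n₀ * a τ * deriv a τ * deriv R τ ^ 2
          + 2 * n₁ * a τ * deriv a τ * deriv R τ),
        n₀ * a τ * deriv a τ * R τ ^ 2 + n₁ * a τ ^ 2 * R τ,
        (n₀ * a τ * deriv a τ * R τ ^ 2 + n₁ * a τ ^ 2 * R τ) * Real.sin ϑ ^ 2] i j := by
  rw [interiorSurface_eq, secondForm_eq (interiorMetric_transpose _ _)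
    (interiorMetric_det (by simpa [symmetrySurface]) (by simpa [symmetrySurface])
      (by simpa [symmetrySurface]))]
  simp only [pderiv_tangent_symmetrySurface]
  simp only [tangent_symmetrySurface, christoffelFirst]
  simp only [pderiv_interiorMetric (x := symmetrySurface id R ![τ, ϑ, φ]) ha]
  fin_cases i <;> fin_cases j <;>
    simp [lower, interiorMetric, interiorMetricDeriv, symmetrySurface, Fin.sum_univ_four,
      Matrix.diagonal] <;> ring

theorem secondForm_exterior {Λ ε : ℝ} {m : ℝ → ℝ} (u r : ℝ → ℝ) {τ ϑ : ℝ} (φ n₀ n₁ : ℝ)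
    (hε : ε ≠ 0) (hm : DifferentiableAt ℝ m (u τ)) (hr : r τ ≠ 0) (hϑ : Real.sin ϑ ≠ 0)
    (i j : Fin 3) :
    secondForm (exteriorMetric Λ ε m) (exteriorSurface u r) ![n₀, n₁, 0, 0] ![τ, ϑ, φ] i j =
      Matrix.diagonal ![-((-chi Λ m (u τ) (r τ) * n₀ + ε * n₁) * deriv (deriv u) τ
          + ε * n₀ * deriv (deriv r) τ
          + n₀ * (deriv m (u τ) / r τ * deriv u τ ^ 2
            - (2 * m (u τ) / r τ ^ 2 - 2 * Λ / 3 * r τ) * deriv u τ * deriv r τ)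
          + n₁ * ((2 * m (u τ) / r τ ^ 2 - 2 * Λ / 3 * r τ) / 2) * deriv u τ ^ 2),
        n₁ * r τ, n₁ * r τ * Real.sin ϑ ^ 2] i j := by
  rw [exteriorSurface_eq, secondForm_eq (exteriorMetric_transpose _ _ _ _)
    (exteriorMetric_det hε (by simpa [symmetrySurface]) (by simpa [symmetrySurface]))]
  simp only [pderiv_tangent_symmetrySurface]
  simp only [tangent_symmetrySurface, christoffelFirst]
  simp only [pderiv_exteriorMetric (x := symmetrySurface u r ![τ, ϑ, φ]) ε hm hr]
  fin_cases i <;> fin_cases j <;>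
    simp [lower, exteriorMetric, exteriorMetricDeriv, symmetrySurface, Fin.sum_univ_four,
      Matrix.diagonal] <;> ring

/-! ### Null expansions of symmetry spheres -/

theorem expansion_interior {a : ℝ → ℝ} {t X ϑ : ℝ} (φ k₀ k₁ : ℝ) (ha : DifferentiableAt ℝ a t)
    (ha0 : a t ≠ 0) (hX : X ≠ 0) (hϑ : Real.sin ϑ ≠ 0) :
    expansion (interiorMetric a) ![t, X, ϑ, φ] ![k₀, k₁, 0, 0] =
      2 * (k₀ * deriv a t / a t + k₁ / X) := by
  rw [expansion_eq (interiorMetric_transpose _ _) (interiorMetric_det (by simpa) (by simpa)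
    (by simpa))]
  simp only [christoffelFirst]
  simp only [pderiv_interiorMetric (x := ![t, X, ϑ, φ]) ha]
  have hη : (interiorMetric a ![t, X, ϑ, φ]).submatrix surfIdx surfIdx =
      Matrix.diagonal ![a t ^ 2 * X ^ 2, a t ^ 2 * X ^ 2 * Real.sin ϑ ^ 2] := by
    ext i j
    fin_cases i <;> fin_cases j <;> simp [interiorMetric, surfIdx, Matrix.diagonal]
  have hinv : ((interiorMetric a ![t, X, ϑ, φ]).submatrix surfIdx surfIdx)⁻¹ =
      Matrix.diagonal ![(a t ^ 2 * X ^ 2)⁻¹, (a t ^ 2 * X ^ 2 * Real.sin ϑ ^ 2)⁻¹] := by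
    rw [hη]
    apply Matrix.inv_eq_left_inv
    ext i j
    fin_cases i <;> fin_cases j <;> simp <;> field_simp
  rw [hinv]
  simp [Fin.sum_univ_four, surfIdx, interiorMetricDeriv, Matrix.diagonal]
  field_simp
  ring

theorem expansion_exterior {Λ ε : ℝ} {m : ℝ → ℝ} {v X ϑ : ℝ} (φ k₀ k₁ : ℝ) (hε : ε ≠ 0)
    (hm : DifferentiableAt ℝ m v) (hX : X ≠ 0) (hϑ : Real.sin ϑ ≠ 0) :
    expansion (exteriorMetric Λ ε m) ![v, X, ϑ, φ] ![k₀, k₁, 0, 0] = 2 * k₁ / X := by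
  rw [expansion_eq (exteriorMetric_transpose _ _ _ _) (exteriorMetric_det hε (by simpa) (by simpa))]
  simp only [christoffelFirst]
  simp only [pderiv_exteriorMetric (x := ![v, X, ϑ, φ]) ε hm hX]
  have hη : (exteriorMetric Λ ε m ![v, X, ϑ, φ]).submatrix surfIdx surfIdx =
      Matrix.diagonal ![X ^ 2, X ^ 2 * Real.sin ϑ ^ 2] := by
    ext i j
    fin_cases i <;> fin_cases j <;> simp [exteriorMetric, surfIdx, Matrix.diagonal]
  have hinv : ((exteriorMetric Λ ε m ![v, X, ϑ, φ]).submatrix surfIdx surfIdx)⁻¹ =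
      Matrix.diagonal ![(X ^ 2)⁻¹, (X ^ 2 * Real.sin ϑ ^ 2)⁻¹] := by
    rw [hη]
    apply Matrix.inv_eq_left_inv
    ext i j
    fin_cases i <;> fin_cases j <;> simp [hX] <;> field_simp
  rw [hinv]
  simp [Fin.sum_univ_four, surfIdx, exteriorMetricDeriv, Matrix.diagonal]
  field_simp
  ring

/-! ### Trapped spheres -/

theorem isFutureNullPair_interior {a : ℝ → ℝ} {t : ℝ} (X ϑ φ : ℝ) (ha0 : a t ≠ 0) :
    IsFutureNullPair (interiorMetric a) interiorTime ![t, X, ϑ, φ]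
      ![1, (a t)⁻¹, 0, 0] ![1 / 2, -(2 * a t)⁻¹, 0, 0] where
  null_left := by simp [metricProd, interiorMetric, Fin.sum_univ_four, Matrix.diagonal]; field_simp; ring
  null_right := by simp [metricProd, interiorMetric, Fin.sum_univ_four, Matrix.diagonal]; field_simp; ring
  cross := by simp [metricProd, interiorMetric, Fin.sum_univ_four, Matrix.diagonal]; field_simp; ring
  normal_left := by
    intro A; fin_cases A <;> simp [lower, interiorMetric, surfIdx, Matrix.diagonal]
  normal_right := by
    intro A; fin_cases A <;> simp [lower, interiorMetric, surfIdx, Matrix.diagonal]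
  future_left := by
    simp [metricProd, interiorMetric, interiorTime, Fin.sum_univ_four, Matrix.diagonal]
  future_right := by
    simp [metricProd, interiorMetric, interiorTime, Fin.sum_univ_four, Matrix.diagonal]

theorem isFutureNullPair_exterior (Λ : ℝ) (m : ℝ → ℝ) (v X ϑ φ : ℝ) :
    IsFutureNullPair (exteriorMetric Λ 1 m) (exteriorTime Λ 1 m) ![v, X, ϑ, φ]
      ![1, chi Λ m v X / 2, 0, 0] ![0, -1, 0, 0] where
  null_left := by simp [metricProd, exteriorMetric, Fin.sum_univ_four]; ring
  null_right := by simp [metricProd, exteriorMetric, Fin.sum_univ_four]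
  cross := by simp [metricProd, exteriorMetric, Fin.sum_univ_four]
  normal_left := by
    intro A; fin_cases A <;> simp [lower, exteriorMetric, surfIdx, Fin.sum_univ_four]
  normal_right := by
    intro A; fin_cases A <;> simp [lower, exteriorMetric, surfIdx, Fin.sum_univ_four]
  future_left := by
    simp [metricProd, exteriorMetric, exteriorTime, Fin.sum_univ_four]
    linarith
  future_right := by
    simp [metricProd, exteriorMetric, exteriorTime, Fin.sum_univ_four]

theorem expansion_interior_outgoing {a : ℝ → ℝ} {t X ϑ : ℝ} (φ : ℝ) (ha : DifferentiableAt ℝ a t)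
    (ha0 : a t ≠ 0) (hX : X ≠ 0) (hϑ : Real.sin ϑ ≠ 0) :
    expansion (interiorMetric a) ![t, X, ϑ, φ] ![1, (a t)⁻¹, 0, 0] =
      2 * (deriv a t * X + 1) / (a t * X) := by
  rw [expansion_interior φ _ _ ha ha0 hX hϑ]
  field_simp

theorem expansion_interior_ingoing {a : ℝ → ℝ} {t X ϑ : ℝ} (φ : ℝ) (ha : DifferentiableAt ℝ a t)
    (ha0 : a t ≠ 0) (hX : X ≠ 0) (hϑ : Real.sin ϑ ≠ 0) :
    expansion (interiorMetric a) ![t, X, ϑ, φ] ![1 / 2, -(2 * a t)⁻¹, 0, 0] =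
      (deriv a t * X - 1) / (a t * X) := by
  rw [expansion_interior φ _ _ ha ha0 hX hϑ]
  field_simp
  ring

theorem isUntrapped_interior {a : ℝ → ℝ} {t X ϑ : ℝ} (φ : ℝ) (ha : DifferentiableAt ℝ a t)
    (ha0 : 0 < a t) (hX : 0 < X) (hϑ : Real.sin ϑ ≠ 0) (h : |deriv a t * X| < 1) :
    IsUntrapped (interiorMetric a) interiorTime ![t, X, ϑ, φ] := by
  refine ⟨_, _, isFutureNullPair_interior X ϑ φ ha0.ne', ?_⟩
  rw [expansion_interior_outgoing φ ha ha0.ne' hX.ne' hϑ,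
    expansion_interior_ingoing φ ha ha0.ne' hX.ne' hϑ]
  obtain ⟨h1, h2⟩ := abs_lt.1 h
  exact mul_neg_of_pos_of_neg (div_pos (by linarith) (by positivity))
    (div_neg_of_neg_of_pos (by linarith) (by positivity))

theorem isFutureTrapped_interior {a : ℝ → ℝ} {t X ϑ : ℝ} (φ : ℝ) (ha : DifferentiableAt ℝ a t)
    (ha0 : 0 < a t) (hX : 0 < X) (hϑ : Real.sin ϑ ≠ 0) (h : deriv a t * X < -1) :
    IsFutureTrapped (interiorMetric a) interiorTime ![t, X, ϑ, φ] := by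
  refine ⟨_, _, isFutureNullPair_interior X ϑ φ ha0.ne', ?_⟩
  rw [expansion_interior_outgoing φ ha ha0.ne' hX.ne' hϑ,
    expansion_interior_ingoing φ ha ha0.ne' hX.ne' hϑ]
  exact ⟨div_neg_of_neg_of_pos (by linarith) (by positivity),
    div_neg_of_neg_of_pos (by linarith) (by positivity)⟩

theorem isFutureMarginallyTrapped_interior {a : ℝ → ℝ} {t X ϑ : ℝ} (φ : ℝ)
    (ha : DifferentiableAt ℝ a t) (ha0 : 0 < a t) (hX : 0 < X) (hϑ : Real.sin ϑ ≠ 0)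
    (h : deriv a t * X = -1) :
    IsFutureMarginallyTrapped (interiorMetric a) interiorTime ![t, X, ϑ, φ] := by
  refine ⟨_, _, isFutureNullPair_interior X ϑ φ ha0.ne', ?_⟩
  rw [expansion_interior_outgoing φ ha ha0.ne' hX.ne' hϑ,
    expansion_interior_ingoing φ ha ha0.ne' hX.ne' hϑ, h]
  exact ⟨by simp, div_neg_of_neg_of_pos (by norm_num) (by positivity)⟩

theorem isUntrapped_exterior {Λ : ℝ} {m : ℝ → ℝ} {v X ϑ : ℝ} (φ : ℝ) (hm : DifferentiableAt ℝ m v)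
    (hX : 0 < X) (hϑ : Real.sin ϑ ≠ 0) (h : 0 < chi Λ m v X) :
    IsUntrapped (exteriorMetric Λ 1 m) (exteriorTime Λ 1 m) ![v, X, ϑ, φ] := by
  refine ⟨_, _, isFutureNullPair_exterior Λ m v X ϑ φ, ?_⟩
  rw [expansion_exterior φ _ _ one_ne_zero hm hX.ne' hϑ,
    expansion_exterior φ _ _ one_ne_zero hm hX.ne' hϑ]
  exact mul_neg_of_pos_of_neg (by positivity) (div_neg_of_neg_of_pos (by norm_num) hX)

theorem isFutureTrapped_exterior {Λ : ℝ} {m : ℝ → ℝ} {v X ϑ : ℝ} (φ : ℝ)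
    (hm : DifferentiableAt ℝ m v) (hX : 0 < X) (hϑ : Real.sin ϑ ≠ 0) (h : chi Λ m v X < 0) :
    IsFutureTrapped (exteriorMetric Λ 1 m) (exteriorTime Λ 1 m) ![v, X, ϑ, φ] := by
  refine ⟨_, _, isFutureNullPair_exterior Λ m v X ϑ φ, ?_⟩
  rw [expansion_exterior φ _ _ one_ne_zero hm hX.ne' hϑ,
    expansion_exterior φ _ _ one_ne_zero hm hX.ne' hϑ]
  exact ⟨div_neg_of_neg_of_pos (by linarith) hX, div_neg_of_neg_of_pos (by norm_num) hX⟩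

theorem isFutureMarginallyTrapped_exterior {Λ : ℝ} {m : ℝ → ℝ} {v X ϑ : ℝ} (φ : ℝ)
    (hm : DifferentiableAt ℝ m v) (hX : 0 < X) (hϑ : Real.sin ϑ ≠ 0) (h : chi Λ m v X = 0) :
    IsFutureMarginallyTrapped (exteriorMetric Λ 1 m) (exteriorTime Λ 1 m) ![v, X, ϑ, φ] := by
  refine ⟨_, _, isFutureNullPair_exterior Λ m v X ϑ φ, ?_⟩
  rw [expansion_exterior φ _ _ one_ne_zero hm hX.ne' hϑ,
    expansion_exterior φ _ _ one_ne_zero hm hX.ne' hϑ, h]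
  exact ⟨by simp, div_neg_of_neg_of_pos (by norm_num) hX⟩

/-! ### The matching conditions in terms of ordinary differential equations -/

/-- The junction conditions at `τ`. -/
structure IsJunction (a : ℝ → ℝ) (Λ ε s : ℝ) (R u r m : ℝ → ℝ) (τ : ℝ) : Prop where
  radius : r τ = a τ * R τ
  timelike : a τ ^ 2 * deriv R τ ^ 2 < 1
  first : chi Λ m (u τ) (r τ) * deriv u τ ^ 2 - 2 * ε * deriv u τ * deriv r τ =
    1 - a τ ^ 2 * deriv R τ ^ 2
  angular : s * (chi Λ m (u τ) (r τ) * deriv u τ - ε * deriv r τ) =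
    1 + a τ * deriv R τ * (deriv a τ * R τ)
  radial : s * (-deriv r τ * deriv (deriv u) τ + deriv u τ * deriv (deriv r) τ
      + ε * deriv u τ * (deriv m (u τ) / r τ * deriv u τ ^ 2
        - (2 * m (u τ) / r τ ^ 2 - 2 * Λ / 3 * r τ) * deriv u τ * deriv r τ)
      + (chi Λ m (u τ) (r τ) * deriv u τ - ε * deriv r τ) *
        ((2 * m (u τ) / r τ ^ 2 - 2 * Λ / 3 * r τ) / 2) * deriv u τ ^ 2) =
    a τ * deriv (deriv R) τ - a τ ^ 2 * deriv a τ * deriv R τ ^ 3 + 2 * deriv a τ * deriv R τ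

theorem IsSign.sq_eq {ε : ℝ} (h : IsSign ε) : ε ^ 2 = 1 := by
  rcases h with rfl | rfl <;> norm_num

theorem IsSign.ne_zero {ε : ℝ} (h : IsSign ε) : ε ≠ 0 := by
  rcases h with rfl | rfl <;> norm_num

theorem interiorNormal_eq (a R : ℝ → ℝ) (τ : ℝ) : interiorNormal a R τ =
    ![(Real.sqrt (1 - a τ ^ 2 * deriv R τ ^ 2))⁻¹ * (a τ * deriv R τ),
      (Real.sqrt (1 - a τ ^ 2 * deriv R τ ^ 2))⁻¹ * (1 / a τ), 0, 0] := by
  simp [interiorNormal]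

theorem exteriorNormal_eq (Λ ε s : ℝ) (u r m : ℝ → ℝ) (τ : ℝ) : exteriorNormal Λ ε s u r m τ =
    ![s / Real.sqrt (chi Λ m (u τ) (r τ) * deriv u τ ^ 2 - 2 * ε * deriv u τ * deriv r τ) *
        (ε * deriv u τ),
      s / Real.sqrt (chi Λ m (u τ) (r τ) * deriv u τ ^ 2 - 2 * ε * deriv u τ * deriv r τ) *
        (chi Λ m (u τ) (r τ) * deriv u τ - ε * deriv r τ), 0, 0] := by
  simp [exteriorNormal]

theorem isUnitNormal_interior {a R : ℝ → ℝ} {τ : ℝ} (ϑ φ : ℝ) (ha : a τ ≠ 0)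
    (h : a τ ^ 2 * deriv R τ ^ 2 < 1) :
    IsUnitNormal (interiorMetric a) (interiorSurface R) (interiorNormal a R τ) ![τ, ϑ, φ] := by
  have hN : 0 < Real.sqrt (1 - a τ ^ 2 * deriv R τ ^ 2) := Real.sqrt_pos.2 (by linarith)
  have hN2 : Real.sqrt (1 - a τ ^ 2 * deriv R τ ^ 2) ^ 2 = 1 - a τ ^ 2 * deriv R τ ^ 2 :=
    Real.sq_sqrt (by linarith)
  rw [interiorNormal_eq, interiorSurface_eq]
  set N := Real.sqrt (1 - a τ ^ 2 * deriv R τ ^ 2)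
  constructor
  · intro i
    rw [tangent_symmetrySurface]
    fin_cases i <;>
      simp [metricProd, interiorMetric, symmetrySurface, Fin.sum_univ_four, Matrix.diagonal]
    field_simp
    ring
  · simp [metricProd, interiorMetric, symmetrySurface, Fin.sum_univ_four, Matrix.diagonal]
    field_simp
    linear_combination -hN2

theorem isUnitNormal_exterior {Λ ε s : ℝ} {u r m : ℝ → ℝ} {τ : ℝ} (ϑ φ : ℝ) (hε : IsSign ε)
    (hs : IsSign s)
    (h : 0 < chi Λ m (u τ) (r τ) * deriv u τ ^ 2 - 2 * ε * deriv u τ * deriv r τ) :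
    IsUnitNormal (exteriorMetric Λ ε m) (exteriorSurface u r) (exteriorNormal Λ ε s u r m τ)
      ![τ, ϑ, φ] := by
  have hN := Real.sqrt_pos.2 h
  have hN2 := Real.sq_sqrt h.le
  have hε2 := hε.sq_eq
  have hs2 := hs.sq_eq
  rw [exteriorNormal_eq, exteriorSurface_eq]
  set N := Real.sqrt (chi Λ m (u τ) (r τ) * deriv u τ ^ 2 - 2 * ε * deriv u τ * deriv r τ)
  constructor
  · intro i
    rw [tangent_symmetrySurface]
    fin_cases i <;>
      simp [metricProd, exteriorMetric, symmetrySurface, Fin.sum_univ_four]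
    field_simp
    ring
  · simp [metricProd, exteriorMetric, symmetrySurface, Fin.sum_univ_four]
    field_simp
    rw [hN2, hε2, hs2]
    ring

theorem sin_pi_div_two_ne : Real.sin (Real.pi / 2) ≠ 0 := by simp

theorem pi_div_two_mem : Real.pi / 2 ∈ Ioo 0 Real.pi :=
  ⟨by positivity, by linarith [Real.pi_pos]⟩

/-- By the inverse function theorem f maps neighbourhoods to neighbourhoods. This is needed because
the mass function is regular only on `u '' I`, while its derivative there must be an honest
two-sided one. -/
theorem isOpen_image_of_deriv_pos {f : ℝ → ℝ} {I : Set ℝ} (hI : IsOpen I)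
    (hf : ContDiffOn ℝ 1 f I) (hpos : ∀ x ∈ I, 0 < deriv f x) : IsOpen (f '' I) := by
  rw [isOpen_iff_mem_nhds]
  rintro _ ⟨x, hx, rfl⟩
  have h1 : ContDiffAt ℝ 1 f x := hf.contDiffAt (hI.mem_nhds hx)
  rw [← (h1.hasStrictDerivAt one_ne_zero).map_nhds_eq (hpos x hx).ne']
  exact image_mem_map (hI.mem_nhds hx)

theorem differentiableAt_of_contDiffOn_two {f : ℝ → ℝ} {I : Set ℝ} (hI : IsOpen I)
    (hf : ContDiffOn ℝ 2 f I) {x : ℝ} (hx : x ∈ I) : DifferentiableAt ℝ f x :=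
  (hf.contDiffAt (hI.mem_nhds hx)).differentiableAt two_ne_zero

theorem Matches.isOpen_image {a : ℝ → ℝ} {Λ ε s : ℝ} {I : Set ℝ} {R u r m : ℝ → ℝ}
    (M : Matches a Λ ε s I R u r m) (hI : IsOpen I) : IsOpen (u '' I) :=
  isOpen_image_of_deriv_pos hI (M.smooth_u.of_le (by norm_num)) M.future_u

theorem Matches.differentiableAt_mass {a : ℝ → ℝ} {Λ ε s : ℝ} {I : Set ℝ} {R u r m : ℝ → ℝ}
    (M : Matches a Λ ε s I R u r m) (hI : IsOpen I) {τ : ℝ} (hτ : τ ∈ I) :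
    DifferentiableAt ℝ m (u τ) :=
  differentiableAt_of_contDiffOn_two (M.isOpen_image hI) M.smooth_m (mem_image_of_mem u hτ)

/-- The equator ϑ = π/2 already carries all the information. Equality of the first forms makes the
normalisations of the two normals coincide, so that their common factor cancels from the second
forms. -/
theorem Matches.isJunction {a : ℝ → ℝ} {Λ ε s : ℝ} {I : Set ℝ} {R u r m : ℝ → ℝ}
    (M : Matches a Λ ε s I R u r m) (hε : IsSign ε) (hI : IsOpen I)
    (ha : ∀ τ ∈ I, DifferentiableAt ℝ a τ) (hpos : ∀ τ ∈ I, 0 < a τ) {τ : ℝ} (hτ : τ ∈ I) :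
    IsJunction a Λ ε s R u r m τ := by
  have ha0 := hpos τ hτ
  have hR := M.pos_R τ hτ
  have hr := M.pos_r τ hτ
  have hε2 := hε.sq_eq
  have t1 := M.timelike_int τ hτ _ pi_div_two_mem 0
  rw [firstForm_interior] at t1
  have f0 := M.first_eq τ hτ _ pi_div_two_mem 0 0 0
  have f1 := M.first_eq τ hτ _ pi_div_two_mem 0 1 1
  rw [firstForm_interior, firstForm_exterior] at f0 f1
  have k0 := M.second_eq τ hτ _ pi_div_two_mem 0 0 0
  have k1 := M.second_eq τ hτ _ pi_div_two_mem 0 1 1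
  rw [interiorNormal_eq, exteriorNormal_eq,
    secondForm_interior R 0 _ _ (ha τ hτ) ha0.ne' hR.ne' sin_pi_div_two_ne,
    secondForm_exterior u r 0 _ _ hε.ne_zero (M.differentiableAt_mass hI hτ) hr.ne'
      sin_pi_div_two_ne] at k0 k1
  simp at t1 f0 f1 k0 k1
  have hrad : r τ = a τ * R τ := by
    rw [← mul_pow, sq_eq_sq₀ hr.le (by positivity)] at f1
    exact f1
  have hfirst : chi Λ m (u τ) (r τ) * deriv u τ ^ 2 - 2 * ε * deriv u τ * deriv r τ =
      1 - a τ ^ 2 * deriv R τ ^ 2 := by linarith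
  have hN : 0 < Real.sqrt (1 - a τ ^ 2 * deriv R τ ^ 2) := Real.sqrt_pos.2 (by linarith)
  rw [hfirst] at k0 k1
  set N := Real.sqrt (1 - a τ ^ 2 * deriv R τ ^ 2)
  refine ⟨hrad, by linarith, hfirst, ?_, ?_⟩
  · rw [hrad] at k1 ⊢
    field_simp at k1
    linear_combination k1
  · generalize chi Λ m (u τ) (r τ) = χ at *
    field_simp at k0
    field_simp
    -- The lowered exterior normal is proportional to (-ε² r', ε² u'); the correction by `hε2`
    -- replaces ε² by 1.
    linear_combination (-1) * k0 + 3 * s * r τ ^ 2 *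
      (deriv r τ * deriv (deriv u) τ - deriv u τ * deriv (deriv r) τ) * hε2

theorem matches_of_isJunction {a : ℝ → ℝ} {Λ ε s : ℝ} {I : Set ℝ} {R u r m : ℝ → ℝ}
    (hε : IsSign ε) (hs : IsSign s) (hI : IsOpen I)
    (ha : ∀ τ ∈ I, DifferentiableAt ℝ a τ) (hpos : ∀ τ ∈ I, 0 < a τ)
    (hR : ContDiffOn ℝ 2 R I) (hu : ContDiffOn ℝ 2 u I) (hr : ContDiffOn ℝ 2 r I)
    (hm : ContDiffOn ℝ 2 m (u '' I)) (hRpos : ∀ τ ∈ I, 0 < R τ) (hu' : ∀ τ ∈ I, 0 < deriv u τ)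
    (h : ∀ τ ∈ I, IsJunction a Λ ε s R u r m τ) : Matches a Λ ε s I R u r m := by
  have hrpos : ∀ τ ∈ I, 0 < r τ := fun τ hτ => by
    rw [(h τ hτ).radius]; exact mul_pos (hpos τ hτ) (hRpos τ hτ)
  have hfirst : ∀ τ ∈ I, 0 < chi Λ m (u τ) (r τ) * deriv u τ ^ 2 - 2 * ε * deriv u τ * deriv r τ :=
    fun τ hτ => by rw [(h τ hτ).first]; linarith [(h τ hτ).timelike]
  have hm' : ∀ τ ∈ I, DifferentiableAt ℝ m (u τ) := fun τ hτ =>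
    differentiableAt_of_contDiffOn_two
      (isOpen_image_of_deriv_pos hI (hu.of_le (by norm_num)) hu') hm (mem_image_of_mem u hτ)
  refine ⟨hR, hu, hr, hm, hRpos, hrpos, hu', ?_, ?_, ?_, ?_, ?_, ?_⟩
  · intro τ hτ ϑ _ φ
    rw [firstForm_interior]
    simpa using (h τ hτ).timelike
  · intro τ hτ ϑ _ φ
    rw [firstForm_exterior]
    have := hfirst τ hτ
    simp
    linarith
  · intro τ hτ ϑ _ φ
    exact isUnitNormal_interior ϑ φ (hpos τ hτ).ne' (h τ hτ).timelike
  · intro τ hτ ϑ _ φ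
    exact isUnitNormal_exterior ϑ φ hε hs (hfirst τ hτ)
  · intro τ hτ ϑ _ φ i j
    rw [firstForm_exterior, firstForm_interior]
    have e1 := (h τ hτ).first
    have e2 := (h τ hτ).radius
    have e3 : -chi Λ m (u τ) (r τ) * deriv u τ ^ 2 + 2 * ε * deriv u τ * deriv r τ =
        -1 + a τ ^ 2 * deriv R τ ^ 2 := by linarith
    rw [e3, e2, mul_pow]
  · intro τ hτ ϑ hϑ φ i j
    have ha0 := (hpos τ hτ).ne'
    have hr0 := (hrpos τ hτ).ne'
    have hsin : Real.sin ϑ ≠ 0 := (Real.sin_pos_of_mem_Ioo hϑ).ne'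
    have hε2 := hε.sq_eq
    have e1 := (h τ hτ).radius
    have e2 := (h τ hτ).angular
    have e3 := (h τ hτ).radial
    rw [interiorNormal_eq, exteriorNormal_eq,
      secondForm_interior R φ _ _ (ha τ hτ) ha0 (hRpos τ hτ).ne' hsin,
      secondForm_exterior u r φ _ _ hε.ne_zero (hm' τ hτ) hr0 hsin, (h τ hτ).first]
    have hN : 0 < Real.sqrt (1 - a τ ^ 2 * deriv R τ ^ 2) :=
      Real.sqrt_pos.2 (by linarith [(h τ hτ).timelike])
    set N := Real.sqrt (1 - a τ ^ 2 * deriv R τ ^ 2)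
    -- On both sides the last diagonal entry is sin²ϑ times the middle one, so two scalar equations
    -- suffice for every ϑ.
    have k0 : ∀ p q p' q' : ℝ, p = p' → q = q' → Matrix.diagonal ![p, q, q * Real.sin ϑ ^ 2] i j =
      Matrix.diagonal ![p', q', q' * Real.sin ϑ ^ 2] i j := by rintro p q p' q' rfl rfl; rfl
    apply k0
    · generalize chi Λ m (u τ) (r τ) = χ at *
      field_simp at e3 ⊢
      linear_combination (-1) * e3 + 3 * s * r τ ^ 2 *
      (deriv r τ * deriv (deriv u) τ - deriv u τ * deriv (deriv r) τ) * hε2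
    · rw [e1]
      rw [e1] at e2
      field_simp
      linear_combination R τ * e2

/-! ### Dynamics of the interior -/

theorem IsFlatFLRW.differentiableAt {Λ γ : ℝ} {J : Set ℝ} {a : ℝ → ℝ} (h : IsFlatFLRW Λ γ J a)
    {t : ℝ} (ht : t ∈ J) : DifferentiableAt ℝ a t :=
  differentiableAt_of_contDiffOn_two h.interval.2.1 h.smooth ht

theorem IsFlatFLRW.contDiffOn_deriv {Λ γ : ℝ} {J : Set ℝ} {a : ℝ → ℝ} (h : IsFlatFLRW Λ γ J a) :
    ContDiffOn ℝ 1 (deriv a) J :=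
  ((contDiffOn_succ_iff_deriv_of_isOpen h.interval.2.1 (n := 1)).1 h.smooth).2.2

theorem IsFlatFLRW.differentiableAt_deriv {Λ γ : ℝ} {J : Set ℝ} {a : ℝ → ℝ}
    (h : IsFlatFLRW Λ γ J a) {t : ℝ} (ht : t ∈ J) : DifferentiableAt ℝ (deriv a) t :=
  (h.contDiffOn_deriv.contDiffAt (h.interval.2.1.mem_nhds ht)).differentiableAt one_ne_zero

theorem IsFlatFLRW.deriv_deriv {Λ γ : ℝ} {J : Set ℝ} {a : ℝ → ℝ} (h : IsFlatFLRW Λ γ J a)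
    {t : ℝ} (ht : t ∈ J) : deriv (deriv a) t =
      deriv a t ^ 2 / a t - (1 + γ) / 2 * (3 * deriv a t ^ 2 / a t ^ 2 - Λ) * a t := by
  have h1 := h.eos t ht
  have h2 := (h.pos t ht).ne'
  unfold pressure density at h1
  field_simp at h1 ⊢
  linear_combination (-1) * h1

theorem density_pos {Λ : ℝ} (hΛ : Λ < 0) (a : ℝ → ℝ) (t : ℝ) : 0 < density Λ a t := by
  unfold density
  have : 0 ≤ 3 * deriv a t ^ 2 / a t ^ 2 := by positivity
  linarith

theorem IsFlatFLRW.interiorDEC {Λ γ : ℝ} {J : Set ℝ} {a : ℝ → ℝ} (h : IsFlatFLRW Λ γ J a)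
    (hΛ : Λ < 0) (hγ₀ : 0 < γ) (hγ₁ : γ < 1) : InteriorDEC Λ J a := by
  intro t ht
  have h1 := density_pos hΛ a t
  rw [h.eos t ht]
  exact ⟨h1.le, by nlinarith, by nlinarith⟩

/-! ### Solving the junction conditions -/

/-- With v = aR' and w = a'R, multiplying the first-form equation by χ completes a square: χ(1 - v²)
= (χu' - εr')² - r'² = (1 + vw)² - (v + w)² = (1 - v²)(1 - w²). The timelike condition permits
division by 1 - v². -/
theorem IsJunction.chi_eq {a : ℝ → ℝ} {Λ ε s : ℝ} {R u r m : ℝ → ℝ} {τ : ℝ}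
    (h : IsJunction a Λ ε s R u r m τ) (hε : IsSign ε) (hs : IsSign s)
    (hr : deriv r τ = deriv a τ * R τ + a τ * deriv R τ) :
    chi Λ m (u τ) (r τ) = 1 - (deriv a τ * R τ) ^ 2 := by
  have h1 := h.first
  have h2 := h.angular
  have hε2 := hε.sq_eq
  have hs2 := hs.sq_eq
  have h3 : 1 - a τ ^ 2 * deriv R τ ^ 2 ≠ 0 := by linarith [h.timelike]
  rw [hr] at h1 h2
  apply mul_left_cancel₀ h3
  linear_combination -chi Λ m (u τ) (r τ) * h1 +
    (s * (chi Λ m (u τ) (r τ) * deriv u τ - ε * (deriv a τ * R τ + a τ * deriv R τ)) +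
      (1 + a τ * deriv R τ * (deriv a τ * R τ))) * h2
    - (chi Λ m (u τ) (r τ) * deriv u τ - ε * (deriv a τ * R τ + a τ * deriv R τ)) ^ 2 * hs2
    - (deriv a τ * R τ + a τ * deriv R τ) ^ 2 * hε2

theorem IsJunction.mass_eq {a : ℝ → ℝ} {Λ ε s : ℝ} {R u r m : ℝ → ℝ} {τ : ℝ}
    (h : IsJunction a Λ ε s R u r m τ) (hε : IsSign ε) (hs : IsSign s)
    (hr : deriv r τ = deriv a τ * R τ + a τ * deriv R τ) (hr0 : r τ ≠ 0) :
    m (u τ) = r τ / 2 * ((deriv a τ * R τ) ^ 2 - Λ / 3 * r τ ^ 2) := by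
  have h1 := h.chi_eq hε hs hr
  unfold chi at h1
  field_simp at h1
  linear_combination -h1 / 6

/-- Inserting the angular equation into the first-form equation factorises it as s u'(1 - δv)(1 -
δw) = (1 - δv)(1 + δv), where δ = sε, v = aR' and w = a'R. The factor 1 - δv is nonzero since |v| <
1. -/
theorem IsJunction.null_eq {a : ℝ → ℝ} {Λ ε s : ℝ} {R u r m : ℝ → ℝ} {τ : ℝ}
    (h : IsJunction a Λ ε s R u r m τ) (hε : IsSign ε) (hs : IsSign s)
    (hr : deriv r τ = deriv a τ * R τ + a τ * deriv R τ) :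
    s * deriv u τ * (1 - s * ε * (deriv a τ * R τ)) = 1 + s * ε * (a τ * deriv R τ) := by
  have h1 := h.first
  have h2 := h.angular
  have h3 : (a τ * deriv R τ) ^ 2 < 1 := by rw [mul_pow]; exact h.timelike
  obtain ⟨h4, h5⟩ := abs_lt.1 ((sq_lt_one_iff_abs_lt_one _).1 h3)
  have h6 : 1 - s * ε * (a τ * deriv R τ) ≠ 0 := by
    rcases hε with rfl | rfl <;> rcases hs with rfl | rfl <;> linarith
  rw [hr] at h1 h2
  apply mul_left_cancel₀ h6
  rcases hε with rfl | rfl <;> rcases hs with rfl | rfl <;>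
    first
    | linear_combination h1 - deriv u τ * h2
    | linear_combination h1 + deriv u τ * h2

/-- The radial junction condition fails by a multiple of `s ε a R' - γ`. -/
theorem radial_defect {a a₁ a₂ R R₁ R₂ u₁ u₂ m m₁ Λ γ ε s : ℝ} (hε : IsSign ε) (hs : IsSign s)
    (ha : a ≠ 0) (hD : 1 - s * ε * (a₁ * R) ≠ 0)
    (h₂ : a₂ = a₁ ^ 2 / a - (1 + γ) / 2 * (3 * a₁ ^ 2 / a ^ 2 - Λ) * a)
    (hm : m = a * R / 2 * ((a₁ * R) ^ 2 - Λ / 3 * (a * R) ^ 2))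
    (hu₁ : s * u₁ * (1 - s * ε * (a₁ * R)) = 1 + s * ε * (a * R₁))
    (hu₂ : s * u₂ * (1 - s * ε * (a₁ * R)) - s * u₁ * (s * ε * (a₂ * R + a₁ * R₁)) =
      s * ε * (a₁ * R₁ + a * R₂))
    (hm₁ : m₁ * u₁ = (a₁ * R + a * R₁) / 2 * ((a₁ * R) ^ 2 - Λ / 3 * (a * R) ^ 2) +
      a * R / 2 * (2 * (a₁ * R) * (a₂ * R + a₁ * R₁) -
        2 * Λ / 3 * (a * R) * (a₁ * R + a * R₁))) :
    s * (-(a₁ * R + a * R₁) * u₂ + u₁ * (a₂ * R + 2 * a₁ * R₁ + a * R₂)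
      + ε * u₁ * (m₁ / (a * R) * u₁ ^ 2
        - (2 * m / (a * R) ^ 2 - 2 * Λ / 3 * (a * R)) * u₁ * (a₁ * R + a * R₁))
      + ((1 - (a₁ * R) ^ 2) * u₁ - ε * (a₁ * R + a * R₁)) *
        ((2 * m / (a * R) ^ 2 - 2 * Λ / 3 * (a * R)) / 2) * u₁ ^ 2) -
      (a * R₂ - a ^ 2 * a₁ * R₁ ^ 3 + 2 * a₁ * R₁) =
    (3 * a₁ ^ 2 / a ^ 2 - Λ) * (a * R) * (1 - (a * R₁) ^ 2) * (s * ε * (a * R₁) - γ) /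
      (2 * (1 - s * ε * (a₁ * R))) := by
  -- The null relation and its derivative are solved for u' and u''. The derivative of m enters only
  -- through m'u', the rate of change of the mass along σ, so everything becomes rational in a, a',
  -- R, R', R''.
  have e₁ : u₁ = s * (1 + s * ε * (a * R₁)) / (1 - s * ε * (a₁ * R)) := by
    rw [eq_div_iff hD]
    linear_combination s * hu₁ - u₁ * (1 - s * ε * (a₁ * R)) * hs.sq_eq
  have e₂ : u₂ = s * (s * ε * (a₁ * R₁ + a * R₂) + s * u₁ * (s * ε * (a₂ * R + a₁ * R₁))) /
      (1 - s * ε * (a₁ * R)) := by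
    rw [eq_div_iff hD]
    linear_combination s * hu₂ - u₂ * (1 - s * ε * (a₁ * R)) * hs.sq_eq
  have e₃ : ε * u₁ * (m₁ / (a * R) * u₁ ^ 2
        - (2 * m / (a * R) ^ 2 - 2 * Λ / 3 * (a * R)) * u₁ * (a₁ * R + a * R₁)) =
      ε * u₁ ^ 2 * ((m₁ * u₁) / (a * R)
        - (2 * m / (a * R) ^ 2 - 2 * Λ / 3 * (a * R)) * (a₁ * R + a * R₁)) := by ring
  rw [e₃, hm₁, hm, e₂, e₁, h₂]
  rcases hε with rfl | rfl <;> rcases hs with rfl | rfl <;>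
  · simp only [one_mul, mul_one, neg_mul, sub_neg_eq_add, neg_neg, mul_neg, neg_neg] at hD ⊢
    field_simp
    ring

/-! ### Calculus on open intervals -/

theorem contDiffOn_two_of_hasDerivAt {f g : ℝ → ℝ} {I : Set ℝ} (hI : IsOpen I)
    (h : ∀ x ∈ I, HasDerivAt f (g x) x) (hg : ContDiffOn ℝ 1 g I) : ContDiffOn ℝ 2 f I := by
  refine (contDiffOn_succ_iff_deriv_of_isOpen hI (n := 1)).2
    ⟨fun x hx => (h x hx).differentiableAt.differentiableWithinAt, by simp, ?_⟩
  exact hg.congr fun x hx => (h x hx).deriv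

theorem differentiableAt_deriv_of_contDiffOn_two {f : ℝ → ℝ} {I : Set ℝ} (hI : IsOpen I)
    (hf : ContDiffOn ℝ 2 f I) {x : ℝ} (hx : x ∈ I) : DifferentiableAt ℝ (deriv f) x :=
  (((contDiffOn_succ_iff_deriv_of_isOpen hI (n := 1)).1 hf).2.2.contDiffAt
    (hI.mem_nhds hx)).differentiableAt one_ne_zero

theorem exists_primitive {f : ℝ → ℝ} {I : Set ℝ} (hI : IsOpenInterval I) (hf : ContinuousOn f I) :
    ∃ F : ℝ → ℝ, ∀ x ∈ I, HasDerivAt F (f x) x := by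
  obtain ⟨x₀, hx₀⟩ := hI.1
  refine ⟨fun x => ∫ t in x₀..x, f t, fun x hx => ?_⟩
  have hsub : uIcc x₀ x ⊆ I := hI.2.2.uIcc_subset hx₀ hx
  exact intervalIntegral.integral_hasDerivAt_right ((hf.mono hsub).intervalIntegrable)
    (hf.stronglyMeasurableAtFilter hI.2.1 x hx) (hf.continuousAt (hI.2.1.mem_nhds hx))

theorem strictMonoOn_of_hasDerivAt_pos {f g : ℝ → ℝ} {I : Set ℝ} (hI : I.OrdConnected)
    (h : ∀ x ∈ I, HasDerivAt f (g x) x) (hg : ∀ x ∈ I, 0 < g x) : StrictMonoOn f I := by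
  refine strictMonoOn_of_deriv_pos hI.convex (fun x hx => (h x hx).continuousAt.continuousWithinAt)
    fun x hx => ?_
  have hx' := interior_subset hx
  rw [(h x hx').deriv]
  exact hg x hx'

theorem strictAntiOn_of_hasDerivAt_neg {f g : ℝ → ℝ} {I : Set ℝ} (hI : I.OrdConnected)
    (h : ∀ x ∈ I, HasDerivAt f (g x) x) (hg : ∀ x ∈ I, g x < 0) : StrictAntiOn f I := by
  refine strictAntiOn_of_deriv_neg hI.convex (fun x hx => (h x hx).continuousAt.continuousWithinAt)
    fun x hx => ?_
  have hx' := interior_subset hx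
  rw [(h x hx').deriv]
  exact hg x hx'

theorem eq_add_const_of_hasDerivAt_eq {f g f' : ℝ → ℝ} {I : Set ℝ} (hI : I.OrdConnected)
    (hf : ∀ x ∈ I, HasDerivAt f (f' x) x) (hg : ∀ x ∈ I, HasDerivAt g (f' x) x) :
    ∃ c, ∀ x ∈ I, f x = g x + c := by
  rcases I.eq_empty_or_nonempty with rfl | ⟨x₀, hx₀⟩
  · exact ⟨0, by simp⟩
  refine ⟨f x₀ - g x₀, fun x hx => ?_⟩
  have h0 : ∀ y ∈ I, HasDerivWithinAt (fun y => f y - g y) 0 I y := fun y hy => by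
    simpa using ((hf y hy).fun_sub (hg y hy)).hasDerivWithinAt
  have h1 := hI.convex.norm_image_sub_le_of_norm_hasDerivWithin_le (C := 0) h0 (by simp) hx₀ hx
  have h2 : f x - g x - (f x₀ - g x₀) = 0 := by simpa using h1
  linarith

/-- Near each image point the global inverse coincides, by injectivity, with the local inverse of
the inverse function theorem. This is what turns the mass along σ, given in terms of τ, into a C²
function of u. -/
theorem contDiffOn_invFunOn {f : ℝ → ℝ} {I : Set ℝ} (hI : IsOpen I) (hf : ContDiffOn ℝ 2 f I)
    (hpos : ∀ x ∈ I, 0 < deriv f x) (hinj : InjOn f I) :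
    ContDiffOn ℝ 2 (Function.invFunOn f I) (f '' I) := by
  rintro _ ⟨x, hx, rfl⟩
  have h2 : ContDiffAt ℝ 2 f x := hf.contDiffAt (hI.mem_nhds hx)
  have hd : HasStrictDerivAt f (deriv f x) x := h2.hasStrictDerivAt two_ne_zero
  have hne := (hpos x hx).ne'
  have hd' : HasFDerivAt f
      ((ContinuousLinearEquiv.unitsEquivAut ℝ (Units.mk0 _ hne) : ℝ ≃L[ℝ] ℝ) : ℝ →L[ℝ] ℝ) x := by
    refine hd.hasDerivAt.hasFDerivAt.congr_fderiv ?_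
    ext
    simp
  have hloc := h2.to_localInverse hd' two_ne_zero
  refine (hloc.congr_of_eventuallyEq ?_).contDiffWithinAt
  have hs := h2.hasStrictFDerivAt' hd' two_ne_zero
  have hleft := hs.eventually_left_inverse
  rw [← hd.map_nhds_eq hne]
  filter_upwards [image_mem_map hleft, image_mem_map (hI.mem_nhds hx),
    image_mem_map (inter_mem hleft (hI.mem_nhds hx))] with y _ _ hy
  obtain ⟨z, ⟨hz1, hz2⟩, rfl⟩ := hy
  rw [hinj.leftInvOn_invFunOn hz2]
  exact hz1.symm

/-! ### Matching surfaces -/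

/-- The relations for u' and m hold on an open set and may therefore be differentiated in τ; this
supplies the hypotheses of `radial_defect`. It serves both directions, extracting the speed from a
matching and verifying the radial equation for a constructed one. -/
theorem radial_defect_of_eqOn {Λ γ : ℝ} {J : Set ℝ} {a : ℝ → ℝ} (hF : IsFlatFLRW Λ γ J a) {ε s : ℝ}
    (hε : IsSign ε) (hs : IsSign s) {I : Set ℝ} (hI : IsOpen I) (hIJ : I ⊆ J) {R u r m : ℝ → ℝ}
    (hR : ContDiffOn ℝ 2 R I) (hu : ContDiffOn ℝ 2 u I) (hm : ContDiffOn ℝ 2 m (u '' I))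
    (hu' : ∀ τ ∈ I, 0 < deriv u τ) (hr : ∀ τ ∈ I, r τ = a τ * R τ)
    (hmass : ∀ τ ∈ I, m (u τ) = a τ * R τ / 2 *
      ((deriv a τ * R τ) ^ 2 - Λ / 3 * (a τ * R τ) ^ 2))
    (hnull : ∀ τ ∈ I, s * deriv u τ * (1 - s * ε * (deriv a τ * R τ)) =
      1 + s * ε * (a τ * deriv R τ))
    {τ : ℝ} (hτ : τ ∈ I) (hD : 1 - s * ε * (deriv a τ * R τ) ≠ 0) :
    s * (-deriv r τ * deriv (deriv u) τ + deriv u τ * deriv (deriv r) τ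
      + ε * deriv u τ * (deriv m (u τ) / r τ * deriv u τ ^ 2
        - (2 * m (u τ) / r τ ^ 2 - 2 * Λ / 3 * r τ) * deriv u τ * deriv r τ)
      + ((1 - (deriv a τ * R τ) ^ 2) * deriv u τ - ε * deriv r τ) *
        ((2 * m (u τ) / r τ ^ 2 - 2 * Λ / 3 * r τ) / 2) * deriv u τ ^ 2) -
    (a τ * deriv (deriv R) τ - a τ ^ 2 * deriv a τ * deriv R τ ^ 3 + 2 * deriv a τ * deriv R τ) =
    (3 * deriv a τ ^ 2 / a τ ^ 2 - Λ) * (a τ * R τ) * (1 - (a τ * deriv R τ) ^ 2) *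
      (s * ε * (a τ * deriv R τ) - γ) / (2 * (1 - s * ε * (deriv a τ * R τ))) := by
  have hev : ∀ᶠ t in 𝓝 τ, t ∈ I := hI.mem_nhds hτ
  have da : ∀ t ∈ I, HasDerivAt a (deriv a t) t := fun t ht =>
    (hF.differentiableAt (hIJ ht)).hasDerivAt
  have dda : HasDerivAt (deriv a) (deriv (deriv a) τ) τ :=
    (hF.differentiableAt_deriv (hIJ hτ)).hasDerivAt
  have dR : ∀ t ∈ I, HasDerivAt R (deriv R t) t := fun t ht =>
    (differentiableAt_of_contDiffOn_two hI hR ht).hasDerivAt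
  have ddR : HasDerivAt (deriv R) (deriv (deriv R) τ) τ :=
    (differentiableAt_deriv_of_contDiffOn_two hI hR hτ).hasDerivAt
  have du : HasDerivAt u (deriv u τ) τ := (differentiableAt_of_contDiffOn_two hI hu hτ).hasDerivAt
  have ddu : HasDerivAt (deriv u) (deriv (deriv u) τ) τ :=
    (differentiableAt_deriv_of_contDiffOn_two hI hu hτ).hasDerivAt
  have hm' : HasDerivAt m (deriv m (u τ)) (u τ) :=
    (differentiableAt_of_contDiffOn_two (isOpen_image_of_deriv_pos hI (hu.of_le (by norm_num)) hu')
      hm (mem_image_of_mem u hτ)).hasDerivAt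
  have dr : ∀ t ∈ I, deriv r t = deriv a t * R t + a t * deriv R t := fun t ht =>
    (((da t ht).mul (dR t ht)).congr_of_eventuallyEq
      (eventually_of_mem (hI.mem_nhds ht) hr)).deriv
  have ddr : deriv (deriv r) τ = deriv (deriv a) τ * R τ + 2 * deriv a τ * deriv R τ +
      a τ * deriv (deriv R) τ := by
    rw [(((dda.mul (dR τ hτ)).add ((da τ hτ).mul ddR)).congr_of_eventuallyEq
      (eventually_of_mem hev dr)).deriv]
    ring
  have dw : HasDerivAt (fun t => deriv a t * R t)
      (deriv (deriv a) τ * R τ + deriv a τ * deriv R τ) τ := dda.mul (dR τ hτ)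
  have dρ : HasDerivAt (fun t => a t * R t) (deriv a τ * R τ + a τ * deriv R τ) τ :=
    (da τ hτ).mul (dR τ hτ)
  have n1 := (ddu.const_mul s).mul ((dw.const_mul (s * ε)).const_sub 1)
  have n2 := (((da τ hτ).mul ddR).const_mul (s * ε)).const_add 1
  have hu₂ := n1.unique (n2.congr_of_eventuallyEq (eventually_of_mem hev hnull))
  have m1 := hm'.comp τ du
  have m2 := (dρ.div_const 2).mul ((dw.fun_pow 2).sub ((dρ.fun_pow 2).const_mul (Λ / 3)))
  have hm₁ := m1.unique (m2.congr_of_eventuallyEq (eventually_of_mem hev hmass))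
  rw [dr τ hτ, ddr, hr τ hτ]
  refine radial_defect hε hs (hF.pos τ (hIJ hτ)).ne' hD
    (hF.deriv_deriv (hIJ hτ)) (hmass τ hτ) (hnull τ hτ) ?_ ?_
  · linear_combination hu₂
  · rw [hm₁]
    simp only [Pi.sub_apply]
    push_cast
    ring

/-- What the matching conditions say about the surface and the exterior. -/
structure IsSolution (a : ℝ → ℝ) (Λ γ ε s : ℝ) (R u r m : ℝ → ℝ) (τ : ℝ) : Prop where
  speed : HasDerivAt R (s * ε * γ / a τ) τ
  radius : r τ = a τ * R τ
  radius_deriv : HasDerivAt r (deriv a τ * R τ + s * ε * γ) τ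
  chi_eq : chi Λ m (u τ) (r τ) = 1 - (deriv a τ * R τ) ^ 2
  mass_eq : m (u τ) = density Λ a τ * r τ ^ 3 / 6
  null_eq : s * deriv u τ * (1 - s * ε * (deriv a τ * R τ)) = 1 + γ
  side : 0 < s * (1 - s * ε * (deriv a τ * R τ))
  mass_deriv : deriv m (u τ) * deriv u τ =
    density Λ a τ * r τ ^ 2 / 2 * (s * ε * γ - γ * (deriv a τ * R τ))

/-- The radial defect has to vanish, and among its factors ρ, aR and 1 - (aR')² are positive, so sε
aR' = γ. The side condition is then the sign of u' in the null relation, whose right-hand side has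
become 1 + γ > 0. -/
theorem Matches.isSolution {Λ γ : ℝ} (hΛ : Λ < 0) (hγ₀ : 0 < γ) {J : Set ℝ} {a : ℝ → ℝ}
    (hF : IsFlatFLRW Λ γ J a) {ε s : ℝ} (hε : IsSign ε) (hs : IsSign s) {I : Set ℝ}
    (hI : IsOpen I) (hIJ : I ⊆ J) {R u r m : ℝ → ℝ} (M : Matches a Λ ε s I R u r m) {τ : ℝ}
    (hτ : τ ∈ I) : IsSolution a Λ γ ε s R u r m τ := by
  have hj : ∀ t ∈ I, IsJunction a Λ ε s R u r m t := fun t ht =>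
    M.isJunction hε hI (fun t ht => hF.differentiableAt (hIJ ht)) (fun t ht => hF.pos t (hIJ ht)) ht
  have dR : ∀ t ∈ I, HasDerivAt R (deriv R t) t := fun t ht =>
    (differentiableAt_of_contDiffOn_two hI M.smooth_R ht).hasDerivAt
  have dr : ∀ t ∈ I, HasDerivAt r (deriv a t * R t + a t * deriv R t) t := fun t ht =>
    (((hF.differentiableAt (hIJ ht)).hasDerivAt.mul (dR t ht)).congr_of_eventuallyEq
      (eventually_of_mem (hI.mem_nhds ht) fun t ht => (hj t ht).radius))
  have hnull : ∀ t ∈ I, s * deriv u t * (1 - s * ε * (deriv a t * R t)) =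
      1 + s * ε * (a t * deriv R t) := fun t ht => (hj t ht).null_eq hε hs (dr t ht).deriv
  have hmass : ∀ t ∈ I, m (u t) = a t * R t / 2 *
      ((deriv a t * R t) ^ 2 - Λ / 3 * (a t * R t) ^ 2) := fun t ht => by
    rw [← (hj t ht).radius]
    exact (hj t ht).mass_eq hε hs (dr t ht).deriv (M.pos_r t ht).ne'
  have ha := hF.pos τ (hIJ hτ)
  have hv : (a τ * deriv R τ) ^ 2 < 1 := by rw [mul_pow]; exact (hj τ hτ).timelike
  have hv' : 0 < 1 + s * ε * (a τ * deriv R τ) := by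
    obtain ⟨h4, h5⟩ := abs_lt.1 ((sq_lt_one_iff_abs_lt_one _).1 hv)
    rcases hε with rfl | rfl <;> rcases hs with rfl | rfl <;> linarith
  -- If it vanished, the null relation would read 0 = 1 + sε aR', against |aR'| < 1.
  have hD : 1 - s * ε * (deriv a τ * R τ) ≠ 0 := by
    intro h0
    have := hnull τ hτ
    rw [h0, mul_zero] at this
    linarith
  have hchi := (hj τ hτ).chi_eq hε hs (dr τ hτ).deriv
  have hdef := radial_defect_of_eqOn hF hε hs hI hIJ M.smooth_R M.smooth_u M.smooth_m M.future_u
    (fun t ht => (hj t ht).radius) hmass hnull hτ hD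
  have hrad := (hj τ hτ).radial
  rw [hchi] at hrad
  rw [hrad, sub_self, eq_comm, div_eq_zero_iff] at hdef
  have hρ := density_pos hΛ a τ
  have hvel : s * ε * (a τ * deriv R τ) = γ := by
    rcases hdef with h | h
    · have h1 : (3 * deriv a τ ^ 2 / a τ ^ 2 - Λ) ≠ 0 := hρ.ne'
      have h2 : a τ * R τ ≠ 0 := (mul_pos ha (M.pos_R τ hτ)).ne'
      have h3 : 1 - (a τ * deriv R τ) ^ 2 ≠ 0 := by linarith
      rcases mul_eq_zero.1 h with h | h
      · exact absurd h (mul_ne_zero (mul_ne_zero h1 h2) h3)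
      · linarith
    · exact absurd h (mul_ne_zero two_ne_zero hD)
  have hvel' : a τ * deriv R τ = s * ε * γ := by
    rw [← hvel]
    linear_combination -(a τ * deriv R τ) * s ^ 2 * hε.sq_eq - (a τ * deriv R τ) * hs.sq_eq
  have hN := hnull τ hτ
  rw [hvel] at hN
  have hu' := M.future_u τ hτ
  have hev : ∀ᶠ t in 𝓝 τ, t ∈ I := hI.mem_nhds hτ
  have dw := (hF.differentiableAt_deriv (hIJ hτ)).hasDerivAt.mul (dR τ hτ)
  have dρ := (hF.differentiableAt (hIJ hτ)).hasDerivAt.mul (dR τ hτ)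
  have m1 := (M.differentiableAt_mass hI hτ).hasDerivAt.comp τ
    (differentiableAt_of_contDiffOn_two hI M.smooth_u hτ).hasDerivAt
  have m2 := (dρ.div_const 2).mul ((dw.fun_pow 2).sub ((dρ.fun_pow 2).const_mul (Λ / 3)))
  have hm₁ := m1.unique (m2.congr_of_eventuallyEq (eventually_of_mem hev hmass))
  refine ⟨?_, (hj τ hτ).radius, ?_, hchi, ?_, hN, ?_, ?_⟩
  · rw [← hvel', mul_div_cancel_left₀ _ ha.ne']
    exact dR τ hτ
  · rw [← hvel']
    exact dr τ hτ
  · rw [hmass τ hτ, (hj τ hτ).radius]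
    unfold density
    field_simp
    ring
  · have h1 : 0 < deriv u τ * (s * (1 - s * ε * (deriv a τ * R τ))) := by linarith
    exact pos_of_mul_pos_right h1 hu'.le
  · rw [hm₁, (hj τ hτ).radius]
    simp only [Pi.mul_apply, Pi.sub_apply, hF.deriv_deriv (hIJ hτ), hvel']
    rw [show deriv R τ = s * ε * γ / a τ by rw [← hvel', mul_div_cancel_left₀ _ ha.ne']]
    unfold density
    field_simp
    ring

/-- ε m' u' equals γρr²/2 times the quantity in `side`, so the energy condition has the same origin
as the growth of u towards the future. -/
theorem IsSolution.exteriorDEC {Λ γ : ℝ} (hΛ : Λ < 0) (hγ₀ : 0 < γ) {a : ℝ → ℝ} {ε s : ℝ}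
    (hε : IsSign ε) (hs : IsSign s) {I : Set ℝ} {R u r m : ℝ → ℝ}
    (hu : ∀ τ ∈ I, 0 < deriv u τ) (h : ∀ τ ∈ I, IsSolution a Λ γ ε s R u r m τ) :
    ExteriorDEC ε (u '' I) m := by
  rintro _ ⟨τ, hτ, rfl⟩
  have h1 := (h τ hτ).mass_deriv
  have h2 := density_pos hΛ a τ
  have h3 := (h τ hτ).side
  have h4 : ε * deriv m (u τ) * deriv u τ = γ * (density Λ a τ * r τ ^ 2 / 2) *
      (s * (1 - s * ε * (deriv a τ * R τ))) := by
    linear_combination ε * h1 + density Λ a τ * r τ ^ 2 / 2 * γ * s * hε.sq_eq +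
      density Λ a τ * r τ ^ 2 / 2 * γ * ε * (deriv a τ * R τ) * hs.sq_eq
  exact nonneg_of_mul_nonneg_left (by rw [h4]; positivity) (hu τ hτ)

/-! ### The explicit interiors -/

/-- The Hubble rate scale `√(-Λ/3)`. -/
def hubbleScale (Λ : ℝ) : ℝ := Real.sqrt (-Λ / 3)

/-- The frequency `(3/2) (1 + γ) √(-Λ/3)` of the flat FLRW solutions. -/
def frequency (Λ γ : ℝ) : ℝ := 3 / 2 * (1 + γ) * hubbleScale Λ

/-- The scale factor `A cos(ω (c - t))^(2/(3(1+γ)))`. -/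
def scaleFactor (Λ γ A c : ℝ) (t : ℝ) : ℝ :=
  A * Real.cos (frequency Λ γ * (c - t)) ^ (2 / (3 * (1 + γ)))

/-- The lifetime of `scaleFactor`. -/
def lifetime (Λ γ c : ℝ) : Set ℝ :=
  Ioo (c - Real.pi / (2 * frequency Λ γ)) (c + Real.pi / (2 * frequency Λ γ))

variable {Λ γ : ℝ}

theorem hubbleScale_pos (hΛ : Λ < 0) : 0 < hubbleScale Λ := Real.sqrt_pos.2 (by linarith)

theorem hubbleScale_sq (hΛ : Λ < 0) : hubbleScale Λ ^ 2 = -Λ / 3 := Real.sq_sqrt (by linarith)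

theorem frequency_pos (hΛ : Λ < 0) (hγ₀ : 0 < γ) : 0 < frequency Λ γ := by
  have := hubbleScale_pos hΛ
  unfold frequency
  positivity

theorem mem_lifetime_iff (hω : 0 < frequency Λ γ) {c t : ℝ} : t ∈ lifetime Λ γ c ↔
    frequency Λ γ * (c - t) ∈ Ioo (-(Real.pi / 2)) (Real.pi / 2) := by
  have e : Real.pi / (2 * frequency Λ γ) = Real.pi / 2 / frequency Λ γ := by field_simp
  unfold lifetime
  rw [e, mem_Ioo, mem_Ioo]
  constructor
  · rintro ⟨h1, h2⟩
    have h3 : c - t < Real.pi / 2 / frequency Λ γ := by linarith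
    have h4 : t - c < Real.pi / 2 / frequency Λ γ := by linarith
    rw [lt_div_iff₀ hω] at h3 h4
    constructor <;> linarith
  · rintro ⟨h1, h2⟩
    have h3 : c - t < Real.pi / 2 / frequency Λ γ := by rw [lt_div_iff₀ hω]; linarith
    have h4 : t - c < Real.pi / 2 / frequency Λ γ := by rw [lt_div_iff₀ hω]; linarith
    constructor <;> linarith

theorem cos_pos_of_mem_lifetime (hω : 0 < frequency Λ γ) {c t : ℝ} (ht : t ∈ lifetime Λ γ c) :
    0 < Real.cos (frequency Λ γ * (c - t)) :=
  Real.cos_pos_of_mem_Ioo ((mem_lifetime_iff hω).1 ht)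

theorem hasDerivAt_phase (ω c t : ℝ) : HasDerivAt (fun t => ω * (c - t)) (-ω) t := by
  simpa using ((hasDerivAt_id t).const_sub c).const_mul ω

theorem hasDerivAt_scaleFactor (hω : 0 < frequency Λ γ) (hγ₀ : 0 < γ) (A : ℝ) {c t : ℝ}
    (ht : t ∈ lifetime Λ γ c) : HasDerivAt (scaleFactor Λ γ A c)
      (scaleFactor Λ γ A c t * (hubbleScale Λ * Real.tan (frequency Λ γ * (c - t)))) t := by
  have hc := cos_pos_of_mem_lifetime hω ht
  have h := (((hasDerivAt_phase (frequency Λ γ) c t).cos).rpow_const (p := 2 / (3 * (1 + γ)))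
    (Or.inl hc.ne')).const_mul A
  refine h.congr_deriv ?_
  have e : frequency Λ γ * (2 / (3 * (1 + γ))) = hubbleScale Λ := by
    unfold frequency; field_simp
  rw [Real.rpow_sub_one hc.ne', Real.tan_eq_sin_div_cos, ← e]
  unfold scaleFactor
  field_simp

theorem isFlatFLRW_scaleFactor (hΛ : Λ < 0) (hγ₀ : 0 < γ) {A : ℝ} (hA : 0 < A) (c : ℝ) :
    IsFlatFLRW Λ γ (lifetime Λ γ c) (scaleFactor Λ γ A c) := by
  have hω := frequency_pos hΛ hγ₀
  have hpos : ∀ t ∈ lifetime Λ γ c, 0 < scaleFactor Λ γ A c t := fun t ht =>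
    mul_pos hA (Real.rpow_pos_of_pos (cos_pos_of_mem_lifetime hω ht) _)
  refine ⟨⟨⟨c, ?_⟩, isOpen_Ioo, ordConnected_Ioo⟩, ?_, hpos, ?_⟩
  · rw [mem_lifetime_iff hω, sub_self, mul_zero, mem_Ioo]
    constructor <;> linarith [Real.pi_pos]
  · intro t ht
    have hc := cos_pos_of_mem_lifetime hω ht
    refine ContDiffAt.contDiffWithinAt ?_
    refine contDiffAt_const.mul (ContDiffAt.rpow_const_of_ne ?_ hc.ne')
    fun_prop
  · intro t ht
    have hc := cos_pos_of_mem_lifetime hω ht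
    have h1 := hasDerivAt_scaleFactor hω hγ₀ A ht
    have h2 : deriv (scaleFactor Λ γ A c) =ᶠ[𝓝 t] fun t =>
        scaleFactor Λ γ A c t * (hubbleScale Λ * Real.tan (frequency Λ γ * (c - t))) :=
      eventually_of_mem (isOpen_Ioo.mem_nhds ht) fun t ht =>
        (hasDerivAt_scaleFactor hω hγ₀ A ht).deriv
    have h3 := h1.fun_mul ((((Real.hasDerivAt_tan hc.ne').comp t
      (hasDerivAt_phase (frequency Λ γ) c t))).const_mul (hubbleScale Λ))
    have h4 := (h3.congr_of_eventuallyEq h2).deriv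
    have hp := (hpos t ht).ne'
    -- With sec² = 1 + tan² and Λ = -3h², the equation of state becomes a rational identity in the
    -- tangent and the scale h.
    have e1 : 1 / Real.cos (frequency Λ γ * (c - t)) ^ 2 =
        1 + Real.tan (frequency Λ γ * (c - t)) ^ 2 := by
      rw [Real.tan_eq_sin_div_cos]
      field_simp
      linarith [Real.sin_sq_add_cos_sq (frequency Λ γ * (c - t))]
    have e2 : Λ = -3 * hubbleScale Λ ^ 2 := by rw [hubbleScale_sq hΛ]; ring
    unfold pressure density
    rw [h4, h1.deriv, e1]
    simp only [Function.comp_apply]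
    generalize Real.tan (frequency Λ γ * (c - t)) = T
    generalize scaleFactor Λ γ A c t = S at hp
    rw [show frequency Λ γ = 3 / 2 * (1 + γ) * hubbleScale Λ from rfl]
    generalize hubbleScale Λ = h at e2
    subst e2
    field_simp
    ring

theorem IsFlatFLRW.hasDerivAt_hubble {J : Set ℝ} {a : ℝ → ℝ} (hF : IsFlatFLRW Λ γ J a)
    {t : ℝ} (ht : t ∈ J) : HasDerivAt (fun t => deriv a t / a t)
      (-(1 + γ) / 2 * (3 * (deriv a t / a t) ^ 2 - Λ)) t := by
  have ha := (hF.pos t ht).ne'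
  refine ((hF.differentiableAt_deriv ht).hasDerivAt.fun_div
    (hF.differentiableAt ht).hasDerivAt ha).congr_deriv ?_
  rw [hF.deriv_deriv ht]
  field_simp
  ring

/-- With h² = -Λ/3 the Hubble rate satisfies H' = -(3/2)(1 + γ)(H² + h²), so arctan(H/h) has the
constant derivative -ω. -/
theorem IsFlatFLRW.exists_phase (hΛ : Λ < 0) (hγ₀ : 0 < γ) {J : Set ℝ} {a : ℝ → ℝ}
    (hF : IsFlatFLRW Λ γ J a) :
    ∃ c, ∀ t ∈ J, Real.arctan (deriv a t / a t / hubbleScale Λ) = frequency Λ γ * (c - t) := by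
  have hω := frequency_pos hΛ hγ₀
  have hh := hubbleScale_pos hΛ
  have h1 : ∀ t ∈ J, HasDerivAt (fun t => Real.arctan (deriv a t / a t / hubbleScale Λ))
      (-frequency Λ γ) t := fun t ht => by
    refine (((hF.hasDerivAt_hubble ht).div_const (hubbleScale Λ)).arctan).congr_deriv ?_
    generalize deriv a t / a t = H
    have e2 : Λ = -3 * hubbleScale Λ ^ 2 := by rw [hubbleScale_sq hΛ]; ring
    rw [show frequency Λ γ = 3 / 2 * (1 + γ) * hubbleScale Λ from rfl]
    generalize hubbleScale Λ = h at e2 hh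
    subst e2
    have : h ^ 2 + H ^ 2 ≠ 0 := by positivity
    field_simp
    ring
  obtain ⟨k, hk⟩ := eq_add_const_of_hasDerivAt_eq hF.interval.2.2 h1
    fun t _ => hasDerivAt_phase (frequency Λ γ) 0 t
  refine ⟨k / frequency Λ γ, fun t ht => ?_⟩
  rw [hk t ht]
  field_simp
  ring

/-- The range of the arctangent confines J to one half-period of the phase. There log a and the
logarithm of the explicit solution have the same derivative, and the constant of integration becomes
the amplitude. -/
theorem IsFlatFLRW.exists_scaleFactor (hΛ : Λ < 0) (hγ₀ : 0 < γ) {J : Set ℝ} {a : ℝ → ℝ}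
    (hF : IsFlatFLRW Λ γ J a) : ∃ A c, 0 < A ∧ J ⊆ lifetime Λ γ c ∧
      EqOn a (scaleFactor Λ γ A c) J := by
  have hω := frequency_pos hΛ hγ₀
  have hh := hubbleScale_pos hΛ
  obtain ⟨c, hc⟩ := hF.exists_phase hΛ hγ₀
  have hsub : J ⊆ lifetime Λ γ c := fun t ht => by
    rw [mem_lifetime_iff hω, ← hc t ht]
    exact ⟨Real.neg_pi_div_two_lt_arctan _, Real.arctan_lt_pi_div_two _⟩
  have hder : ∀ t ∈ J, deriv a t =
      a t * (hubbleScale Λ * Real.tan (frequency Λ γ * (c - t))) := fun t ht => by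
    have := hF.pos t ht
    rw [← hc t ht, Real.tan_arctan]
    field_simp
  have hpos : ∀ t ∈ J, 0 < scaleFactor Λ γ 1 c t := fun t ht =>
    (isFlatFLRW_scaleFactor hΛ hγ₀ one_pos c).pos t (hsub ht)
  obtain ⟨k, hk⟩ := eq_add_const_of_hasDerivAt_eq (f := fun t => Real.log (a t))
    (g := fun t => Real.log (scaleFactor Λ γ 1 c t)) hF.interval.2.2
    (f' := fun t => hubbleScale Λ * Real.tan (frequency Λ γ * (c - t)))
    (fun t ht => by
      refine ((hF.differentiableAt ht).hasDerivAt.log (hF.pos t ht).ne').congr_deriv ?_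
      rw [hder t ht, mul_div_cancel_left₀ _ (hF.pos t ht).ne'])
    (fun t ht => by
      refine ((hasDerivAt_scaleFactor hω hγ₀ 1 (hsub ht)).log (hpos t ht).ne').congr_deriv ?_
      rw [mul_div_cancel_left₀ _ (hpos t ht).ne'])
  refine ⟨Real.exp k, c, Real.exp_pos k, hsub, fun t ht => ?_⟩
  rw [← Real.exp_log (hF.pos t ht), hk t ht, Real.exp_add, Real.exp_log (hpos t ht)]
  unfold scaleFactor
  ring

theorem IsFLRWInterior.exists_eq (hΛ : Λ < 0) (hγ₀ : 0 < γ) {J : Set ℝ} {a : ℝ → ℝ}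
    (h : IsFLRWInterior Λ γ J a) : ∃ A c, 0 < A ∧ J = lifetime Λ γ c ∧
      EqOn a (scaleFactor Λ γ A c) J := by
  obtain ⟨A, c, hA, hJ, ha⟩ := h.toIsFlatFLRW.exists_scaleFactor hΛ hγ₀
  exact ⟨A, c, hA, (h.maximal _ _ (isFlatFLRW_scaleFactor hΛ hγ₀ hA c) hJ ha.symm).symm, ha⟩

theorem IsFLRWInterior.deriv_eq (hΛ : Λ < 0) (hγ₀ : 0 < γ) {A c : ℝ} {a : ℝ → ℝ}
    (ha : EqOn a (scaleFactor Λ γ A c) (lifetime Λ γ c)) {t : ℝ} (ht : t ∈ lifetime Λ γ c) :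
    deriv a t = a t * (hubbleScale Λ * Real.tan (frequency Λ γ * (c - t))) := by
  rw [((hasDerivAt_scaleFactor (frequency_pos hΛ hγ₀) hγ₀ A ht).congr_of_eventuallyEq
    (eventually_of_mem (isOpen_Ioo.mem_nhds ht) ha)).deriv, ha ht]

/-- An extension has a linear phase of its own. Agreement at one time identifies the two phase
constants, and the bounds on the arctangent then keep the extension inside the lifetime. -/
theorem isFLRWInterior_scaleFactor (hΛ : Λ < 0) (hγ₀ : 0 < γ) {A : ℝ} (hA : 0 < A) (c : ℝ) :
    IsFLRWInterior Λ γ (lifetime Λ γ c) (scaleFactor Λ γ A c) := by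
  have hω := frequency_pos hΛ hγ₀
  have hh := hubbleScale_pos hΛ
  have hF := isFlatFLRW_scaleFactor hΛ hγ₀ hA c
  refine ⟨hF, fun J' a' hF' hJ heq => Subset.antisymm ?_ hJ⟩
  obtain ⟨c', hc'⟩ := hF'.exists_phase hΛ hγ₀
  obtain ⟨t₀, ht₀⟩ := hF.interval.1
  have h1 := hc' t₀ (hJ ht₀)
  rw [IsFLRWInterior.deriv_eq hΛ hγ₀ heq ht₀, mul_div_cancel_left₀ _ (hF'.pos _ (hJ ht₀)).ne',
    mul_div_cancel_left₀ _ hh.ne',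
    Real.arctan_tan ((mem_lifetime_iff hω).1 ht₀).1 ((mem_lifetime_iff hω).1 ht₀).2] at h1
  have h2 : c' = c := by
    have := mul_left_cancel₀ hω.ne' h1
    linarith
  subst h2
  intro t ht
  rw [mem_lifetime_iff hω, ← hc' t ht]
  exact ⟨Real.neg_pi_div_two_lt_arctan _, Real.arctan_lt_pi_div_two _⟩

/-- Every positive `a` and every `da/dt` occur in an interior. -/
theorem exists_isFLRWInterior (hΛ : Λ < 0) (hγ₀ : 0 < γ) {a₀ : ℝ} (ha₀ : 0 < a₀) (a₁ : ℝ) :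
    ∃ (J : Set ℝ) (a : ℝ → ℝ) (t₀ : ℝ), IsFLRWInterior Λ γ J a ∧ t₀ ∈ J ∧ a t₀ = a₀ ∧
      deriv a t₀ = a₁ := by
  have hω := frequency_pos hΛ hγ₀
  have hh := hubbleScale_pos hΛ
  have e : frequency Λ γ * (Real.arctan (a₁ / a₀ / hubbleScale Λ) / frequency Λ γ - 0) =
      Real.arctan (a₁ / a₀ / hubbleScale Λ) := by field_simp; ring
  set c := Real.arctan (a₁ / a₀ / hubbleScale Λ) / frequency Λ γ
  have h0 : (0 : ℝ) ∈ lifetime Λ γ c := by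
    rw [mem_lifetime_iff hω, e]
    exact ⟨Real.neg_pi_div_two_lt_arctan _, Real.arctan_lt_pi_div_two _⟩
  have hc := Real.rpow_pos_of_pos (cos_pos_of_mem_lifetime hω h0) (2 / (3 * (1 + γ)))
  have ha : scaleFactor Λ γ (a₀ / Real.cos (frequency Λ γ * (c - 0)) ^ (2 / (3 * (1 + γ)))) c 0 =
      a₀ := by
    unfold scaleFactor
    field_simp
  refine ⟨_, _, 0, isFLRWInterior_scaleFactor hΛ hγ₀ (div_pos ha₀ hc) c, h0, ha, ?_⟩
  rw [(hasDerivAt_scaleFactor hω hγ₀ _ h0).deriv, ha, e, Real.tan_arctan]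
  field_simp

theorem mem_lifetime_center (hω : 0 < frequency Λ γ) (c : ℝ) {x : ℝ}
    (hx : x ∈ Ioo (-(Real.pi / 2)) (Real.pi / 2)) : c - x / frequency Λ γ ∈ lifetime Λ γ c := by
  rw [mem_lifetime_iff hω]
  convert hx using 1
  field_simp
  ring

theorem IsFLRWInterior.exists_deriv_sign (hΛ : Λ < 0) (hγ₀ : 0 < γ) {J : Set ℝ} {a : ℝ → ℝ}
    (h : IsFLRWInterior Λ γ J a) {w : ℝ} (hw : IsSign w) : ∃ t ∈ J, 0 < w * deriv a t := by
  have hω := frequency_pos hΛ hγ₀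
  have hh := hubbleScale_pos hΛ
  obtain ⟨A, c, hA, rfl, ha⟩ := h.exists_eq hΛ hγ₀
  -- At phase wπ/4 the tangent is w, so a' has the sign w there.
  have hx : w * (Real.pi / 4) ∈ Ioo (-(Real.pi / 2)) (Real.pi / 2) := by
    rcases hw with rfl | rfl <;> constructor <;> linarith [Real.pi_pos]
  have ht := mem_lifetime_center hω c hx
  refine ⟨_, ht, ?_⟩
  rw [IsFLRWInterior.deriv_eq hΛ hγ₀ ha ht]
  have hp := h.pos _ ht
  have e : frequency Λ γ * (c - (c - w * (Real.pi / 4) / frequency Λ γ)) = w * (Real.pi / 4) := by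
    field_simp; ring
  rw [e]
  generalize a (c - w * (Real.pi / 4) / frequency Λ γ) = α at hp
  have hαh := mul_pos hp hh
  rcases hw with rfl | rfl
  · rw [one_mul, one_mul, Real.tan_pi_div_four]
    linarith
  · rw [neg_one_mul (Real.pi / 4), Real.tan_neg, Real.tan_pi_div_four]
    linarith

/-! ### Existence and uniqueness of the exterior -/

/-- The equation of state expresses a'' through a and a', which gains one derivative. The mass along
σ contains a', so it would otherwise be only C¹. -/
theorem IsFlatFLRW.contDiffOn_two_deriv {J : Set ℝ} {a : ℝ → ℝ} (hF : IsFlatFLRW Λ γ J a) :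
    ContDiffOn ℝ 2 (deriv a) J := by
  have h1 := hF.contDiffOn_deriv
  have h2 : ContDiffOn ℝ 1 a J := hF.smooth.of_le (by norm_num)
  have h3 : ∀ t ∈ J, a t ≠ 0 := fun t ht => (hF.pos t ht).ne'
  refine contDiffOn_two_of_hasDerivAt hF.interval.2.1
    (fun t ht => (hF.differentiableAt_deriv ht).hasDerivAt) ?_
  refine ContDiffOn.congr ?_ fun t ht => hF.deriv_deriv ht
  exact ((h1.pow 2).div h2 h3).sub ((contDiffOn_const.mul
    (((contDiffOn_const.mul (h1.pow 2)).div (h2.pow 2) fun t ht => pow_ne_zero 2 (h3 t ht)).sub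
      contDiffOn_const)).mul h2)

theorem IsSign.mul_sq {ε s : ℝ} (hε : IsSign ε) (hs : IsSign s) : (s * ε) ^ 2 = 1 := by
  rw [mul_pow, hε.sq_eq, hs.sq_eq, one_mul]

/-- The exterior is forced: u integrates the null relation, r = aR, and m is the mass prescribed
along σ composed with the inverse of u. The condition γ < 1 makes the surface timelike, since its
speed is aR' = ±γ. -/
theorem exists_matches (hγ₀ : 0 < γ) (hγ₁ : γ < 1) {J : Set ℝ} {a : ℝ → ℝ}
    (hF : IsFlatFLRW Λ γ J a) {ε s : ℝ} (hε : IsSign ε) (hs : IsSign s) {I : Set ℝ}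
    (hI : IsOpenInterval I) (hIJ : I ⊆ J) {R : ℝ → ℝ}
    (hR : ∀ τ ∈ I, HasDerivAt R (s * ε * γ / a τ) τ) (hR0 : ∀ τ ∈ I, 0 < R τ)
    (hside : ∀ τ ∈ I, 0 < s * (1 - s * ε * (deriv a τ * R τ))) :
    ∃ u r m : ℝ → ℝ, Matches a Λ ε s I R u r m := by
  have hδ := IsSign.mul_sq hε hs
  have hs2 := hs.sq_eq
  have ha2 := hF.smooth.mono hIJ
  have ha1 : ContDiffOn ℝ 1 a I := ha2.of_le (by norm_num)
  have hda2 := hF.contDiffOn_two_deriv.mono hIJ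
  have ha0 : ∀ τ ∈ I, a τ ≠ 0 := fun τ hτ => (hF.pos τ (hIJ hτ)).ne'
  have hR2 : ContDiffOn ℝ 2 R I :=
    contDiffOn_two_of_hasDerivAt hI.2.1 hR (contDiffOn_const.div ha1 ha0)
  have hw2 : ContDiffOn ℝ 2 (fun τ => deriv a τ * R τ) I := hda2.mul hR2
  have hD : ∀ τ ∈ I, 1 - s * ε * (deriv a τ * R τ) ≠ 0 := fun τ hτ h0 => by
    have := hside τ hτ
    rw [h0, mul_zero] at this
    exact this.false
  have hg : ContDiffOn ℝ 1 (fun τ => s * (1 + γ) / (1 - s * ε * (deriv a τ * R τ))) I :=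
    contDiffOn_const.div
      (contDiffOn_const.sub (contDiffOn_const.mul (hw2.of_le (by norm_num)))) hD
  obtain ⟨u, hu⟩ := exists_primitive hI hg.continuousOn
  have hu2 : ContDiffOn ℝ 2 u I := contDiffOn_two_of_hasDerivAt hI.2.1 hu hg
  have hu' : ∀ τ ∈ I, 0 < deriv u τ := fun τ hτ => by
    rw [(hu τ hτ).deriv, show s * (1 + γ) / (1 - s * ε * (deriv a τ * R τ)) =
      (1 + γ) / (s * (1 - s * ε * (deriv a τ * R τ))) by
        rw [div_eq_div_iff (hD τ hτ) (mul_ne_zero hs.ne_zero (hD τ hτ))]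
        linear_combination (1 + γ) * (1 - s * ε * (deriv a τ * R τ)) * hs2]
    exact div_pos (by linarith) (hside τ hτ)
  have hinj : InjOn u I := (strictMonoOn_of_hasDerivAt_pos hI.2.2 hu
    fun τ hτ => by rw [← (hu τ hτ).deriv]; exact hu' τ hτ).injOn
  have hr2 : ContDiffOn ℝ 2 (fun τ => a τ * R τ) I := ha2.mul hR2
  set M : ℝ → ℝ := fun τ => a τ * R τ / 2 *
      ((deriv a τ * R τ) ^ 2 - Λ / 3 * (a τ * R τ) ^ 2) with hM
  have hM2 : ContDiffOn ℝ 2 M I :=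
    (hr2.div_const 2).mul ((hw2.pow 2).sub (contDiffOn_const.mul (hr2.pow 2)))
  have hinv := contDiffOn_invFunOn hI.2.1 hu2 hu' hinj
  have hm2 : ContDiffOn ℝ 2 (M ∘ Function.invFunOn u I) (u '' I) :=
    hM2.comp hinv fun y hy => Function.invFunOn_mem hy
  have hmass : ∀ τ ∈ I, (M ∘ Function.invFunOn u I) (u τ) = M τ := fun τ hτ => by
    rw [Function.comp_apply, hinj.leftInvOn_invFunOn hτ]
  have hnull : ∀ τ ∈ I, s * deriv u τ * (1 - s * ε * (deriv a τ * R τ)) =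
      1 + s * ε * (a τ * deriv R τ) := fun τ hτ => by
    rw [(hu τ hτ).deriv, (hR τ hτ).deriv, mul_assoc, div_mul_cancel₀ _ (hD τ hτ),
      mul_div_cancel₀ _ (ha0 τ hτ)]
    linear_combination (1 + γ) * hs2 - γ * hδ
  refine ⟨u, fun τ => a τ * R τ, M ∘ Function.invFunOn u I, matches_of_isJunction hε hs hI.2.1
    (fun τ hτ => hF.differentiableAt (hIJ hτ)) (fun τ hτ => hF.pos τ (hIJ hτ)) hR2 hu2 hr2 hm2 hR0
    hu' fun τ hτ => ?_⟩
  have hap := hF.pos τ (hIJ hτ)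
  have hvel : a τ * deriv R τ = s * ε * γ := by
    rw [(hR τ hτ).deriv, mul_div_cancel₀ _ hap.ne']
  have hdr : deriv (fun τ => a τ * R τ) τ = deriv a τ * R τ + s * ε * γ := by
    rw [← hvel]
    exact ((hF.differentiableAt (hIJ hτ)).hasDerivAt.fun_mul
      (hR τ hτ).differentiableAt.hasDerivAt).deriv
  have hchi : chi Λ (M ∘ Function.invFunOn u I) (u τ) (a τ * R τ) = 1 - (deriv a τ * R τ) ^ 2 := by
    have := hR0 τ hτ
    unfold chi
    rw [hmass τ hτ, hM]
    field_simp
    ring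
  have hn := hnull τ hτ
  rw [hvel] at hn
  have hD' := hD τ hτ
  have hu1 : deriv u τ = s * (1 + γ) / (1 - s * ε * (deriv a τ * R τ)) := (hu τ hτ).deriv
  refine ⟨rfl, ?_, ?_, ?_, ?_⟩
  · rw [← mul_pow, hvel, mul_pow, hδ]
    nlinarith
  · rw [hchi, hdr, ← mul_pow, hvel, hu1]
    rcases hε with rfl | rfl <;> rcases hs with rfl | rfl <;>
    · simp only [one_mul, mul_one, neg_mul, sub_neg_eq_add, neg_neg, mul_neg] at hD' ⊢
      field_simp
      ring
  · rw [hchi, hdr, hvel, hu1]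
    rcases hε with rfl | rfl <;> rcases hs with rfl | rfl <;>
    · simp only [one_mul, mul_one, neg_mul, sub_neg_eq_add, neg_neg, mul_neg] at hD' ⊢
      field_simp
      ring
  -- For the prescribed speed the last factor of the defect is (sε)²γ - γ = 0.
  · have hdef := radial_defect_of_eqOn hF hε hs hI.2.1 hIJ hR2 hu2 hm2 hu'
      (r := fun τ => a τ * R τ) (fun _ _ => rfl) hmass hnull hτ (hD τ hτ)
    rw [hvel, show s * ε * (s * ε * γ) - γ = 0 by linear_combination γ * hδ, mul_zero, zero_div]
      at hdef
    rw [hchi]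
    exact sub_eq_zero.1 hdef

/-- Since γ ≠ 0, the speed of the surface determines the product sε; then s is the sign of 1 - sε
a'R by the side condition. With both signs known, the null relation fixes u', and u is left with a
translation. -/
theorem exterior_unique (hγ₀ : 0 < γ) {a : ℝ → ℝ} {ε s ε' s' : ℝ} (hε : IsSign ε) (hs : IsSign s)
    (hs' : IsSign s') {I : Set ℝ} (hI : IsOpenInterval I)
    (ha : ∀ τ ∈ I, 0 < a τ) {R u r m u' r' m' : ℝ → ℝ}
    (hu : ∀ τ ∈ I, DifferentiableAt ℝ u τ) (hu' : ∀ τ ∈ I, DifferentiableAt ℝ u' τ)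
    (h : ∀ τ ∈ I, IsSolution a Λ γ ε s R u r m τ)
    (h' : ∀ τ ∈ I, IsSolution a Λ γ ε' s' R u' r' m' τ) :
    ε' = ε ∧ s' = s ∧ ∃ κ : ℝ, ∀ τ ∈ I, u' τ = u τ + κ ∧ r' τ = r τ ∧ m' (u τ + κ) = m (u τ) := by
  obtain ⟨τ₀, hτ₀⟩ := hI.1
  have hδ : s' * ε' = s * ε := by
    have h1 := (h' τ₀ hτ₀).speed.unique (h τ₀ hτ₀).speed
    have h2 := (ha τ₀ hτ₀).ne'
    field_simp at h1
    exact h1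
  have hss : s' = s := by
    have h1 := (h τ₀ hτ₀).side
    have h2 := (h' τ₀ hτ₀).side
    rw [hδ] at h2
    rcases hs with rfl | rfl <;> rcases hs' with rfl | rfl <;> first | rfl | (exfalso; linarith)
  subst hss
  have hεε : ε' = ε := mul_left_cancel₀ hs'.ne_zero hδ
  subst hεε
  obtain ⟨κ, hκ⟩ := eq_add_const_of_hasDerivAt_eq (f := u') (g := u) (f' := deriv u) hI.2.2
    (fun τ hτ => by
      have h1 := (h τ hτ).null_eq
      have h2 := (h' τ hτ).null_eq
      have h3 := (h τ hτ).side
      have h4 : deriv u' τ = deriv u τ := by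
        apply mul_right_cancel₀ h3.ne'
        linarith
      rw [← h4]
      exact (hu' τ hτ).hasDerivAt)
    (fun τ hτ => (hu τ hτ).hasDerivAt)
  refine ⟨rfl, rfl, κ, fun τ hτ => ⟨hκ τ hτ, ?_, ?_⟩⟩
  · rw [(h' τ hτ).radius, (h τ hτ).radius]
  · rw [← hκ τ hτ, (h' τ hτ).mass_eq, (h τ hτ).mass_eq, (h' τ hτ).radius, (h τ hτ).radius]

/-! ### The one-parameter family of surfaces -/

/-- The times at which the surface `R` bounds a matched spacetime. -/
def matchingTimes (J : Set ℝ) (a : ℝ → ℝ) (ε s : ℝ) (R : ℝ → ℝ) : Set ℝ :=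
  {τ ∈ J | 0 < R τ ∧ 0 < s * (1 - s * ε * (deriv a τ * R τ))}

theorem IsFlatFLRW.deriv_deriv_neg (hΛ : Λ < 0) (hγ₀ : 0 < γ) {J : Set ℝ} {a : ℝ → ℝ}
    (hF : IsFlatFLRW Λ γ J a) {t : ℝ} (ht : t ∈ J) : deriv (deriv a) t < 0 := by
  have ha := hF.pos t ht
  rw [hF.deriv_deriv ht, show deriv a t ^ 2 / a t - (1 + γ) / 2 * (3 * deriv a t ^ 2 / a t ^ 2 - Λ)
    * a t = -((1 + 3 * γ) / 2 * (deriv a t ^ 2 / a t) + (1 + γ) / 2 * (-Λ) * a t) by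
      field_simp; ring, neg_lt_zero]
  have h1 : 0 < -Λ := by linarith
  positivity

theorem IsFlatFLRW.strictAntiOn_deriv (hΛ : Λ < 0) (hγ₀ : 0 < γ) {J : Set ℝ} {a : ℝ → ℝ}
    (hF : IsFlatFLRW Λ γ J a) : StrictAntiOn (deriv a) J :=
  strictAntiOn_of_hasDerivAt_neg hF.interval.2.2
    (fun _ ht => (hF.differentiableAt_deriv ht).hasDerivAt)
    fun _ ht => hF.deriv_deriv_neg hΛ hγ₀ ht

/-- Because 1 - δa'R = -a'(δR - 1/a'), the side condition compares δR with 1/a' as long as a' keeps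
its sign. The difference has derivative γ/a + a''/a'² = -(1 + γ)/2 · (1/a - Λa/a'²) < 0. As a'
decreases, its sign at one suitable end of the interval settles it throughout. -/
theorem IsFlatFLRW.crossing_lt (hΛ : Λ < 0) (hγ₀ : 0 < γ) {J : Set ℝ} {a : ℝ → ℝ}
    (hF : IsFlatFLRW Λ γ J a) {δ : ℝ} (hδ : δ ^ 2 = 1) {R : ℝ → ℝ}
    (hR : ∀ τ ∈ J, HasDerivAt R (δ * γ / a τ) τ) {x y : ℝ} (hx : x ∈ J) (hy : y ∈ J) (hxy : x < y)
    (hs : 0 < deriv a y ∨ deriv a x < 0) :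
    δ * R y - (deriv a y)⁻¹ < δ * R x - (deriv a x)⁻¹ := by
  have hsub : Icc x y ⊆ J := hF.interval.2.2.out hx hy
  have hanti := (hF.strictAntiOn_deriv hΛ hγ₀).antitoneOn
  have hne : ∀ t ∈ Icc x y, deriv a t ≠ 0 := fun t ht => by
    rcases hs with h | h
    · exact (h.trans_le (hanti (hsub ht) hy ht.2)).ne'
    · exact ((hanti hx (hsub ht) ht.1).trans_lt h).ne
  refine strictAntiOn_of_hasDerivAt_neg (f := fun t => δ * R t - (deriv a t)⁻¹) ordConnected_Icc
    (fun t ht => ((hR t (hsub ht)).const_mul δ).sub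
      ((hF.differentiableAt_deriv (hsub ht)).hasDerivAt.inv (hne t ht))) (fun t ht => ?_)
    (left_mem_Icc.2 hxy.le) (right_mem_Icc.2 hxy.le) hxy
  have ha := hF.pos t (hsub ht)
  have hn := hne t ht
  rw [hF.deriv_deriv (hsub ht), show δ * (δ * γ / a t) - -(deriv a t ^ 2 / a t -
    (1 + γ) / 2 * (3 * deriv a t ^ 2 / a t ^ 2 - Λ) * a t) / deriv a t ^ 2 =
    -((1 + γ) / 2 * (1 / a t + (-Λ) * a t / deriv a t ^ 2)) by
      field_simp
      linear_combination 2 * deriv a t ^ 2 * γ * hδ, neg_lt_zero]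
  have h1 : 0 < -Λ := by linarith
  positivity

theorem strictMonoOn_of_speed (hγ₀ : 0 < γ) {J : Set ℝ} {a : ℝ → ℝ} (hF : IsFlatFLRW Λ γ J a)
    {δ : ℝ} {R : ℝ → ℝ} (hR : ∀ τ ∈ J, HasDerivAt R (δ * γ / a τ) τ) (hδ : δ ^ 2 = 1) :
    StrictMonoOn (fun t => δ * R t) J :=
  strictMonoOn_of_hasDerivAt_pos hF.interval.2.2 (fun t ht => (hR t ht).const_mul δ)
    fun t ht => by
      rw [show δ * (δ * γ / a t) = γ / a t * δ ^ 2 by ring, hδ, mul_one]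
      exact div_pos hγ₀ (hF.pos t ht)

/-- Positivity of R passes to y from the end at which R is smaller: x if sε = 1, z if sε = -1. The
side condition passes forward from x for ε = 1 and backward from z for ε = -1, by
`IsFlatFLRW.crossing_lt`. For s = 1 it holds trivially where ε a' ≤ 0; for s = -1 it forces the sign
of a' at the end used. -/
theorem ordConnected_matchingTimes (hΛ : Λ < 0) (hγ₀ : 0 < γ) {J : Set ℝ} {a : ℝ → ℝ}
    (hF : IsFlatFLRW Λ γ J a) {ε s : ℝ} (hε : IsSign ε) (hs : IsSign s) {R : ℝ → ℝ}
    (hR : ∀ τ ∈ J, HasDerivAt R (s * ε * γ / a τ) τ) :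
    (matchingTimes J a ε s R).OrdConnected := by
  have hδ := IsSign.mul_sq hε hs
  have hanti := hF.strictAntiOn_deriv hΛ hγ₀
  have hmono := strictMonoOn_of_speed hγ₀ hF hR hδ
  refine ⟨fun x hx z hz y hy => ?_⟩
  rcases hy.1.eq_or_lt with rfl | hxy
  · exact hx
  rcases hy.2.eq_or_lt with rfl | hyz
  · exact hz
  obtain ⟨hxJ, hx1, hx2⟩ := hx
  obtain ⟨hzJ, hz1, hz2⟩ := hz
  have hyJ : y ∈ J := hF.interval.2.2.out hxJ hzJ hy
  have m1 := hmono hxJ hyJ hxy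
  have m2 := hmono hyJ hzJ hyz
  have d1 := hanti hxJ hyJ hxy
  have d2 := hanti hyJ hzJ hyz
  have g1 := hF.crossing_lt hΛ hγ₀ hδ hR hxJ hyJ hxy
  have g2 := hF.crossing_lt hΛ hγ₀ hδ hR hyJ hzJ hyz
  have key : ∀ {A : ℝ}, A ≠ 0 → ∀ B : ℝ, A * B - 1 = A * (B - A⁻¹) := fun hA B => by
    field_simp
  refine ⟨hyJ, ?_⟩
  rcases hε with rfl | rfl <;> rcases hs with rfl | rfl <;>
    simp only [one_mul, mul_one, neg_mul, neg_neg, mul_neg, sub_neg_eq_add] at *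
  · have hRy : 0 < R y := hx1.trans m1
    refine ⟨hRy, ?_⟩
    rcases le_or_gt (deriv a y) 0 with h | h
    · nlinarith
    · have k1 := key (h.trans d1).ne' (R x)
      have k2 := key h.ne' (R y)
      have := g1 (Or.inl h)
      have h3 : R x - (deriv a x)⁻¹ < 0 := by
        by_contra! h4
        nlinarith [mul_nonneg (h.trans d1).le h4]
      nlinarith [mul_neg_of_pos_of_neg h (this.trans h3)]
  · have hRy : 0 < R y := by linarith
    have hzn : deriv a x < 0 := by
      by_contra! h4
      nlinarith
    refine ⟨hRy, ?_⟩
    have hyn := d1.trans hzn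
    have k1 := key hzn.ne (-R x)
    have k2 := key hyn.ne (-R y)
    have := g1 (Or.inr hzn)
    have h3 : -R x - (deriv a x)⁻¹ < 0 := by
      by_contra! h4
      nlinarith [mul_nonneg (neg_nonneg.2 hzn.le) h4]
    nlinarith [mul_pos_of_neg_of_neg hyn (this.trans h3)]
  · have hRy : 0 < R y := by linarith
    refine ⟨hRy, ?_⟩
    rcases le_or_gt 0 (deriv a y) with h | h
    · nlinarith
    · have hzn := d2.trans h
      have k1 := key hzn.ne (-R z)
      have k2 := key h.ne (-R y)
      have := g2 (Or.inr h)
      have h3 : 0 < -R z - (deriv a z)⁻¹ := by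
        by_contra! h4
        nlinarith [mul_nonneg_of_nonpos_of_nonpos hzn.le h4]
      nlinarith [mul_neg_of_neg_of_pos h (h3.trans this)]
  · have hRy : 0 < R y := by linarith
    refine ⟨hRy, ?_⟩
    have hzp : 0 < deriv a z := by
      by_contra! h4
      nlinarith
    have hyp := hzp.trans d2
    have k1 := key hzp.ne' (R z)
    have k2 := key hyp.ne' (R y)
    have := g2 (Or.inl hzp)
    have h3 : 0 < R z - (deriv a z)⁻¹ := by
      by_contra! h4
      nlinarith [mul_nonneg hzp.le (neg_nonneg.2 h4)]
    nlinarith [mul_pos hyp (h3.trans this)]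

theorem isOpen_matchingTimes {J : Set ℝ} {a : ℝ → ℝ}
    (hF : IsFlatFLRW Λ γ J a) {ε s : ℝ} {R : ℝ → ℝ}
    (hR : ContinuousOn R J) : IsOpen (matchingTimes J a ε s R) := by
  have h1 : ContinuousOn (fun τ => (R τ, s * (1 - s * ε * (deriv a τ * R τ)))) J :=
    hR.prodMk (continuousOn_const.mul (continuousOn_const.sub
      (continuousOn_const.mul (hF.contDiffOn_deriv.continuousOn.mul hR))))
  exact h1.isOpen_inter_preimage hF.interval.2.1 (isOpen_Ioi.prod isOpen_Ioi)

/-- The parameters of the surfaces that bound a matched spacetime. -/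
def familyParameters (J : Set ℝ) (a : ℝ → ℝ) (ε s : ℝ) (R₀ : ℝ → ℝ) : Set ℝ :=
  {c | (matchingTimes J a ε s fun τ => c + R₀ τ).Nonempty}

theorem isOpen_familyParameters (J : Set ℝ) (a : ℝ → ℝ) (ε s : ℝ) (R₀ : ℝ → ℝ) :
    IsOpen (familyParameters J a ε s R₀) := by
  have h1 : familyParameters J a ε s R₀ = ⋃ τ ∈ J, {c | 0 < c + R₀ τ ∧
      0 < s * (1 - s * ε * (deriv a τ * (c + R₀ τ)))} := by
    ext c
    simp only [familyParameters, matchingTimes, Set.Nonempty, mem_ofPred_eq, mem_iUnion, exists_prop]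
  rw [h1]
  refine isOpen_biUnion fun τ _ => ?_
  have h2 : IsOpen {c : ℝ | 0 < c + R₀ τ} := isOpen_lt continuous_const (by fun_prop)
  have h3 : IsOpen {c : ℝ | 0 < s * (1 - s * ε * (deriv a τ * (c + R₀ τ)))} :=
    isOpen_lt continuous_const (by fun_prop)
  exact h2.inter h3

/-- The admissible constants are closed upwards. For s = -1 the side condition reads -εa'R > 1,
which a larger R preserves. For s = 1 it reads εa'R < 1; where εa' > 0 this may fail for a larger R,
and one changes to a time t₁ with εa' < 0, at which any positive R is admissible. This t₁ lies on
the side of τ where R is larger, so R stays positive. -/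
theorem isOpenInterval_familyParameters (hΛ : Λ < 0) (hγ₀ : 0 < γ) {J : Set ℝ} {a : ℝ → ℝ}
    (h : IsFLRWInterior Λ γ J a) {ε s : ℝ} (hε : IsSign ε) (hs : IsSign s) {R₀ : ℝ → ℝ}
    (hR : ∀ τ ∈ J, HasDerivAt R₀ (s * ε * γ / a τ) τ) :
    IsOpenInterval (familyParameters J a ε s R₀) := by
  have hF := h.toIsFlatFLRW
  have hδ := IsSign.mul_sq hε hs
  have hanti := (hF.strictAntiOn_deriv hΛ hγ₀).antitoneOn
  have hmono := (strictMonoOn_of_speed hγ₀ hF hR hδ).monotoneOn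
  have hδs : IsSign (-ε) := by
    rcases hε with rfl | rfl
    · exact Or.inr rfl
    · exact Or.inl (by norm_num)
  obtain ⟨t₁, ht₁, hd⟩ := h.exists_deriv_sign hΛ hγ₀ hδs
  have hup : ∀ c ∈ familyParameters J a ε s R₀, ∀ c' ≥ c, c' ∈ familyParameters J a ε s R₀ := by
    rintro c ⟨τ, hτ, hτ1, hτ2⟩ c' hc
    simp only [] at hτ1 hτ2
    rcases hs with rfl | rfl
    · simp only [one_mul] at *
      by_cases h0 : ε * deriv a τ ≤ 0
      · refine ⟨τ, hτ, by linarith, ?_⟩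
        have h1 : 0 < c' + R₀ τ := by linarith
        nlinarith
      · have h1 : 0 < c' + R₀ t₁ := by
          rcases hε with rfl | rfl
          · have h2 : τ ≤ t₁ := by
              by_contra! h3
              have := hanti ht₁ hτ h3.le
              linarith
            have := hmono hτ ht₁ h2
            simp only [one_mul] at this
            linarith
          · have h2 : t₁ ≤ τ := by
              by_contra! h3
              have := hanti hτ ht₁ h3.le
              linarith
            have := hmono ht₁ hτ h2
            simp only [neg_mul, one_mul] at this
            linarith
        refine ⟨t₁, ht₁, h1, ?_⟩
        nlinarith
    · refine ⟨τ, hτ, by linarith, ?_⟩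
      have h1 : 0 < -1 * ε * deriv a τ := by
        by_contra! h2
        nlinarith
      nlinarith
  refine ⟨?_, isOpen_familyParameters J a ε s R₀, ⟨fun c hc c' _ x hx => hup c hc x hx.1⟩⟩
  rcases hs with rfl | rfl
  · refine ⟨1 - R₀ t₁, t₁, ht₁, by simp, ?_⟩
    simp only [one_mul, sub_add_cancel]
    nlinarith
  · have hne : 0 < -1 * ε * deriv a t₁ := by linarith
    -- This constant gives -εa'R = 2 at t₁; any value above 1 would do.
    refine ⟨2 / (-1 * ε * deriv a t₁) - R₀ t₁, t₁, ht₁, ?_, ?_⟩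
    · simp only [sub_add_cancel]
      positivity
    · have e : -1 * ε * (deriv a t₁ * (2 / (-1 * ε * deriv a t₁) - R₀ t₁ + R₀ t₁)) = 2 := by
        rw [sub_add_cancel, ← mul_assoc]
        exact mul_div_cancel₀ _ hne.ne'
      simp only [e]
      norm_num

theorem exists_matching_family (hΛ : Λ < 0) (hγ₀ : 0 < γ) (hγ₁ : γ < 1) {J : Set ℝ} {a : ℝ → ℝ}
    (h : IsFLRWInterior Λ γ J a) {ε s : ℝ} (hε : IsSign ε) (hs : IsSign s) :
    ∃ (P : Set ℝ) (R : ℝ → ℝ → ℝ) (I : ℝ → Set ℝ),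
      IsOpenInterval P ∧
      (∀ c c' τ : ℝ, τ ∈ J → R c τ - R c' τ = c - c') ∧
      (∀ c ∈ P, IsOpenInterval (I c) ∧ I c ⊆ J ∧
        ∃ u r m : ℝ → ℝ, Matches a Λ ε s (I c) (R c) u r m ∧
          InteriorDEC Λ J a ∧ ExteriorDEC ε (u '' I c) m) ∧
      (∀ (I' : Set ℝ) (R' u' r' m' : ℝ → ℝ), IsOpenInterval I' → I' ⊆ J →
        Matches a Λ ε s I' R' u' r' m' →
        ∃ c ∈ P, I' ⊆ I c ∧ Set.EqOn R' (R c) I') ∧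
      (∀ c ∈ P, ∀ I' : Set ℝ, IsOpenInterval I' → I' ⊆ I c →
        ∀ u r m : ℝ → ℝ, Matches a Λ ε s I' (R c) u r m →
        ∀ ε' s' : ℝ, IsSign ε' → IsSign s' →
        ∀ u' r' m' : ℝ → ℝ, Matches a Λ ε' s' I' (R c) u' r' m' →
          ε' = ε ∧ s' = s ∧ ∃ κ : ℝ, ∀ τ ∈ I',
            u' τ = u τ + κ ∧ r' τ = r τ ∧ m' (u τ + κ) = m (u τ)) := by
  have hF := h.toIsFlatFLRW
  have hcont : ContinuousOn (fun τ => s * ε * γ / a τ) J :=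
    continuousOn_const.div hF.smooth.continuousOn fun τ hτ => (hF.pos τ hτ).ne'
  obtain ⟨R₀, hR₀⟩ := exists_primitive hF.interval hcont
  have hR : ∀ c : ℝ, ∀ τ ∈ J, HasDerivAt (fun τ => c + R₀ τ) (s * ε * γ / a τ) τ :=
    fun c τ hτ => (hR₀ τ hτ).const_add c
  refine ⟨familyParameters J a ε s R₀, fun c τ => c + R₀ τ,
    fun c => matchingTimes J a ε s fun τ => c + R₀ τ,
    isOpenInterval_familyParameters hΛ hγ₀ h hε hs hR₀, fun c c' τ _ => by ring, ?_, ?_, ?_⟩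
  · intro c hc
    have hI : IsOpenInterval (matchingTimes J a ε s fun τ => c + R₀ τ) :=
      ⟨hc, isOpen_matchingTimes hF fun τ hτ => (hR c τ hτ).continuousAt.continuousWithinAt,
        ordConnected_matchingTimes hΛ hγ₀ hF hε hs (hR c)⟩
    have hIJ : matchingTimes J a ε s (fun τ => c + R₀ τ) ⊆ J := fun τ hτ => hτ.1
    obtain ⟨u, r, m, M⟩ := exists_matches hγ₀ hγ₁ hF hε hs hI hIJ
      (fun τ hτ => hR c τ (hIJ hτ)) (fun τ hτ => hτ.2.1) (fun τ hτ => hτ.2.2)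
    exact ⟨hI, hIJ, u, r, m, M, hF.interiorDEC hΛ hγ₀ hγ₁,
      IsSolution.exteriorDEC hΛ hγ₀ hε hs M.future_u
        fun τ hτ => M.isSolution hΛ hγ₀ hF hε hs hI.2.1 hIJ hτ⟩
  · intro I' R' u' r' m' hI' hIJ' M
    have hsol := fun τ hτ => M.isSolution hΛ hγ₀ hF hε hs hI'.2.1 hIJ' (τ := τ) hτ
    obtain ⟨c, hc⟩ := eq_add_const_of_hasDerivAt_eq hI'.2.2 (fun τ hτ => (hsol τ hτ).speed)
      (fun τ hτ => hR₀ τ (hIJ' hτ))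
    have hc' : ∀ τ ∈ I', R' τ = c + R₀ τ := fun τ hτ => by rw [hc τ hτ, add_comm]
    have hsub : I' ⊆ matchingTimes J a ε s fun τ => c + R₀ τ := fun τ hτ => by
      refine ⟨hIJ' hτ, ?_, ?_⟩
      · have h1 := M.pos_R τ hτ
        rwa [hc' τ hτ] at h1
      · have h1 := (hsol τ hτ).side
        rwa [hc' τ hτ] at h1
    exact ⟨c, hI'.1.mono hsub, hsub, hc'⟩
  · intro c _ I' hI' hsub u r m M ε' s' hε' hs' u' r' m' M'
    have hIJ' : I' ⊆ J := fun τ hτ => (hsub hτ).1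
    exact exterior_unique hγ₀ hε hs hs' hI' (fun τ hτ => hF.pos τ (hIJ' hτ))
      (fun τ hτ => differentiableAt_of_contDiffOn_two hI'.2.1 M.smooth_u hτ)
      (fun τ hτ => differentiableAt_of_contDiffOn_two hI'.2.1 M'.smooth_u hτ)
      (fun τ hτ => M.isSolution hΛ hγ₀ hF hε hs hI'.2.1 hIJ' hτ)
      (fun τ hτ => M'.isSolution hΛ hγ₀ hF hε' hs' hI'.2.1 hIJ' hτ)

/-! ### Causal curves -/

theorem metricProd_exterior (m : ℝ → ℝ) (x v w : Coord) :
    metricProd (exteriorMetric Λ 1 m) x v w =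
      -chi Λ m (x 0) (x 1) * v 0 * w 0 + v 0 * w 1 + v 1 * w 0 + x 1 ^ 2 * v 2 * w 2 +
        x 1 ^ 2 * Real.sin (x 2) ^ 2 * v 3 * w 3 := by
  simp [metricProd, exteriorMetric, Fin.sum_univ_four]

theorem metricProd_interior_time (a : ℝ → ℝ) (x v : Coord) :
    metricProd (interiorMetric a) x v (interiorTime x) = -v 0 := by
  simp [metricProd, interiorMetric, interiorTime, Fin.sum_univ_four, Matrix.diagonal]

/-- The angular terms only add to the norm, so causality gives v⁰(2v¹ - χv⁰) ≤ 0, and future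
direction excludes v⁰ < 0. The result is the speed limit set by the outgoing radial null rays. -/
theorem causal_exterior {m : ℝ → ℝ} {x v : Coord}
    (h1 : metricProd (exteriorMetric Λ 1 m) x v v ≤ 0)
    (h2 : metricProd (exteriorMetric Λ 1 m) x v (exteriorTime Λ 1 m x) < 0) :
    0 ≤ v 0 ∧ v 1 ≤ chi Λ m (x 0) (x 1) / 2 * v 0 := by
  rw [metricProd_exterior] at h1 h2
  simp [exteriorTime] at h2
  have h3 : v 0 * (2 * v 1 - chi Λ m (x 0) (x 1) * v 0) ≤ 0 := by
    have e1 : 0 ≤ x 1 ^ 2 * v 2 * v 2 := by nlinarith [sq_nonneg (x 1 * v 2)]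
    have e2 : 0 ≤ x 1 ^ 2 * Real.sin (x 2) ^ 2 * v 3 * v 3 := by
      nlinarith [sq_nonneg (x 1 * Real.sin (x 2) * v 3)]
    linarith
  have h0 : 0 ≤ v 0 := by
    by_contra! h
    nlinarith
  refine ⟨h0, ?_⟩
  rcases h0.eq_or_lt with h | h
  · rw [← h] at h2 ⊢
    linarith
  · have := nonpos_of_mul_nonpos_right h3 h
    linarith

theorem IsCausalCurve.hasDerivAt {g : MetricField} {T : Coord → Coord} {D : Set Coord} {S : Set ℝ}
    {x : ℝ → Coord} (hx : IsCausalCurve g T D S x) {l : ℝ} (hl : l ∈ interior S) (i : Fin 4) :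
    HasDerivAt (fun l => x l i) (derivWithin x S l i) l := by
  have h1 := ((hx.1.differentiableOn one_ne_zero) l (interior_subset hl)).hasDerivWithinAt.hasDerivAt
    (mem_interior_iff_mem_nhds.1 hl)
  exact hasDerivAt_pi.1 h1 i

theorem IsCausalCurve.continuousOn {g : MetricField} {T : Coord → Coord} {D : Set Coord} {S : Set ℝ}
    {x : ℝ → Coord} (hx : IsCausalCurve g T D S x) (i : Fin 4) : ContinuousOn (fun l => x l i) S :=
  (continuous_apply i).comp_continuousOn hx.1.continuousOn

theorem IsCausalCurve.monotoneOn_interior {a : ℝ → ℝ} {D : Set Coord} {S : Set ℝ}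
    {x : ℝ → Coord} (hx : IsCausalCurve (interiorMetric a) interiorTime D S x) (hS : Convex ℝ S) :
    MonotoneOn (fun l => x l 0) S := by
  refine monotoneOn_of_deriv_nonneg hS (hx.continuousOn 0)
    (fun l hl => (hx.hasDerivAt hl 0).differentiableAt.differentiableWithinAt) fun l hl => ?_
  rw [(hx.hasDerivAt hl 0).deriv]
  have := (hx.2 l (interior_subset hl)).2.2
  rw [metricProd_interior_time] at this
  linarith

theorem IsCausalCurve.monotoneOn_exterior {m : ℝ → ℝ} {D : Set Coord} {S : Set ℝ}
    {x : ℝ → Coord} (hx : IsCausalCurve (exteriorMetric Λ 1 m) (exteriorTime Λ 1 m) D S x)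
    (hS : Convex ℝ S) : MonotoneOn (fun l => x l 0) S := by
  refine monotoneOn_of_deriv_nonneg hS (hx.continuousOn 0)
    (fun l hl => (hx.hasDerivAt hl 0).differentiableAt.differentiableWithinAt) fun l hl => ?_
  rw [(hx.hasDerivAt hl 0).deriv]
  have := (hx.2 l (interior_subset hl)).2
  exact (causal_exterior this.1 this.2).1

/-- In an exterior of positive, nondecreasing mass, causal curves do not leave the region of
trapped spheres. -/
theorem IsCausalCurve.chi_neg (hΛ : Λ < 0) {I : Set ℝ} {u r m : ℝ → ℝ}
    (hm : ∀ τ ∈ I, DifferentiableAt ℝ m (u τ)) (hm' : ∀ τ ∈ I, 0 ≤ deriv m (u τ))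
    (hm0 : ∀ τ ∈ I, 0 < m (u τ)) (hr : ∀ τ ∈ I, 0 < r τ) {S : Set ℝ} (hS : S.OrdConnected)
    {x : ℝ → Coord} (hx : IsCausalCurve (exteriorMetric Λ 1 m) (exteriorTime Λ 1 m)
      (exteriorRegion I u r) S x) {l₀ l₁ : ℝ} (h₀ : l₀ ∈ S) (h₁ : l₁ ∈ S) (h₀₁ : l₀ ≤ l₁)
    (hchi : chi Λ m (x l₀ 0) (x l₀ 1) < 0) : chi Λ m (x l₁ 0) (x l₁ 1) < 0 := by
  have hrpos : ∀ l ∈ S, 0 < x l 1 := fun l hl => by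
    obtain ⟨τ, hτ, _, h⟩ := (hx.2 l hl).1
    exact (hr τ hτ).trans_le h
  have hsub : Icc l₀ l₁ ⊆ S := hS.out h₀ h₁
  set f : ℝ → ℝ := fun l => chi Λ m (x l 0) (x l 1) with hf
  have hmc : ContinuousOn m (u '' I) := by
    rintro _ ⟨τ, hτ, rfl⟩
    exact (hm τ hτ).continuousAt.continuousWithinAt
  have hmx : ContinuousOn (fun l => m (x l 0)) S := hmc.comp (hx.continuousOn 0) fun l hl => by
    obtain ⟨τ, hτ, h, _⟩ := (hx.2 l hl).1
    exact ⟨τ, hτ, h.symm⟩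
  have hfc : ContinuousOn f S := (continuousOn_const.sub ((continuousOn_const.mul hmx).div
    (hx.continuousOn 1) fun l hl => (hrpos l hl).ne')).sub
      (continuousOn_const.mul ((hx.continuousOn 1).pow 2))
  by_contra! hpos
  -- Let b be the first parameter at which χ ≥ 0. Before b the radius does not increase and the mass
  -- does not decrease, so χ is nonincreasing up to b and still negative there, a contradiction.
  set Z := Icc l₀ l₁ ∩ f ⁻¹' Ici 0
  have hZc : IsClosed Z := (hfc.mono hsub).preimage_isClosed_of_isClosed isClosed_Icc isClosed_Ici
  have hZn : Z.Nonempty := ⟨l₁, ⟨h₀₁, le_rfl⟩, hpos⟩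
  have hZb : BddBelow Z := ⟨l₀, fun l hl => hl.1.1⟩
  have hmem := hZc.csInf_mem hZn hZb
  set b := sInf Z
  have hbS : Icc l₀ b ⊆ S := fun l hl => hsub ⟨hl.1, hl.2.trans hmem.1.2⟩
  have hneg : ∀ l ∈ Ioo l₀ b, f l < 0 := fun l hl => by
    by_contra! h
    exact (csInf_le hZb ⟨⟨hl.1.le, hl.2.le.trans hmem.1.2⟩, h⟩).not_gt hl.2
  have hder : ∀ l ∈ Ioo l₀ b, ∃ f' ≤ 0, HasDerivAt f f' l := fun l hl => by
    have hlS : l ∈ interior S := interior_mono hbS (by rwa [interior_Icc])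
    obtain ⟨⟨τ, hτ, hu, _⟩, hc1, hc2⟩ := hx.2 l (interior_subset hlS)
    obtain ⟨v0, v1⟩ := causal_exterior hc1 hc2
    have hxr := hrpos l (interior_subset hlS)
    have e1 : HasDerivAt m (deriv m (u τ)) (x l 0) := by rw [hu]; exact (hm τ hτ).hasDerivAt
    have e2 := e1.comp l (hx.hasDerivAt hlS 0)
    have e3 := hx.hasDerivAt hlS 1
    have e4 := (((e2.const_mul 2).fun_div e3 hxr.ne').const_sub 1).fun_sub
      ((e3.fun_pow 2).const_mul (Λ / 3))
    refine ⟨_, ?_, e4⟩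
    have hfl := hneg l hl
    have v2 : derivWithin x S l 1 ≤ 0 := v1.trans
      (mul_nonpos_of_nonpos_of_nonneg (by simp only [hf] at hfl; linarith) v0)
    have hm1 := hm' τ hτ
    have hm2 : 0 < m (x l 0) := by rw [hu]; exact hm0 τ hτ
    simp only [Function.comp_apply]
    have e5 : 0 ≤ 2 * (deriv m (u τ) * derivWithin x S l 0) * x l 1 := by positivity
    have e6 : 2 * m (x l 0) * derivWithin x S l 1 ≤ 0 :=
      mul_nonpos_of_nonneg_of_nonpos (by positivity) v2
    have e7 : 0 ≤ (2 * (deriv m (u τ) * derivWithin x S l 0) * x l 1 -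
      2 * m (x l 0) * derivWithin x S l 1) / x l 1 ^ 2 := by
        apply div_nonneg _ (by positivity)
        linarith
    have e8 : 0 ≤ Λ / 3 * (2 * x l 1 * derivWithin x S l 1) :=
      mul_nonneg_of_nonpos_of_nonpos (by linarith)
        (mul_nonpos_of_nonneg_of_nonpos (by positivity) v2)
    norm_num
    linarith
  have hanti : AntitoneOn f (Icc l₀ b) := by
    refine antitoneOn_of_deriv_nonpos (convex_Icc _ _) (hfc.mono hbS) ?_ ?_ <;>
      rw [interior_Icc] <;> intro l hl <;> obtain ⟨f', h1, h2⟩ := hder l hl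
    · exact h2.differentiableAt.differentiableWithinAt
    · rwa [h2.deriv]
  have h1 := hanti (left_mem_Icc.2 hmem.1.1) (right_mem_Icc.2 hmem.1.1) hmem.1.1
  have h2 : 0 ≤ f b := hmem.2
  exact absurd (h2.trans h1) (not_le.2 hchi)

theorem IsCausalCurve.antitoneOn_radius {m : ℝ → ℝ} {D : Set Coord} {S : Set ℝ}
    {x : ℝ → Coord} (hx : IsCausalCurve (exteriorMetric Λ 1 m) (exteriorTime Λ 1 m) D S x)
    (hS : Convex ℝ S) (hchi : ∀ l ∈ S, chi Λ m (x l 0) (x l 1) < 0) :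
    AntitoneOn (fun l => x l 1) S := by
  refine antitoneOn_of_deriv_nonpos hS (hx.continuousOn 1)
    (fun l hl => (hx.hasDerivAt hl 1).differentiableAt.differentiableWithinAt) fun l hl => ?_
  rw [(hx.hasDerivAt hl 1).deriv]
  have h1 := (hx.2 l (interior_subset hl)).2
  obtain ⟨h2, h3⟩ := causal_exterior h1.1 h1.2
  have h4 := hchi l (interior_subset hl)
  nlinarith

/-- The event lies in the interior later than `τH`, or in the exterior on a trapped sphere later
than `u(τH)`. -/
def IsTrappedEvent (Λ : ℝ) (I : Set ℝ) (u m : ℝ → ℝ) (τH : ℝ) : Event → Prop :=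
  Sum.elim (fun X => τH < X 0)
    (fun X => (∃ τ ∈ I, τH < τ ∧ X 0 = u τ) ∧ chi Λ m (X 0) (X 1) < 0)

/-- `IsTrappedEvent` survives every causal step: t and u never decrease, χ < 0 persists in the
exterior, and σ is itself trapped after τH, so crossings preserve it in both directions. On the
final piece the radius is then nonincreasing and cannot tend to infinity. -/
theorem not_isVisible (hΛ : Λ < 0) {a : ℝ → ℝ} {I : Set ℝ} {R u r m : ℝ → ℝ} {τH : ℝ}
    (hm : ∀ τ ∈ I, DifferentiableAt ℝ m (u τ)) (hm' : ∀ τ ∈ I, 0 ≤ deriv m (u τ))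
    (hm0 : ∀ τ ∈ I, 0 < m (u τ)) (hr : ∀ τ ∈ I, 0 < r τ) (hu : StrictMonoOn u I)
    (hchi : ∀ τ ∈ I, τH < τ → chi Λ m (u τ) (r τ) < 0) {e : Event}
    (he : IsTrappedEvent Λ I u m τH e) : ¬ IsVisible a Λ I R u r m e := by
  rintro ⟨x, hgen, hx, hlim, -⟩
  have hext : ∀ (S : Set ℝ) (y : ℝ → Coord), S.OrdConnected →
      IsCausalCurve (exteriorMetric Λ 1 m) (exteriorTime Λ 1 m) (exteriorRegion I u r) S y →
      ∀ l₀ ∈ S, ∀ l₁ ∈ S, l₀ ≤ l₁ → IsTrappedEvent Λ I u m τH (Sum.inr (y l₀)) →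
        IsTrappedEvent Λ I u m τH (Sum.inr (y l₁)) := by
    rintro S y hS hy l₀ h₀ l₁ h₁ h₀₁ ⟨⟨τ, hτ, hτH, hτu⟩, hc⟩
    refine ⟨?_, hy.chi_neg hΛ hm hm' hm0 hr hS h₀ h₁ h₀₁ hc⟩
    obtain ⟨τ', hτ', hτu', -⟩ := (hy.2 l₁ h₁).1
    refine ⟨τ', hτ', hτH.trans_le ?_, hτu'⟩
    have := hy.monotoneOn_exterior hS.convex h₀ h₁ h₀₁
    simp only [hτu, hτu'] at this
    exact (hu.le_iff_le hτ hτ').1 this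
  have hend : IsTrappedEvent Λ I u m τH (Sum.inr (x 0)) := by
    generalize (Sum.inr (x 0) : Event) = z at hgen ⊢
    induction hgen with
    | refl => exact he
    | tail _ hstep ih =>
      cases hstep with
      | interior y hy =>
        exact lt_of_lt_of_le ih (hy.monotoneOn_interior (convex_Icc 0 1)
          (left_mem_Icc.2 zero_le_one) (right_mem_Icc.2 zero_le_one) zero_le_one)
      | exterior y hy =>
        exact hext _ y ordConnected_Icc hy 0 (left_mem_Icc.2 zero_le_one) 1
          (right_mem_Icc.2 zero_le_one) zero_le_one ih
      | out τ hτ ϑ φ =>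
        have hτH : τH < τ := ih
        exact ⟨⟨τ, hτ, hτH, rfl⟩, hchi τ hτ hτH⟩
      | into τ hτ ϑ φ =>
        obtain ⟨⟨τ', hτ', hτH, h⟩, -⟩ := ih
        have h1 : τ = τ' := hu.injOn hτ hτ' h
        show τH < τ
        rw [h1]
        exact hτH
  have h0 : (0 : ℝ) ∈ Ico (0 : ℝ) 1 := ⟨le_rfl, one_pos⟩
  have hanti := hx.antitoneOn_radius (convex_Ico 0 1) fun l hl =>
    (hext _ x ordConnected_Ico hx 0 h0 l hl hl.1 hend).2
  have h1 : ∀ᶠ l : ℝ in 𝓝[<] 1, l ∈ Ico (0 : ℝ) 1 := Ico_mem_nhdsLT one_pos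
  obtain ⟨l, hl1, hl2⟩ := (h1.and (hlim.eventually_gt_atTop (x 0 1))).exists
  exact (hanti h0 hl1 hl1.1).not_gt hl2

/-! ### Causal curves that reach infinity -/

theorem hasDerivAt_escape (u₀ d X ϑ φ : ℝ) {l : ℝ} (hl : l < 1) :
    HasDerivAt (fun l : ℝ => (![u₀ + d * l, X / (1 - l), ϑ, φ] : Coord))
      ![d, X / (1 - l) ^ 2, 0, 0] l := by
  rw [hasDerivAt_pi]
  have hl' : 1 - l ≠ 0 := by linarith
  intro i
  fin_cases i
  · simpa using ((hasDerivAt_id l).const_mul d).const_add u₀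
  · have h := (hasDerivAt_const l X).fun_div ((hasDerivAt_id l).const_sub 1) hl'
    refine h.congr_deriv ?_
    simp
  · exact hasDerivAt_const l ϑ
  · exact hasDerivAt_const l φ

theorem isVisible_of_large (hΛ : Λ < 0) (a : ℝ → ℝ) {I : Set ℝ} (hI : IsOpenInterval I)
    (R : ℝ → ℝ) {u r m : ℝ → ℝ} (hu : StrictMonoOn u I) (huc : ContinuousOn u I)
    (hrc : ContinuousOn r I) (hmono : MonotoneOn (fun τ => m (u τ)) I)
    {τ : ℝ} (hτ : τ ∈ I) : ∃ X₀, ∀ X ≥ X₀, ∀ ϑ φ : ℝ,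
      IsVisible a Λ I R u r m (Sum.inr ![u τ, X, ϑ, φ]) := by
  obtain ⟨τ₁, hτ₁, h01⟩ : ∃ τ₁ ∈ I, τ < τ₁ := by
    have h1 : ∀ᶠ t in 𝓝[>] τ, t ∈ I := mem_nhdsWithin_of_mem_nhds (hI.2.1.mem_nhds hτ)
    obtain ⟨t, ht, ht'⟩ := (h1.and self_mem_nhdsWithin).exists
    exact ⟨t, ht, ht'⟩
  have hsub : Icc τ τ₁ ⊆ I := hI.2.2.out hτ hτ₁
  obtain ⟨B, hB⟩ := (isCompact_Icc (a := τ) (b := τ₁)).exists_bound_of_continuousOn (hrc.mono hsub)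
  set d := u τ₁ - u τ
  have hd : 0 < d := sub_pos.2 (hu hτ hτ₁ h01)
  have hL : 0 < -Λ := by linarith
  -- The escaping curve is r = X/(1 - l), with u linear from u(τ) to u(τ₁). The bound B keeps it
  -- outside σ; 2m(u(τ₁)) gives 1 - 2m/r ≥ 0, hence χ ≥ -Λr²/3; and the third bound makes this large
  -- enough for 2 dr ≤ χ du.
  refine ⟨max B (max (2 * m (u τ₁)) (6 / (-Λ * d))), fun X hX ϑ φ => ?_⟩
  have hX1 : B ≤ X := (le_max_left _ _).trans hX
  have hX2 : 2 * m (u τ₁) ≤ X := ((le_max_left _ _).trans (le_max_right _ _)).trans hX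
  have hX3 : 6 / (-Λ * d) ≤ X := ((le_max_right _ _).trans (le_max_right _ _)).trans hX
  have hXpos : 0 < X := lt_of_lt_of_le (by positivity) hX3
  have hX4 : 6 ≤ X * (-Λ * d) := (div_le_iff₀ (by positivity)).1 hX3
  set x : ℝ → Coord := fun l => ![u τ + d * l, X / (1 - l), ϑ, φ] with hx
  have hx0 : x 0 = ![u τ, X, ϑ, φ] := by simp [hx]
  refine ⟨x, by rw [hx0], ⟨?_, fun l hl => ?_⟩, ?_, τ₁, hτ₁, ?_⟩
  · rw [contDiffOn_pi]
    intro i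
    have h1 : ∀ l ∈ Ico (0 : ℝ) 1, 1 - l ≠ 0 := fun l hl => by linarith [hl.2]
    fin_cases i
    · show ContDiffOn ℝ 1 (fun l : ℝ => u τ + d * l) _
      fun_prop
    · show ContDiffOn ℝ 1 (fun l : ℝ => X / (1 - l)) _
      exact contDiffOn_const.div (contDiffOn_const.sub contDiffOn_id) h1
    · exact contDiffOn_const
    · exact contDiffOn_const
  · have hl1 : 0 < 1 - l := by linarith [hl.2]
    rw [(hasDerivAt_escape (u τ) d X ϑ φ hl.2).hasDerivWithinAt.derivWithin
      (uniqueDiffOn_Ico 0 1 l hl)]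
    have hul : u τ + d * l ∈ Icc (u τ) (u τ₁) := by
      constructor
      · have := mul_nonneg hd.le hl.1
        linarith
      · have := mul_le_mul_of_nonneg_left hl.2.le hd.le
        simp only [d] at this ⊢
        linarith
    obtain ⟨τ', hτ', hτu⟩ := intermediate_value_Icc h01.le (huc.mono hsub) hul
    have hXl : X ≤ X / (1 - l) := by
      rw [le_div_iff₀ hl1]
      nlinarith [mul_nonneg hXpos.le hl.1]
    have hchi : 2 * (X / (1 - l) ^ 2) ≤ chi Λ m (u τ + d * l) (X / (1 - l)) * d := by
      have hm1 : m (u τ') ≤ m (u τ₁) := hmono (hsub hτ') hτ₁ hτ'.2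
      have h1 : 2 * m (u τ') / (X / (1 - l)) ≤ 1 := by
        rw [div_le_one (by positivity)]
        linarith
      have h2 : -Λ / 3 * (X / (1 - l)) ^ 2 ≤ chi Λ m (u τ + d * l) (X / (1 - l)) := by
        rw [← hτu]
        unfold chi
        linarith
      refine le_trans ?_ (mul_le_mul_of_nonneg_right h2 hd.le)
      rw [div_pow, ← mul_div_assoc, ← mul_div_assoc, div_mul_eq_mul_div]
      refine div_le_div_of_nonneg_right ?_ (by positivity)
      nlinarith
    refine ⟨⟨τ', hsub hτ', hτu.symm, ?_⟩, ?_, ?_⟩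
    · exact ((Real.le_norm_self _).trans (hB τ' hτ')).trans (hX1.trans hXl)
    · rw [metricProd_exterior]
      simp [hx]
      nlinarith
    · rw [metricProd_exterior]
      simp [hx, exteriorTime]
      nlinarith
  · show Tendsto (fun l : ℝ => X / (1 - l)) (𝓝[<] 1) atTop
    have h1 : Tendsto (fun l : ℝ => 1 - l) (𝓝[<] 1) (𝓝[>] 0) := by
      refine tendsto_nhdsWithin_iff.2 ⟨?_, ?_⟩
      · have : Tendsto (fun l : ℝ => 1 - l) (𝓝 1) (𝓝 (1 - 1)) := by
          exact (continuous_const.sub continuous_id).tendsto 1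
        rw [sub_self] at this
        exact this.mono_left nhdsWithin_le_nhds
      · filter_upwards [self_mem_nhdsWithin] with l hl
        simpa using hl
    simp only [div_eq_mul_inv]
    exact (tendsto_inv_nhdsGT_zero.comp h1).const_mul_atTop hXpos
  · show Tendsto (fun l : ℝ => u τ + d * l) (𝓝[<] 1) (𝓝 (u τ₁))
    have h1 : Tendsto (fun l : ℝ => u τ + d * l) (𝓝 1) (𝓝 (u τ + d * 1)) :=
      (continuous_const.add (continuous_const.mul continuous_id)).tendsto 1
    rw [show u τ + d * 1 = u τ₁ by simp only [d]; ring] at h1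
    exact h1.mono_left nhdsWithin_le_nhds

/-! ### The end of the interior -/

/-- The end of `lifetime`. -/
def endTime (Λ γ c : ℝ) : ℝ := c + Real.pi / (2 * frequency Λ γ)

theorem tendsto_phase (hω : 0 < frequency Λ γ) (c : ℝ) :
    Tendsto (fun t => frequency Λ γ * (c - t)) (𝓝[<] endTime Λ γ c) (𝓝[>] (-(Real.pi / 2))) := by
  refine tendsto_nhdsWithin_iff.2 ⟨?_, ?_⟩
  · have h1 : Tendsto (fun t => frequency Λ γ * (c - t)) (𝓝 (endTime Λ γ c))
        (𝓝 (frequency Λ γ * (c - endTime Λ γ c))) :=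
      (continuous_const.mul (continuous_const.sub continuous_id)).tendsto _
    rw [show frequency Λ γ * (c - endTime Λ γ c) = -(Real.pi / 2) by
      unfold endTime; field_simp; ring] at h1
    exact h1.mono_left nhdsWithin_le_nhds
  · filter_upwards [self_mem_nhdsWithin] with t ht
    have h1 : t < c + Real.pi / (2 * frequency Λ γ) := ht
    have h2 : t - c < Real.pi / 2 / frequency Λ γ := by
      rw [div_div]; linarith
    rw [lt_div_iff₀ hω] at h2
    show -(Real.pi / 2) < _
    linarith

theorem eventually_mem_lifetime (hω : 0 < frequency Λ γ) (c : ℝ) :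
    ∀ᶠ t in 𝓝[<] endTime Λ γ c, t ∈ lifetime Λ γ c :=
  Ioo_mem_nhdsLT (by
    have : 0 < Real.pi / (2 * frequency Λ γ) := div_pos Real.pi_pos (by linarith)
    unfold endTime
    linarith)

theorem tendsto_cos_phase (hω : 0 < frequency Λ γ) (c : ℝ) :
    Tendsto (fun t => Real.cos (frequency Λ γ * (c - t))) (𝓝[<] endTime Λ γ c) (𝓝[>] 0) := by
  refine tendsto_nhdsWithin_iff.2 ⟨?_, ?_⟩
  · have h1 := (Real.continuous_cos.tendsto (-(Real.pi / 2))).comp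
      ((tendsto_phase hω c).mono_right nhdsWithin_le_nhds)
    rwa [Real.cos_neg, Real.cos_pi_div_two] at h1
  · filter_upwards [eventually_mem_lifetime hω c] with t ht using cos_pos_of_mem_lifetime hω ht

theorem tendsto_scaleFactor (hω : 0 < frequency Λ γ) (hγ₀ : 0 < γ) {A : ℝ} (hA : 0 < A) (c : ℝ) :
    Tendsto (scaleFactor Λ γ A c) (𝓝[<] endTime Λ γ c) (𝓝[>] 0) := by
  have hk : 0 < 2 / (3 * (1 + γ)) := by positivity
  refine tendsto_nhdsWithin_iff.2 ⟨?_, ?_⟩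
  · have h1 := (((Real.continuous_rpow_const hk.le).tendsto 0).comp
      ((tendsto_cos_phase hω c).mono_right nhdsWithin_le_nhds)).const_mul A
    rwa [Real.zero_rpow hk.ne', mul_zero] at h1
  · filter_upwards [eventually_mem_lifetime hω c] with t ht using
      mul_pos hA (Real.rpow_pos_of_pos (cos_pos_of_mem_lifetime hω ht) _)

section Limits

variable {A c : ℝ} {a : ℝ → ℝ}

theorem tendsto_hubble (hΛ : Λ < 0) (hγ₀ : 0 < γ) (hA : 0 < A)
    (ha : EqOn a (scaleFactor Λ γ A c) (lifetime Λ γ c)) :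
    Tendsto (fun t => deriv a t / a t) (𝓝[<] endTime Λ γ c) atBot := by
  have hω := frequency_pos hΛ hγ₀
  have h1 := (Real.tendsto_tan_neg_pi_div_two.comp (tendsto_phase hω c)).const_mul_atBot
    (hubbleScale_pos hΛ)
  refine h1.congr' ?_
  filter_upwards [eventually_mem_lifetime hω c] with t ht
  have h2 : 0 < a t := by
    rw [ha ht]
    exact mul_pos hA (Real.rpow_pos_of_pos (cos_pos_of_mem_lifetime hω ht) _)
  rw [IsFLRWInterior.deriv_eq hΛ hγ₀ ha ht, mul_div_cancel_left₀ _ h2.ne', Function.comp_apply]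

theorem tendsto_density (hΛ : Λ < 0) (hγ₀ : 0 < γ) (hA : 0 < A)
    (ha : EqOn a (scaleFactor Λ γ A c) (lifetime Λ γ c)) :
    Tendsto (density Λ a) (𝓝[<] endTime Λ γ c) atTop := by
  have h1 := tendsto_hubble hΛ hγ₀ hA ha
  have h2 := tendsto_atTop_add_const_right _ (-Λ)
    ((h1.atBot_mul_atBot₀ h1).const_mul_atTop (by norm_num : (0 : ℝ) < 3))
  refine h2.congr fun t => ?_
  unfold density
  ring

/-- Here a' is a positive multiple of sin · cos^(k-1) with k = 2/(3(1 + γ)) < 1; the sine tends to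
-1 and the power of the cosine blows up. Mere divergence of a'/a would not suffice to bring a'R
below -1. -/
theorem tendsto_deriv (hΛ : Λ < 0) (hγ₀ : 0 < γ) (hA : 0 < A)
    (ha : EqOn a (scaleFactor Λ γ A c) (lifetime Λ γ c)) :
    Tendsto (deriv a) (𝓝[<] endTime Λ γ c) atBot := by
  have hω := frequency_pos hΛ hγ₀
  have hk : 0 < 1 - 2 / (3 * (1 + γ)) := by
    rw [sub_pos, div_lt_one (by positivity)]
    linarith
  have h1 := (tendsto_rpow_neg_nhdsGT_zero (by linarith : 2 / (3 * (1 + γ)) - 1 < 0)).comp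
    (tendsto_cos_phase hω c)
  have h2 := (Real.continuous_sin.tendsto (-(Real.pi / 2))).comp
      ((tendsto_phase hω c).mono_right nhdsWithin_le_nhds)
  rw [Real.sin_neg, Real.sin_pi_div_two] at h2
  have h3 := (h1.atTop_mul_neg (by norm_num) h2).const_mul_atBot (mul_pos hA (hubbleScale_pos hΛ))
  refine h3.congr' ?_
  filter_upwards [eventually_mem_lifetime hω c] with t ht
  have hc := cos_pos_of_mem_lifetime hω ht
  rw [IsFLRWInterior.deriv_eq hΛ hγ₀ ha ht, ha ht, scaleFactor, Real.tan_eq_sin_div_cos]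
  simp only [Function.comp_apply]
  rw [Real.rpow_sub_one hc.ne']
  field_simp

end Limits

/-! ### Formation of the black hole -/

/-- Decrease is only assumed from points where f ≤ 0, which is enough for a negative level: f falls
from the crossing on, and an earlier value at or below ℓ would push f(τ) strictly below ℓ. -/
theorem exists_unique_crossing {f : ℝ → ℝ} {t₀ T ℓ : ℝ} (hfc : ContinuousOn f (Ico t₀ T))
    (hf : ∀ x ∈ Ico t₀ T, ∀ y ∈ Ico t₀ T, x < y → f x ≤ 0 → f y < f x) (hℓ : ℓ < 0)
    (h0 : ℓ ≤ f t₀) (h1 : ∃ t ∈ Ico t₀ T, f t < ℓ) :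
    ∃ τ ∈ Ico t₀ T, f τ = ℓ ∧ (∀ t ∈ Ico t₀ τ, ℓ < f t) ∧ ∀ t ∈ Ioo τ T, f t < ℓ := by
  obtain ⟨t, ht, hlt⟩ := h1
  obtain ⟨τ, hτ, hτℓ⟩ := intermediate_value_Icc' ht.1
    (hfc.mono fun x hx => ⟨hx.1, hx.2.trans_lt ht.2⟩) ⟨hlt.le, h0⟩
  have hτT : τ ∈ Ico t₀ T := ⟨hτ.1, hτ.2.trans_lt ht.2⟩
  refine ⟨τ, hτT, hτℓ, fun x hx => ?_, fun x hx => ?_⟩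
  · by_contra! h
    have := hf x ⟨hx.1, hx.2.trans hτT.2⟩ τ hτT hx.2 (by linarith)
    linarith
  · rw [← hτℓ]
    exact hf τ hτT x ⟨hτT.1.trans hx.1.le, hx.2⟩ hx.1 (by linarith)

/-- A positive decreasing area radius with `dr/dt = (a'/a) r + γ` vanishes at the singularity. -/
theorem tendsto_radius_zero {a a' r : ℝ → ℝ} {t₁ T : ℝ} (ht : t₁ < T)
    (ha0 : ∀ t ∈ Ioo t₁ T, 0 < a t) (ha : ∀ t ∈ Ioo t₁ T, HasDerivAt a (a' t) t)
    (ha' : ∀ t ∈ Ioo t₁ T, a' t < 0)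
    (hr : ∀ t ∈ Ioo t₁ T, HasDerivAt r (a' t / a t * r t + γ) t) (hr0 : ∀ t ∈ Ioo t₁ T, 0 < r t)
    (hanti : AntitoneOn r (Ioo t₁ T)) (hlim : Tendsto a (𝓝[<] T) (𝓝[>] 0)) :
    Tendsto r (𝓝[<] T) (𝓝 0) := by
  have hmem : ∀ᶠ t in 𝓝[<] T, t ∈ Ioo t₁ T := Ioo_mem_nhdsLT ht
  refine tendsto_order.2 ⟨fun b hb => hmem.mono fun t h => hb.trans (hr0 t h), fun ℓ hℓ => ?_⟩
  by_cases hex : ∃ t ∈ Ioo t₁ T, r t < ℓ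
  · obtain ⟨t, h1, h2⟩ := hex
    have h3 : ∀ᶠ x in 𝓝[<] T, x ∈ Ioo t T := Ioo_mem_nhdsLT h1.2
    filter_upwards [h3] with x hx
    exact (hanti h1 ⟨h1.1.trans hx.1, hx.2⟩ hx.1.le).trans_lt h2
  · push Not at hex
    exfalso
    -- If r stayed above ℓ, this g would be nonincreasing, its derivative being (a'/a)(r - ℓ). But
    -- log a → -∞ while r > 0 and γt is bounded, so g would be unbounded above.
    set g : ℝ → ℝ := fun t => r t - ℓ * Real.log (a t) - γ * t with hg
    have hgd : ∀ t ∈ Ioo t₁ T, HasDerivAt g (a' t / a t * (r t - ℓ)) t := fun t h => by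
      refine (((hr t h).sub (((ha t h).log (ha0 t h).ne').const_mul ℓ)).sub
        ((hasDerivAt_id t).const_mul γ)).congr_deriv ?_
      ring
    have hgm : AntitoneOn g (Ioo t₁ T) := by
      refine antitoneOn_of_deriv_nonpos (convex_Ioo _ _)
        (fun t h => (hgd t h).continuousAt.continuousWithinAt) ?_ ?_ <;> rw [interior_Ioo]
      · exact fun t h => (hgd t h).differentiableAt.differentiableWithinAt
      · intro t h
        rw [(hgd t h).deriv]
        exact mul_nonpos_of_nonpos_of_nonneg (div_neg_of_neg_of_pos (ha' t h) (ha0 t h)).le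
          (sub_nonneg.2 (hex t h))
    obtain ⟨t₂, ht₂⟩ := hmem.exists
    have h1 : Tendsto (fun t => ℓ * Real.log (a t) + (g t₂ + |γ| * (|t₂| + |T|))) (𝓝[<] T) atBot :=
      tendsto_atBot_add_const_right _ _
        ((Real.tendsto_log_nhdsGT_zero.comp hlim).const_mul_atBot hℓ)
    have h2 : ∀ᶠ x in 𝓝[<] T, x ∈ Ioo t₂ T := Ioo_mem_nhdsLT ht₂.2
    obtain ⟨t, h3, h4⟩ := (h2.and (h1.eventually_lt_atBot 0)).exists
    have h5 : t ∈ Ioo t₁ T := ⟨ht₂.1.trans h3.1, h3.2⟩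
    have h6 : g t ≤ g t₂ := hgm ht₂ h5 h3.1.le
    have h7 := hr0 t h5
    have h8 : γ * t ≤ |γ| * (|t₂| + |T|) := by
      refine (le_abs_self _).trans ?_
      rw [abs_mul]
      refine mul_le_mul_of_nonneg_left (abs_le.2 ⟨?_, ?_⟩) (abs_nonneg _)
      · linarith [neg_abs_le t₂, abs_nonneg T, h3.1]
      · linarith [le_abs_self T, abs_nonneg t₂, h3.2]
    simp only [hg] at h6 h4
    linarith

theorem strictMonoOn_chi (hΛ : Λ < 0) {m : ℝ → ℝ} {v : ℝ} (hm : 0 < m v) :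
    StrictMonoOn (chi Λ m v) (Ioi 0) := by
  intro x hx y hy hxy
  have hx : 0 < x := hx
  have h1 : 2 * m v / y < 2 * m v / x := div_lt_div_of_pos_left (by positivity) hx hxy
  have h2 : x ^ 2 < y ^ 2 := pow_lt_pow_left₀ hxy hx.le two_ne_zero
  unfold chi
  nlinarith

theorem exists_chi_eq_zero (hΛ : Λ < 0) {m : ℝ → ℝ} {v r : ℝ} (hr : 0 < r)
    (h : chi Λ m v r ≤ 0) : ∃ X, r ≤ X ∧ chi Λ m v X = 0 := by
  set b := max r (2 * m v)
  have hb : 0 < b := hr.trans_le (le_max_left _ _)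
  have hbp : 0 ≤ chi Λ m v b := by
    have h1 : 2 * m v / b ≤ 1 := (div_le_one hb).2 (le_max_right _ _)
    have h2 : 0 ≤ -Λ / 3 * b ^ 2 := mul_nonneg (by linarith) (sq_nonneg b)
    unfold chi
    linarith
  have hc : ContinuousOn (chi Λ m v) (Icc r b) := fun x hx =>
    (hasDerivAt_chi_radius Λ m v (hr.trans_le hx.1).ne').continuousAt.continuousWithinAt
  obtain ⟨X, hX, hX0⟩ := intermediate_value_Icc (le_max_left r (2 * m v)) hc ⟨h, hbp⟩
  exact ⟨X, hX.1, hX0⟩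

theorem isAsymptoticallyAdS_exteriorMetric (Λ ε : ℝ) (m : ℝ → ℝ) (v : ℝ) :
    IsAsymptoticallyAdS Λ ε (exteriorMetric Λ ε m) v := by
  intro θ φ μ ν
  by_cases h : μ = 0 ∧ ν = 0
  · obtain ⟨rfl, rfl⟩ := h
    have e : (fun r : ℝ => exteriorMetric Λ ε m ![v, r, θ, φ] 0 0 -
        exteriorMetric Λ ε (fun _ => 0) ![v, r, θ, φ] 0 0) =
        fun r => 2 * m v * (r ^ fallOff 0 0)⁻¹ := by
      funext r
      simp [exteriorMetric, chi, fallOff]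
      ring
    rw [e]
    exact Asymptotics.isBigO_const_mul_self _ _ _
  · have e : (fun r : ℝ => exteriorMetric Λ ε m ![v, r, θ, φ] μ ν -
        exteriorMetric Λ ε (fun _ => 0) ![v, r, θ, φ] μ ν) = fun _ => 0 := by
      funext r
      fin_cases μ <;> fin_cases ν <;> simp_all [exteriorMetric]
    rw [e]
    exact Asymptotics.isBigO_zero _ _

/-- All clauses reduce to f = a'R. The interior sphere at X is classified by a'X, so the horizon
there is X = -1/a'; in the exterior it is the zero of χ, unique because χ increases in r when m > 0.
Both meet σ where f = -1. -/
theorem exists_formsBlackHole (hΛ : Λ < 0) (hγ₀ : 0 < γ) (hγ₁ : γ < 1) {J : Set ℝ} {a : ℝ → ℝ}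
    (h : IsFLRWInterior Λ γ J a) {I : Set ℝ} (hI : IsOpenInterval I) (hIJ : I ⊆ J) {t₀ : ℝ}
    (ht₀ : t₀ ∈ I) (hend : ∀ τ ∈ J, t₀ ≤ τ → τ ∈ I) {R u r m : ℝ → ℝ}
    (M : Matches a Λ 1 1 I R u r m) (hf0 : -1 < deriv a t₀ * R t₀) :
    ∃ (τm τH T : ℝ) (RH rH : ℝ → ℝ), FormsBlackHole Λ J a t₀ I R u r m τm τH T RH rH := by
  have hF := h.toIsFlatFLRW
  have hω := frequency_pos hΛ hγ₀
  obtain ⟨A, c, hA, hJ, haA⟩ := h.exists_eq hΛ hγ₀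
  have haA' : EqOn a (scaleFactor Λ γ A c) (lifetime Λ γ c) := hJ ▸ haA
  set T := endTime Λ γ c with hT
  have hsol : ∀ τ ∈ I, IsSolution a Λ γ 1 1 R u r m τ := fun τ hτ =>
    M.isSolution hΛ hγ₀ hF (Or.inl rfl) (Or.inl rfl) hI.2.1 hIJ hτ
  have hJT : ∀ τ ∈ J, τ < T := fun τ hτ => by
    rw [hJ] at hτ
    exact hτ.2
  have hKJ : ∀ τ ∈ Ico t₀ T, τ ∈ J := fun τ hτ => by
    have h1 := hIJ ht₀
    rw [hJ] at h1 ⊢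
    exact ⟨h1.1.trans_le hτ.1, hτ.2⟩
  have hKI : ∀ τ ∈ Ico t₀ T, τ ∈ I := fun τ hτ => hend τ (hKJ τ hτ) hτ.1
  have ht₀T : t₀ < T := hJT t₀ (hIJ ht₀)
  have hda : ∀ τ ∈ J, DifferentiableAt ℝ a τ := fun τ hτ => hF.differentiableAt hτ
  have hpos := hF.pos
  have hanti := hF.strictAntiOn_deriv hΛ hγ₀
  have hRmono : StrictMonoOn R I := strictMonoOn_of_hasDerivAt_pos hI.2.2
    (fun τ hτ => (hsol τ hτ).speed) fun τ hτ => by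
      have := hpos τ (hIJ hτ)
      positivity
  have hum : StrictMonoOn u I := strictMonoOn_of_hasDerivAt_pos hI.2.2
    (fun τ hτ => (differentiableAt_of_contDiffOn_two hI.2.1 M.smooth_u hτ).hasDerivAt) M.future_u
  have hmd : ∀ τ ∈ I, DifferentiableAt ℝ m (u τ) := fun τ hτ => M.differentiableAt_mass hI.2.1 hτ
  have hm' : ∀ τ ∈ I, 0 ≤ deriv m (u τ) := fun τ hτ => by
    have := IsSolution.exteriorDEC hΛ hγ₀ (Or.inl rfl) (Or.inl rfl) M.future_u hsol (u τ)
      (mem_image_of_mem u hτ)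
    rwa [one_mul] at this
  have hm0 : ∀ τ ∈ I, 0 < m (u τ) := fun τ hτ => by
    rw [(hsol τ hτ).mass_eq]
    have := density_pos hΛ a τ
    have := M.pos_r τ hτ
    positivity
  have hmmono : MonotoneOn (fun τ => m (u τ)) I := by
    have hd : ∀ τ ∈ I, HasDerivAt (fun τ => m (u τ)) (deriv m (u τ) * deriv u τ) τ := fun τ hτ =>
      (hmd τ hτ).hasDerivAt.comp τ
        (differentiableAt_of_contDiffOn_two hI.2.1 M.smooth_u hτ).hasDerivAt
    refine monotoneOn_of_deriv_nonneg hI.2.2.convex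
      (fun τ hτ => (hd τ hτ).continuousAt.continuousWithinAt) ?_ ?_ <;>
      rw [hI.2.1.interior_eq] <;> intro τ hτ
    · exact (hd τ hτ).differentiableAt.differentiableWithinAt
    · rw [(hd τ hτ).deriv]
      exact mul_nonneg (hm' τ hτ) (M.future_u τ hτ).le
  have hchi : ∀ τ ∈ I, chi Λ m (u τ) (r τ) = 1 - (deriv a τ * R τ) ^ 2 := fun τ hτ =>
    (hsol τ hτ).chi_eq
  set f : ℝ → ℝ := fun τ => deriv a τ * R τ with hf
  have hflt : ∀ τ ∈ I, f τ < 1 := fun τ hτ => by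
    have := (hsol τ hτ).side
    simp only [one_mul] at this
    linarith
  have hfc : ContinuousOn f (Ico t₀ T) := fun τ hτ =>
    ((hF.differentiableAt_deriv (hKJ τ hτ)).continuousAt.mul
      (hsol τ (hKI τ hτ)).speed.continuousAt).continuousWithinAt
  -- Once a' ≤ 0, f is the product of a decreasing nonpositive factor and an increasing positive
  -- one.
  have hfdec : ∀ x ∈ Ico t₀ T, ∀ y ∈ Ico t₀ T, x < y → f x ≤ 0 → f y < f x := by
    intro x hx y hy hxy h0
    have h1 := M.pos_R x (hKI x hx)
    have h2 := hRmono (hKI x hx) (hKI y hy) hxy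
    have h3 := hanti (hKJ x hx) (hKJ y hy) hxy
    have h4 : deriv a x ≤ 0 := by
      by_contra! h5
      exact (mul_pos h5 h1).not_ge h0
    simp only [hf]
    nlinarith
  have hfneg : ∀ τ ∈ Ico t₀ T, f τ < 0 → deriv a τ < 0 := fun τ hτ h0 => by
    have h1 := M.pos_R τ (hKI τ hτ)
    by_contra! h5
    exact (mul_nonneg h5 h1.le).not_gt h0
  have hKev : ∀ᶠ t in 𝓝[<] T, t ∈ Ico t₀ T := Ico_mem_nhdsLT ht₀T
  have hR₀ := M.pos_R t₀ ht₀
  have hfend : ∃ t ∈ Ico t₀ T, f t < -1 := by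
    obtain ⟨t, h1, h2⟩ := (hKev.and ((tendsto_deriv hΛ hγ₀ hA
      haA').eventually_lt_atBot (-(1 / R t₀)))).exists
    refine ⟨t, h1, ?_⟩
    have h3 : R t₀ ≤ R t := hRmono.monotoneOn ht₀ (hKI t h1) h1.1
    have h4 : -(1 / R t₀) * R t₀ = -1 := by field_simp
    have h5 : deriv a t < 0 := h2.trans (by
      have : 0 < 1 / R t₀ := by positivity
      linarith)
    simp only [hf]
    nlinarith
  obtain ⟨τH, hτH, hfH, hbefore, hafter⟩ :=
    exists_unique_crossing hfc hfdec (by norm_num : (-1 : ℝ) < 0) hf0.le hfend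
  have ht₀H : t₀ < τH := hτH.1.lt_of_ne fun h1 => by
    rw [← h1] at hfH
    exact hf0.ne' hfH
  have hafter' : ∀ τ ∈ Ico τH T, f τ ≤ -1 := fun τ hτ => by
    rcases hτ.1.eq_or_lt with h1 | h1
    · rw [← h1, hfH]
    · exact (hafter τ ⟨h1, hτ.2⟩).le
  have hHK : ∀ τ ∈ Ico τH T, τ ∈ Ico t₀ T := fun τ hτ => ⟨ht₀H.le.trans hτ.1, hτ.2⟩
  have hderr : ∀ τ ∈ I, HasDerivAt r (f τ + γ) τ := fun τ hτ => by
    simpa using (hsol τ hτ).radius_deriv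
  -- Since r' = f + γ, the radius is maximal where f crosses -γ, or at t₀ itself if f starts below
  -- that level.
  obtain ⟨τm, hτm, hexp, hcol⟩ : ∃ τm ∈ Ico t₀ T, (∀ t ∈ Ico t₀ τm, -γ < f t) ∧
      ∀ t ∈ Ioo τm T, f t < -γ := by
    rcases le_or_gt (-γ) (f t₀) with h1 | h1
    · obtain ⟨t, h2, h3⟩ := hfend
      obtain ⟨τm, h4, -, h5, h6⟩ := exists_unique_crossing hfc hfdec (neg_lt_zero.2 hγ₀) h1
        ⟨t, h2, h3.trans (by linarith)⟩
      exact ⟨τm, h4, h5, h6⟩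
    · refine ⟨t₀, ⟨le_rfl, ht₀T⟩, fun t ht => absurd ht.2 (not_lt.2 ht.1), fun t ht => ?_⟩
      exact (hfdec t₀ ⟨le_rfl, ht₀T⟩ t ⟨ht.1.le, ht.2⟩ ht.1 (by linarith)).trans h1
  have hcolK : ∀ t ∈ Ico τm T, t ∈ Ico t₀ T := fun t ht => ⟨hτm.1.trans ht.1, ht.2⟩
  have hcollapses : StrictAntiOn r (Ico τm T) := by
    refine strictAntiOn_of_deriv_neg (convex_Ico _ _)
      (fun t ht => (hderr t (hKI t (hcolK t ht))).continuousAt.continuousWithinAt) fun t ht => ?_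
    rw [interior_Ico] at ht
    rw [(hderr t (hKI t (hcolK t ⟨ht.1.le, ht.2⟩))).deriv]
    linarith [hcol t ht]
  have hroot : ∀ τ, ∃ X, τ ∈ Ico τH T → r τ ≤ X ∧ chi Λ m (u τ) X = 0 := fun τ => by
    by_cases hτ : τ ∈ Ico τH T
    · have hτI := hKI τ (hHK τ hτ)
      obtain ⟨X, hX⟩ := exists_chi_eq_zero hΛ (M.pos_r τ hτI) (by
        rw [hchi τ hτI]
        have := hafter' τ hτ
        simp only [hf] at this
        nlinarith)
      exact ⟨X, fun _ => hX⟩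
    · exact ⟨0, fun h1 => absurd h1 hτ⟩
  choose rH hrH using hroot
  have hrHpos : ∀ τ ∈ Ico τH T, 0 < rH τ := fun τ hτ =>
    (M.pos_r τ (hKI τ (hHK τ hτ))).trans_le (hrH τ hτ).1
  have hchi_mono : ∀ τ ∈ I, StrictMonoOn (chi Λ m (u τ)) (Ioi 0) := fun τ hτ =>
    strictMonoOn_chi hΛ (hm0 τ hτ)
  have hchi_neg : ∀ τ ∈ Ico τH T, ∀ X ∈ Ico (r τ) (rH τ), chi Λ m (u τ) X < 0 := by
    intro τ hτ X hX
    rw [← (hrH τ hτ).2]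
    have hτI := hKI τ (hHK τ hτ)
    exact hchi_mono τ hτI ((M.pos_r τ hτI).trans_le hX.1) (hrHpos τ hτ) hX.2
  have hsin : ∀ ϑ ∈ Ioo 0 Real.pi, Real.sin ϑ ≠ 0 := fun ϑ hϑ => (Real.sin_pos_of_mem_Ioo hϑ).ne'
  have hbi : ∀ τ ∈ Ico t₀ τH, ∀ X ∈ Ioc 0 (R τ), ∀ ϑ ∈ Ioo 0 Real.pi, ∀ φ : ℝ,
      IsUntrapped (interiorMetric a) interiorTime ![τ, X, ϑ, φ] := by
    intro τ hτ X hX ϑ hϑ φ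
    have hτK : τ ∈ Ico t₀ T := ⟨hτ.1, hτ.2.trans hτH.2⟩
    refine isUntrapped_interior φ (hda τ (hKJ τ hτK)) (hpos τ (hKJ τ hτK)) hX.1 (hsin ϑ hϑ)
      (abs_lt.2 ?_)
    have h1 := hbefore τ hτ
    have h2 := hflt τ (hKI τ hτK)
    simp only [hf] at h1 h2
    rcases le_or_gt 0 (deriv a τ) with h3 | h3
    · exact ⟨by nlinarith [hX.1], (mul_le_mul_of_nonneg_left hX.2 h3).trans_lt h2⟩
    · exact ⟨h1.trans_le (mul_le_mul_of_nonpos_left hX.2 h3.le), by nlinarith [hX.1]⟩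
  have hbe : ∀ τ ∈ Ico t₀ τH, ∀ X ∈ Ici (r τ), ∀ ϑ ∈ Ioo 0 Real.pi, ∀ φ : ℝ,
      IsUntrapped (exteriorMetric Λ 1 m) (exteriorTime Λ 1 m) ![u τ, X, ϑ, φ] := by
    intro τ hτ X hX ϑ hϑ φ
    have hτK : τ ∈ Ico t₀ T := ⟨hτ.1, hτ.2.trans hτH.2⟩
    have hτI := hKI τ hτK
    have hr := M.pos_r τ hτI
    have hX0 : 0 < X := hr.trans_le hX
    refine isUntrapped_exterior φ (hmd τ hτI) hX0 (hsin ϑ hϑ) ?_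
    refine lt_of_lt_of_le ?_ ((hchi_mono τ hτI).monotoneOn hr hX0 hX)
    rw [hchi τ hτI]
    have h1 := hbefore τ hτ
    have h2 := hflt τ hτI
    simp only [hf] at h1 h2
    nlinarith
  have hdneg : ∀ τ ∈ Ico τH T, deriv a τ < 0 := fun τ hτ =>
    hfneg τ (hHK τ hτ) (by linarith [hafter' τ hτ])
  refine ⟨τm, τH, T, fun τ => -(deriv a τ)⁻¹, rH, ?_⟩
  refine
    { initial_int := hbi t₀ ⟨le_rfl, ht₀H⟩
      initial_ext := hbe t₀ ⟨le_rfl, ht₀H⟩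
      isLUB_end := ?_
      until_end := hend
      max_mem := hτm
      expands := ?_
      collapses := hcollapses
      to_zero := ?_
      singular := tendsto_density hΛ hγ₀ hA haA'
      horizon_mem := ⟨ht₀H, hτH.2⟩
      before_int := hbi
      before_ext := hbe
      cross_int := ?_
      cross_ext := ?_
      RH_mem := ?_
      RH_inside := ?_
      RH_on := ?_
      RH_outside := ?_
      rH_mem := ?_
      rH_inside := ?_
      rH_on := ?_
      rH_outside := ?_
      mass_pos := hm0
      asymptoticallyAdS := fun τ _ => isAsymptoticallyAdS_exteriorMetric Λ 1 m (u τ)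
      visible := ?_
      blackHole_int := ?_
      blackHole_ext := ?_ }
  · rw [hJ]
    exact isLUB_Ioo (by
      have h1 := hIJ ht₀
      rw [hJ] at h1
      exact h1.1.trans h1.2)
  · refine strictMonoOn_of_deriv_pos (convex_Icc _ _)
      (fun t ht => (hderr t (hKI t ⟨ht.1, ht.2.trans_lt hτm.2⟩)).continuousAt.continuousWithinAt)
      fun t ht => ?_
    rw [interior_Icc] at ht
    rw [(hderr t (hKI t ⟨ht.1.le, ht.2.trans hτm.2⟩)).deriv]
    linarith [hexp t ⟨ht.1.le, ht.2⟩]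
  · have hsub : ∀ t ∈ Ioo τm T, t ∈ Ico t₀ T := fun t ht => hcolK t ⟨ht.1.le, ht.2⟩
    refine tendsto_radius_zero (γ := γ) hτm.2 (fun t ht => hpos t (hKJ t (hsub t ht)))
      (fun t ht => (hda t (hKJ t (hsub t ht))).hasDerivAt)
      (fun t ht => hfneg t (hsub t ht) ((hcol t ht).trans (neg_lt_zero.2 hγ₀)))
      (fun t ht => (hderr t (hKI t (hsub t ht))).congr_deriv ?_)
      (fun t ht => M.pos_r t (hKI t (hsub t ht)))
      (hcollapses.antitoneOn.mono Ioo_subset_Ico_self)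
      ((tendsto_scaleFactor hω hγ₀ hA c).congr' ?_)
    · have := (hpos t (hKJ t (hsub t ht))).ne'
      rw [(hsol t (hKI t (hsub t ht))).radius]
      simp only [hf]
      field_simp
    · filter_upwards [eventually_mem_lifetime hω c] with t ht
      exact (haA' ht).symm
  · have h1 : deriv a τH * R τH = -1 := hfH
    have h2 := (hdneg τH ⟨le_rfl, hτH.2⟩).ne
    show -(deriv a τH)⁻¹ = R τH
    field_simp
    linarith
  · have hmem : τH ∈ Ico τH T := ⟨le_rfl, hτH.2⟩
    have hI' := hKI τH hτH
    refine (hchi_mono τH hI').injOn (hrHpos τH hmem) (M.pos_r τH hI') ?_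
    rw [(hrH τH hmem).2, hchi τH hI', show deriv a τH * R τH = -1 from hfH]
    norm_num
  · intro τ hτ
    have h1 := hdneg τ hτ
    have h2 : deriv a τ * R τ ≤ -1 := hafter' τ hτ
    refine ⟨neg_pos.2 (inv_lt_zero.2 h1), ?_⟩
    by_contra! h3
    have h4 := mul_lt_mul_of_neg_left h3 h1
    have h5 : deriv a τ * -(deriv a τ)⁻¹ = -1 := by
      have := h1.ne
      field_simp
    linarith
  · intro τ hτ X hX ϑ hϑ φ
    have h1 := hdneg τ hτ
    have h5 : deriv a τ * -(deriv a τ)⁻¹ = -1 := by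
      have := h1.ne
      field_simp
    have hτJ := hKJ τ (hHK τ hτ)
    refine isUntrapped_interior φ (hda τ hτJ) (hpos τ hτJ) hX.1 (hsin ϑ hϑ) (abs_lt.2 ⟨?_, ?_⟩)
    · have h4 := mul_lt_mul_of_neg_left hX.2 h1
      linarith
    · nlinarith [hX.1]
  · intro τ hτ ϑ hϑ φ
    have h1 := hdneg τ hτ
    have h5 : deriv a τ * -(deriv a τ)⁻¹ = -1 := by
      have := h1.ne
      field_simp
    have hτJ := hKJ τ (hHK τ hτ)
    exact isFutureMarginallyTrapped_interior φ (hda τ hτJ) (hpos τ hτJ)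
      (neg_pos.2 (inv_lt_zero.2 h1)) (hsin ϑ hϑ) h5
  · intro τ hτ X hX ϑ hϑ φ
    have h1 := hdneg τ hτ
    have h5 : deriv a τ * -(deriv a τ)⁻¹ = -1 := by
      have := h1.ne
      field_simp
    have hτJ := hKJ τ (hHK τ hτ)
    refine isFutureTrapped_interior φ (hda τ hτJ) (hpos τ hτJ)
      ((neg_pos.2 (inv_lt_zero.2 h1)).trans hX.1) (hsin ϑ hϑ) ?_
    have h4 := mul_lt_mul_of_neg_left hX.1 h1
    linarith
  · intro τ hτ
    have hmem : τ ∈ Ico τH T := ⟨hτ.1.le, hτ.2⟩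
    have hτI := hKI τ (hHK τ hmem)
    refine (hrH τ hmem).1.lt_of_ne fun h1 => ?_
    have h2 := (hrH τ hmem).2
    rw [← h1, hchi τ hτI] at h2
    have h3 : deriv a τ * R τ < -1 := hafter τ hτ
    nlinarith
  · intro τ hτ X hX ϑ hϑ φ
    have hτI := hKI τ (hHK τ hτ)
    exact isFutureTrapped_exterior φ (hmd τ hτI) ((M.pos_r τ hτI).trans_le hX.1) (hsin ϑ hϑ)
      (hchi_neg τ hτ X hX)
  · intro τ hτ ϑ hϑ φ
    exact isFutureMarginallyTrapped_exterior φ (hmd τ (hKI τ (hHK τ hτ))) (hrHpos τ hτ)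
      (hsin ϑ hϑ) (hrH τ hτ).2
  · intro τ hτ X hX ϑ hϑ φ
    have hτI := hKI τ (hHK τ hτ)
    have hX0 := (hrHpos τ hτ).trans hX
    refine isUntrapped_exterior φ (hmd τ hτI) hX0 (hsin ϑ hϑ) ?_
    rw [← (hrH τ hτ).2]
    exact hchi_mono τ hτI (hrHpos τ hτ) hX0 hX
  · exact fun τ hτ => isVisible_of_large hΛ a hI R hum M.smooth_u.continuousOn
      M.smooth_r.continuousOn hmmono hτ
  all_goals
    intro τ hτ X hX ϑ φ
    refine not_isVisible hΛ hmd hm' hm0 M.pos_r hum (τH := τH) (fun t ht htH => ?_) ?_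
  · have h1 : deriv a t * R t < -1 := hafter t ⟨htH, hJT t (hIJ ht)⟩
    rw [hchi t ht]
    nlinarith
  · exact hτ.1
  · have h1 : deriv a t * R t < -1 := hafter t ⟨htH, hJT t (hIJ ht)⟩
    rw [hchi t ht]
    nlinarith
  · exact ⟨⟨τ, hKI τ (hHK τ ⟨hτ.1.le, hτ.2⟩), hτ.1, rfl⟩, hchi_neg τ ⟨hτ.1.le, hτ.2⟩ X hX⟩

/-- The bound a'R < 1 persists up to the end of the interior: while a' > 0 because R - 1/a'
decreases, afterwards because a'R ≤ 0. The bound a'R > -1 serves only to start before the horizon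
forms. -/
theorem exists_collapse (hΛ : Λ < 0) (hγ₀ : 0 < γ) (hγ₁ : γ < 1) {J : Set ℝ} {a : ℝ → ℝ}
    (h : IsFLRWInterior Λ γ J a) {t₀ R₀ : ℝ} (ht₀ : t₀ ∈ J) (hR₀ : 0 < R₀)
    (h₀ : -1 < deriv a t₀ * R₀) (h₁ : deriv a t₀ * R₀ < 1) :
    ∃ (I : Set ℝ) (R u r m : ℝ → ℝ),
      IsOpenInterval I ∧ I ⊆ J ∧ t₀ ∈ I ∧ R t₀ = R₀ ∧ Matches a Λ 1 1 I R u r m ∧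
      InteriorDEC Λ J a ∧ ExteriorDEC 1 (u '' I) m ∧ deriv r t₀ = deriv a t₀ * R₀ + γ ∧
      ∃ (τm τH T : ℝ) (RH rH : ℝ → ℝ), FormsBlackHole Λ J a t₀ I R u r m τm τH T RH rH := by
  have hF := h.toIsFlatFLRW
  have hs : IsSign 1 := Or.inl rfl
  have hcont : ContinuousOn (fun τ => 1 * 1 * γ / a τ) J :=
    continuousOn_const.div hF.smooth.continuousOn fun τ hτ => (hF.pos τ hτ).ne'
  obtain ⟨F, hF'⟩ := exists_primitive hF.interval hcont
  set R : ℝ → ℝ := fun τ => R₀ - F t₀ + F τ with hRdef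
  have hR : ∀ τ ∈ J, HasDerivAt R (1 * 1 * γ / a τ) τ := fun τ hτ => (hF' τ hτ).const_add _
  have hRt : R t₀ = R₀ := by simp [hRdef]
  have hRm : StrictMonoOn R J := strictMonoOn_of_hasDerivAt_pos hF.interval.2.2 hR fun τ hτ => by
    have := hF.pos τ hτ
    positivity
  have hmem : t₀ ∈ matchingTimes J a 1 1 R := by
    refine ⟨ht₀, by rwa [hRt], ?_⟩
    rw [hRt]
    linarith
  have hI : IsOpenInterval (matchingTimes J a 1 1 R) :=
    ⟨⟨t₀, hmem⟩, isOpen_matchingTimes hF fun τ hτ => (hR τ hτ).continuousAt.continuousWithinAt,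
      ordConnected_matchingTimes hΛ hγ₀ hF hs hs hR⟩
  have hIJ : matchingTimes J a 1 1 R ⊆ J := fun τ hτ => hτ.1
  have hend : ∀ τ ∈ J, t₀ ≤ τ → τ ∈ matchingTimes J a 1 1 R := by
    intro τ hτ hle
    rcases hle.eq_or_lt with rfl | hlt
    · exact hmem
    have hRτ : 0 < R τ := hR₀.trans (hRt ▸ hRm ht₀ hτ hlt)
    refine ⟨hτ, hRτ, ?_⟩
    rcases le_or_gt (deriv a τ) 0 with h2 | h2
    · have := mul_nonpos_of_nonpos_of_nonneg h2 hRτ.le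
      linarith
    · have h3 := hF.crossing_lt hΛ hγ₀ (by norm_num : ((1 : ℝ) * 1) ^ 2 = 1) hR ht₀ hτ hlt
        (Or.inl h2)
      have h4 := h2.trans (hF.strictAntiOn_deriv hΛ hγ₀ ht₀ hτ hlt)
      have h5 : R t₀ - (deriv a t₀)⁻¹ < 0 := by
        rw [hRt, sub_neg, ← one_div, lt_div_iff₀ h4]
        linarith
      have h6 : R τ < 1 / deriv a τ := by
        rw [one_div]
        linarith
      rw [lt_div_iff₀ h2] at h6
      linarith
  obtain ⟨u, r, m, M⟩ := exists_matches hγ₀ hγ₁ hF hs hs hI hIJ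
    (fun τ hτ => hR τ (hIJ hτ)) (fun τ hτ => hτ.2.1) (fun τ hτ => hτ.2.2)
  have hsol := fun τ hτ => M.isSolution hΛ hγ₀ hF hs hs hI.2.1 hIJ (τ := τ) hτ
  refine ⟨_, R, u, r, m, hI, hIJ, hmem, hRt, M, hF.interiorDEC hΛ hγ₀ hγ₁,
    IsSolution.exteriorDEC hΛ hγ₀ hs hs M.future_u hsol, ?_,
    exists_formsBlackHole hΛ hγ₀ hγ₁ h hI hIJ hmem hend M (by rwa [hRt])⟩
  rw [(hsol t₀ hmem).radius_deriv.deriv, hRt]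
  ring

/-! ### Open sets of initial data -/

/-- Data with `α < a' R < β`. -/
def dataSet (α β : ℝ) : Set (ℝ × ℝ × ℝ) :=
  {d | 0 < d.1 ∧ 0 < d.2.2 ∧ α < d.2.1 * d.2.2 ∧ d.2.1 * d.2.2 < β}

theorem isOpen_dataSet (α β : ℝ) : IsOpen (dataSet α β) := by
  have h1 : IsOpen {d : ℝ × ℝ × ℝ | 0 < d.1} := isOpen_lt continuous_const (by fun_prop)
  have h2 : IsOpen {d : ℝ × ℝ × ℝ | 0 < d.2.2} := isOpen_lt continuous_const (by fun_prop)
  have h3 : IsOpen {d : ℝ × ℝ × ℝ | α < d.2.1 * d.2.2} := isOpen_lt continuous_const (by fun_prop)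
  have h4 : IsOpen {d : ℝ × ℝ × ℝ | d.2.1 * d.2.2 < β} := isOpen_lt (by fun_prop) continuous_const
  exact h1.inter (h2.inter (h3.inter h4))

/-- Every interior has a contracting phase. As α < 0, a negative value v can be chosen between the
bounds, and R = v/a' is then positive. -/
theorem exists_mem_dataSet (hΛ : Λ < 0) (hγ₀ : 0 < γ) {α β : ℝ} (hα : α < 0) (hαβ : α < β)
    {J : Set ℝ} {a : ℝ → ℝ} (h : IsFLRWInterior Λ γ J a) :
    ∃ t₀ ∈ J, ∃ R₀ : ℝ, (a t₀, deriv a t₀, R₀) ∈ dataSet α β := by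
  obtain ⟨t, ht, hd⟩ := h.exists_deriv_sign hΛ hγ₀ (Or.inr rfl : IsSign (-1))
  have hd' : deriv a t < 0 := by linarith
  obtain ⟨v, hv1, hv2⟩ := exists_between (lt_min hα hαβ)
  refine ⟨t, ht, v / deriv a t, h.pos t ht,
    div_pos_of_neg_of_neg (hv2.trans_le (min_le_left _ _)) hd', ?_⟩
  show α < deriv a t * (v / deriv a t) ∧ deriv a t * (v / deriv a t) < β
  rw [mul_div_cancel₀ _ hd'.ne]
  exact ⟨hv1, hv2.trans_le (min_le_right _ _)⟩

/-- The open set of data that collapse (`w = -1`) or expand and recollapse (`w = 1`). -/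
theorem exists_collapse_data (hΛ : Λ < 0) (hγ₀ : 0 < γ) (hγ₁ : γ < 1) {α β w : ℝ} (hα : α < 0)
    (hαβ : α < β) (hα₁ : -1 ≤ α) (hβ₁ : β ≤ 1)
    (hw : ∀ v, α < v → v < β → 0 < w * (v + γ)) : ∃ U : Set (ℝ × ℝ × ℝ), IsOpen U ∧ U.Nonempty ∧
      (∀ d ∈ U, ∃ (J : Set ℝ) (a : ℝ → ℝ) (t₀ : ℝ), IsFLRWInterior Λ γ J a ∧
        t₀ ∈ J ∧ a t₀ = d.1 ∧ deriv a t₀ = d.2.1) ∧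
      (∀ (J : Set ℝ) (a : ℝ → ℝ), IsFLRWInterior Λ γ J a →
        ∃ t₀ ∈ J, ∃ R₀ : ℝ, (a t₀, deriv a t₀, R₀) ∈ U) ∧
      (∀ (J : Set ℝ) (a : ℝ → ℝ) (t₀ R₀ : ℝ), IsFLRWInterior Λ γ J a → t₀ ∈ J →
        (a t₀, deriv a t₀, R₀) ∈ U →
        ∃ (I : Set ℝ) (R u r m : ℝ → ℝ),
          IsOpenInterval I ∧ I ⊆ J ∧ t₀ ∈ I ∧ R t₀ = R₀ ∧
          Matches a Λ 1 1 I R u r m ∧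
          InteriorDEC Λ J a ∧ ExteriorDEC 1 (u '' I) m ∧
          0 < w * deriv r t₀ ∧
          ∃ (τm τH T : ℝ) (RH rH : ℝ → ℝ),
            FormsBlackHole Λ J a t₀ I R u r m τm τH T RH rH) := by
  refine ⟨dataSet α β, isOpen_dataSet α β, ?_, fun d hd => exists_isFLRWInterior hΛ hγ₀ hd.1 d.2.1,
    fun J a h => exists_mem_dataSet hΛ hγ₀ hα hαβ h, ?_⟩
  · obtain ⟨t, _, R, hR⟩ := exists_mem_dataSet hΛ hγ₀ hα hαβ
      (isFLRWInterior_scaleFactor hΛ hγ₀ one_pos 0)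
    exact ⟨_, hR⟩
  · rintro J a t₀ R₀ h ht₀ ⟨-, hR₀, h1, h2⟩
    obtain ⟨I, R, u, r, m, i1, i2, i3, i4, i5, i6, i7, i8, i9⟩ := exists_collapse hΛ hγ₀ hγ₁ h ht₀
      hR₀ (hα₁.trans_lt h1) (h2.trans_le hβ₁)
    exact ⟨I, R, u, r, m, i1, i2, i3, i4, i5, i6, i7, by rw [i8]; exact hw _ h1 h2, i9⟩

end CollapseModel

end

theorem theorem2 (Λ γ : ℝ) (hΛ : Λ < 0) (hγ₀ : 0 < γ) (hγ₁ : γ < 1) :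
    -- existence and completeness of the one-parameter family, energy conditions, uniqueness
    (∀ (J : Set ℝ) (a : ℝ → ℝ), CollapseModel.IsFLRWInterior Λ γ J a →
      ∀ ε s : ℝ, CollapseModel.IsSign ε → CollapseModel.IsSign s →
      ∃ (P : Set ℝ) (R : ℝ → ℝ → ℝ) (I : ℝ → Set ℝ),
        CollapseModel.IsOpenInterval P ∧
        (∀ c c' τ : ℝ, τ ∈ J → R c τ - R c' τ = c - c') ∧
        (∀ c ∈ P, CollapseModel.IsOpenInterval (I c) ∧ I c ⊆ J ∧
          ∃ u r m : ℝ → ℝ, CollapseModel.Matches a Λ ε s (I c) (R c) u r m ∧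
            CollapseModel.InteriorDEC Λ J a ∧ CollapseModel.ExteriorDEC ε (u '' I c) m) ∧
        (∀ (I' : Set ℝ) (R' u' r' m' : ℝ → ℝ), CollapseModel.IsOpenInterval I' → I' ⊆ J →
          CollapseModel.Matches a Λ ε s I' R' u' r' m' →
          ∃ c ∈ P, I' ⊆ I c ∧ Set.EqOn R' (R c) I') ∧
        (∀ c ∈ P, ∀ I' : Set ℝ, CollapseModel.IsOpenInterval I' → I' ⊆ I c →
          ∀ u r m : ℝ → ℝ, CollapseModel.Matches a Λ ε s I' (R c) u r m →
          ∀ ε' s' : ℝ, CollapseModel.IsSign ε' → CollapseModel.IsSign s' →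
          ∀ u' r' m' : ℝ → ℝ, CollapseModel.Matches a Λ ε' s' I' (R c) u' r' m' →
            ε' = ε ∧ s' = s ∧ ∃ κ : ℝ, ∀ τ ∈ I',
              u' τ = u τ + κ ∧ r' τ = r τ ∧ m' (u τ + κ) = m (u τ))) ∧
    -- for ε = s = 1: open sets of initial data `(a, da/dt, R)` that collapse (`w = -1`), or that
    -- expand first and then recollapse (`w = 1`), to a black hole
    (∀ w : ℝ, CollapseModel.IsSign w → ∃ U : Set (ℝ × ℝ × ℝ), IsOpen U ∧ U.Nonempty ∧
      (∀ d ∈ U, ∃ (J : Set ℝ) (a : ℝ → ℝ) (t₀ : ℝ), CollapseModel.IsFLRWInterior Λ γ J a ∧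
        t₀ ∈ J ∧ a t₀ = d.1 ∧ deriv a t₀ = d.2.1) ∧
      (∀ (J : Set ℝ) (a : ℝ → ℝ), CollapseModel.IsFLRWInterior Λ γ J a →
        ∃ t₀ ∈ J, ∃ R₀ : ℝ, (a t₀, deriv a t₀, R₀) ∈ U) ∧
      (∀ (J : Set ℝ) (a : ℝ → ℝ) (t₀ R₀ : ℝ), CollapseModel.IsFLRWInterior Λ γ J a → t₀ ∈ J →
        (a t₀, deriv a t₀, R₀) ∈ U →
        ∃ (I : Set ℝ) (R u r m : ℝ → ℝ),
          CollapseModel.IsOpenInterval I ∧ I ⊆ J ∧ t₀ ∈ I ∧ R t₀ = R₀ ∧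
          CollapseModel.Matches a Λ 1 1 I R u r m ∧
          CollapseModel.InteriorDEC Λ J a ∧ CollapseModel.ExteriorDEC 1 (u '' I) m ∧
          0 < w * deriv r t₀ ∧
          ∃ (τm τH T : ℝ) (RH rH : ℝ → ℝ),
            CollapseModel.FormsBlackHole Λ J a t₀ I R u r m τm τH T RH rH)) := by
  refine ⟨fun J a h ε s hε hs => CollapseModel.exists_matching_family hΛ hγ₀ hγ₁ h hε hs,
    fun w hw => ?_⟩
  rcases hw with rfl | rfl
  -- The value -γ separates the two data sets because r' = a'R + γ at t₀; the outer bounds ±1 keep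
  -- the initial surface untrapped.
  · exact CollapseModel.exists_collapse_data hΛ hγ₀ hγ₁ (α := -γ) (β := 1) (by linarith)
      (by linarith) (by linarith) le_rfl fun v h1 _ => by linarith
  · exact CollapseModel.exists_collapse_data hΛ hγ₀ hγ₁ (α := -1) (β := -γ) (by linarith)
      (by linarith) le_rfl (by linarith) fun v _ h2 => by linarith
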